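/- **Definitions.** A real symmetric matrix $A=(a_{ij})$ (finite, with $a_{ii}=-2$) is *fundamental* if for all $i\ne j$ one has $a_{ij}\ge 0$, and $a_{ij}=2\cos(\pi/m_{ij})$ with an integer $m_{ij}\ge 2$ whenever $a_{ij}<2$. Its *Gram graph* has the indices as vertices, with $i\neq j$ joined iff $a_{ij}\ne 0$. The matrix (or a set of indices) is *hyperbolic* if the form $\sum a_{ij}X_iY_j$ modulo its kernel has signature $(1,r)$ for some $r$. The *ground field* of $A$ is the subfield $\mathbb K\subset\mathbb R$ generated over $\mathbb Q$ by all cyclic products $a_{i_1i_2}a_{i_2i_3}\cdots a_{i_{m-1}i_m}a_{i_mi_1}$. The matrix $A$ is *V-arithmetic* if it is fundamental and hyperbolic, all its cyclic products are algebraic integers, $\widetilde{\mathbb K}=\mathbb Q(\{a_{ij}\})$ is a totally real number field, and for every embedding $\widetilde{\mathbb K}\to\mathbb R$ that is not the identity on $\mathbb K$ the conjugate form is negative definite (modulo its kernel). It has *minimality* $t$ if $a_{ij}<t$ for all $i,j$. Let $\Phi$ be a real form of signature $(1,n)$ and $V^+$ a half of the cone $\{x^2>0\}$. A *fundamental chamber*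 is $\mathcal M=\{x\in V^+ : x\cdot e\ge 0 \text{ for all } e\in P(\mathcal M)\}$ modulo positive scaling, where $P(\mathcal M)$ is the finite set of the vectors of square $-2$ orthogonal to its codimension-one faces, and its Gram matrix $(e\cdot e')_{e,e'\in P(\mathcal M)}$ is fundamental. It is a (finite) *edge chamber* if it has a one-dimensional edge with finite vertices $v_1\ne v_2$ such that the hyperplane orthogonal to each $e\in P(\mathcal M)$ contains $v_1$ or $v_2$. Properties of the Gram matrix are attributed to the chamber. Put $\mathbb F L^4=\{\mathbb Q,\mathbb Q(\sqrt2),\mathbb Q(\sqrt5)\}$ and $$\mathbb F T=\{\mathbb Q\}\cup\{\mathbb Q(\sqrt a): a=2,3,5,6\}\cup\{\mathbb Q(\sqrt2,\sqrt3),\mathbb Q(\sqrt2,\sqrt5)\}\cup\{\mathbb Q(\cos\tfrac{2\pi}{b}): b=7,9,11,15,16,20\}.$$ For $i=1,\dots,5$ and $t>0$ let $\mathbb F\Gamma^{(4)}_i(t)$ be the set of ground fields of the V-arithmetic three-dimensional finite edge chambers with four faces $e_1,e_2,f,g$ such that $2<u<t$ for $u=e_1\cdot e_2$ and such that, for some integers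 $s,k,r,p$, the other products are as follows, where $w(m)=2\cos(\pi/m)$ and unlisted products of distinct vectors are $0$: 1. $e_1f=w(s),\ e_1g=w(r),\ e_2f=w(k),\ e_2g=w(p)$ with $s,k,r,p\ge3$; 2. $e_1f=w(s),\ e_2f=w(k),\ fg=w(p)$ with $s,k,p\ge3$; 3. $e_1f=w(s),\ e_2g=w(k),\ fg=w(r)$ with $s\ge2$ and $k,r\ge3$; 4. $e_1f=w(s),\ e_1g=w(r),\ e_2f=w(k)$ with $k\ge2$ and $s,r\ge3$; 5. $e_1f=w(k),\ e_2g=w(s)$ with $k,s\ge3$. Call $N\in\mathbb N$ a *degree constant* for $t$ if for every V-arithmetic edge chamber of minimality $t$ whose ground field has degree greater than $N$ over $\mathbb Q$, the hyperbolic connected component of the Gram graph has less than $4$ vertices. **Proposition.** (a) Let $t>0$. The ground field of every V-arithmetic edge chamber of minimality $t$ whose Gram graph has a hyperbolic connected component with at least $4$ vertices belongs to $\mathbb F L^4$, to $\mathbb F T$, or to $\mathbb F\Gamma^{(4)}_i(t)$ for some $i\in\{1,\dots,5\}$. (b) For every $t>0$, a degree constant for $t$ exists if and only if the sets $\mathbb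 F\Gamma^{(4)}_i(t)$, $i=1,\dots,5$, are all finite. (c) The equivalence is effective: for every $t>0$ and every integer $N\ge5$, $N$ is a degree constant for $t$ if and only if $[\mathbb K:\mathbb Q]\le N$ for all $\mathbb K\in\bigcup_i\mathbb F\Gamma^{(4)}_i(t)$. Consequently there is a computable function $N:\mathbb N\to\mathbb N$ such that $N(\lceil t\rceil)$ is a degree constant for every real $t>0$ if and only if all the sets $\mathbb F\Gamma^{(4)}_i(t)$, $t>0$, $i=1,\dots,5$, are finite and there is a computable function $N:\mathbb N\to\mathbb N$ such that for every $t>0$ the degrees of their fields are at most $N(\lceil t\rceil)$. -/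

import Mathlib

namespace VArith

/-! ### Fundamental matrices, their Gram graphs, ground fields, V-arithmeticity -/

section Matrices

variable {ι : Type}

/-- A fundamental matrix: a symmetric real matrix with diagonal `-2` and non-negative off-diagonal
entries, each of which is at least `2` or of the form `2 cos (π / m)` for an integer `m ≥ 2`. -/
def IsFundamental (A : Matrix ι ι ℝ) : Prop :=
  A.IsSymm ∧ (∀ i, A i i = -2) ∧
    ∀ i j, i ≠ j → 0 ≤ A i j ∧
      (A i j < 2 → ∃ m : ℕ, 2 ≤ m ∧ A i j = 2 * Real.cos (Real.pi / m))

/-- The (underlying simple graph of the) Gram graph: distinct `i`, `j` are joined if and only if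
`A i j ≠ 0`. -/
def gramGraph (A : Matrix ι ι ℝ) : SimpleGraph ι :=
  SimpleGraph.fromRel fun i j => A i j ≠ 0

/-- The form `∑ a_{ij} X_i Y_j` modulo its kernel has signature `(1, r)` for some `r`. -/
def IsHyperbolic [Fintype ι] (A : Matrix ι ι ℝ) : Prop :=
  letI := Classical.decEq ι
  sigPos (Matrix.toQuadraticForm' A) = 1

/-- The form `∑ a_{ij} X_i Y_j` modulo its kernel is negative definite. -/
def IsNegDefModKernel [Fintype ι] (A : Matrix ι ι ℝ) : Prop :=
  ∀ v : ι → ℝ, Matrix.mulVec A v ≠ 0 → v ⬝ᵥ Matrix.mulVec A v < 0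

/-- The cyclic product `a_{i₀ i₁} a_{i₁ i₂} ⋯ a_{iₘ i₀}` (addition in `Fin (m + 1)` is cyclic). -/
noncomputable def cyclicProduct (A : Matrix ι ι ℝ) {m : ℕ} (i : Fin (m + 1) → ι) : ℝ :=
  ∏ k, A (i k) (i (k + 1))

/-- The field generated over `ℚ` by all entries of `A`. -/
noncomputable def entryField (A : Matrix ι ι ℝ) : IntermediateField ℚ ℝ :=
  IntermediateField.adjoin ℚ {x | ∃ i j, x = A i j}

/-- The ground field: the field generated over `ℚ` by all cyclic products of `A`. -/
noncomputable def groundField (A : Matrix ι ι ℝ) : IntermediateField ℚ ℝ :=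
  IntermediateField.adjoin ℚ {x | ∃ (m : ℕ) (i : Fin (m + 1) → ι), x = cyclicProduct A i}

/-- The entry `A i j` as an element of the field of entries. -/
noncomputable def entry (A : Matrix ι ι ℝ) (i j : ι) : entryField A :=
  ⟨A i j, IntermediateField.subset_adjoin ℚ _ ⟨i, j, rfl⟩⟩

/-- The real matrix obtained by applying an embedding of the field of entries to all entries. -/
noncomputable def conjugate (A : Matrix ι ι ℝ) (σ : entryField A →+* ℝ) : Matrix ι ι ℝ :=
  Matrix.of fun i j => σ (entry A i j)

/-- V-arithmetic matrices: fundamental matrices with hyperbolic form that satisfy Vinberg's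
arithmeticity conditions (finite volume is not required). -/
structure IsVArithmetic [Fintype ι] (A : Matrix ι ι ℝ) : Prop where
  fundamental : IsFundamental A
  hyperbolic : IsHyperbolic A
  integral : ∀ (m : ℕ) (i : Fin (m + 1) → ι), IsIntegral ℤ (cyclicProduct A i)
  numberField : NumberField (entryField A)
  totallyReal : NumberField.IsTotallyReal (entryField A)
  negDef : ∀ σ : entryField A →+* ℝ,
    (∃ x : entryField A, (x : ℝ) ∈ groundField A ∧ σ x ≠ (x : ℝ)) →
      IsNegDefModKernel (conjugate A σ)

/-- Minimality `t`: all entries are less than `t`. -/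
def HasMinimality (A : Matrix ι ι ℝ) (t : ℝ) : Prop :=
  ∀ i j, A i j < t

open scoped Classical in
/-- The connected component `C` of the Gram graph of `A` is hyperbolic. -/
def IsHyperbolicComponent [Fintype ι] (A : Matrix ι ι ℝ)
    (C : (gramGraph A).ConnectedComponent) : Prop :=
  IsHyperbolic (A.submatrix (fun i : C.supp => (i : ι)) (fun i : C.supp => (i : ι)))

end Matrices

/-! ### Fundamental chambers in hyperbolic space -/

/-- A fundamental chamber in the Klein model of the `n`-dimensional hyperbolic space attached to a
form of signature `(1, n)`. The half `V⁺` of the cone `{x | x² > 0}` is the one that contains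
`base`; points of the hyperbolic space are rays in `V⁺`. The family `normal` lists all vectors of
square `-2` that are orthogonal to the codimension one faces of the chamber
`{x ∈ V⁺ | x · normal i ≥ 0 for all i}`; the condition `facet` says that each of the hyperplanes
does cut out a codimension one face. -/
structure FundamentalChamber (n : ℕ) (ι : Type) where
  form : LinearMap.BilinForm ℝ (Fin (n + 1) → ℝ)
  form_symm : ∀ x y, form x y = form y x
  sigPos_form : sigPos (LinearMap.BilinMap.toQuadraticMap form) = 1
  sigNeg_form : sigNeg (LinearMap.BilinMap.toQuadraticMap form) = n
  base : Fin (n + 1) → ℝ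
  base_pos : 0 < form base base
  normal : ι → Fin (n + 1) → ℝ
  facet : ∀ i, ∃ x, 0 < form x x ∧ 0 < form base x ∧ form x (normal i) = 0 ∧
    ∀ j, j ≠ i → 0 < form x (normal j)
  fundamental : IsFundamental (Matrix.of fun i j => form (normal i) (normal j))

namespace FundamentalChamber

variable {n : ℕ} {ι : Type} (M : FundamentalChamber n ι)

/-- The Gram matrix of the chamber. -/
noncomputable def gram : Matrix ι ι ℝ :=
  Matrix.of fun i j => M.form (M.normal i) (M.normal j)

/-- The chamber, as a set of vectors in the open half-cone `V⁺` (a union of rays). -/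
def carrier : Set (Fin (n + 1) → ℝ) :=
  {x | 0 < M.form x x ∧ 0 < M.form M.base x ∧ ∀ i, 0 ≤ M.form x (M.normal i)}

/-- `[v]` is a (finite) vertex of the chamber: a point of the chamber which is the only common
point of the hyperplanes through it. -/
def IsVertex (v : Fin (n + 1) → ℝ) : Prop :=
  v ∈ M.carrier ∧
    ∀ x, (∀ i, M.form v (M.normal i) = 0 → M.form x (M.normal i) = 0) → ∃ c : ℝ, x = c • v

/-- `[v]`, `[w]` are the two distinct (finite) vertices of a one-dimensional edge of the chamber:
the hyperplanes that contain both of them intersect in the line through `[v]` and `[w]`. -/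
def IsEdge (v w : Fin (n + 1) → ℝ) : Prop :=
  M.IsVertex v ∧ M.IsVertex w ∧ (∀ c : ℝ, w ≠ c • v) ∧
    ∀ x, (∀ i, M.form v (M.normal i) = 0 → M.form w (M.normal i) = 0 →
      M.form x (M.normal i) = 0) → ∃ a b : ℝ, x = a • v + b • w

/-- A (finite) edge chamber: the chamber has an edge with finite vertices `[v]`, `[w]` such that
every hyperplane of a codimension one face contains `[v]` or `[w]`. -/
def IsEdgeChamber : Prop :=
  ∃ v w, M.IsEdge v w ∧ ∀ i, M.form v (M.normal i) = 0 ∨ M.form w (M.normal i) = 0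

end FundamentalChamber

/-! ### The sets of fields -/

/-- The fields `ℚ`, `ℚ(√2)`, `ℚ(√5)`. -/
def fieldsL4 : Set (IntermediateField ℚ ℝ) :=
  {⊥, IntermediateField.adjoin ℚ {√(2 : ℝ)}, IntermediateField.adjoin ℚ {√(5 : ℝ)}}

/-- The 13 ground fields of arithmetic triangle groups. -/
def fieldsT : Set (IntermediateField ℚ ℝ) :=
  {⊥} ∪ {K | ∃ a ∈ ({2, 3, 5, 6} : Set ℕ), K = IntermediateField.adjoin ℚ {√(a : ℝ)}} ∪
    {IntermediateField.adjoin ℚ {√(2 : ℝ), √(3 : ℝ)},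
      IntermediateField.adjoin ℚ {√(2 : ℝ), √(5 : ℝ)}} ∪
    {K | ∃ b ∈ ({7, 9, 11, 15, 16, 20} : Set ℕ),
      K = IntermediateField.adjoin ℚ {Real.cos (2 * Real.pi / b)}}

/-- The entry of a fundamental matrix for two faces at the angle `π / m`. -/
noncomputable def wt (m : ℕ) : ℝ := 2 * Real.cos (Real.pi / m)

/-- The five types of graphs with vertices `e₁`, `e₂`, `f`, `g` (in this order), in which `e₁`,
`e₂` are joined by a broken edge of weight `u`, given by their Gram matrices.
Type 1: `f` and `g` are both joined with `e₁` and `e₂`, and not with each other.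
Type 2: `f` is joined with `e₁`, `e₂` and `g`; `g` is joined with `f` only.
Type 3: `f` and `g` are joined, `g` is joined with `e₂`, and `f` is joined with `e₁` if `s ≥ 3`.
Type 4: `f` and `g` are joined with `e₁`, not with each other; `f` is joined with `e₂` if `k ≥ 3`.
Type 5: `f` is joined with `e₁` only, `g` is joined with `e₂` only. -/
def IsGamma (i : Fin 5) (u : ℝ) (A : Matrix (Fin 4) (Fin 4) ℝ) : Prop :=
  match i with
  | 0 => ∃ s k r p : ℕ, 3 ≤ s ∧ 3 ≤ k ∧ 3 ≤ r ∧ 3 ≤ p ∧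
      A = !![-2, u, wt s, wt r;
             u, -2, wt k, wt p;
             wt s, wt k, -2, 0;
             wt r, wt p, 0, -2]
  | 1 => ∃ s k p : ℕ, 3 ≤ s ∧ 3 ≤ k ∧ 3 ≤ p ∧
      A = !![-2, u, wt s, 0;
             u, -2, wt k, 0;
             wt s, wt k, -2, wt p;
             0, 0, wt p, -2]
  | 2 => ∃ s k r : ℕ, 2 ≤ s ∧ 3 ≤ k ∧ 3 ≤ r ∧
      A = !![-2, u, wt s, 0;
             u, -2, 0, wt k;
             wt s, 0, -2, wt r;
             0, wt k, wt r, -2]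
  | 3 => ∃ s k r : ℕ, 3 ≤ s ∧ 2 ≤ k ∧ 3 ≤ r ∧
      A = !![-2, u, wt s, wt r;
             u, -2, wt k, 0;
             wt s, wt k, -2, 0;
             wt r, 0, 0, -2]
  | 4 => ∃ k s : ℕ, 3 ≤ k ∧ 3 ≤ s ∧
      A = !![-2, u, wt k, 0;
             u, -2, 0, wt s;
             wt k, 0, -2, 0;
             0, wt s, 0, -2]

/-- The ground fields of the V-arithmetic finite edge chambers (of dimension 3, with four faces)
whose Gram graph is of type `i`, with `2 < u < t`. (The index `i : Fin 5` starts at `0`, so it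
stands for the type `i + 1`.) -/
def fieldsGamma (i : Fin 5) (t : ℝ) : Set (IntermediateField ℚ ℝ) :=
  {K | ∃ (M : FundamentalChamber 3 (Fin 4)) (u : ℝ), M.IsEdgeChamber ∧ IsVArithmetic M.gram ∧
    IsGamma i u M.gram ∧ 2 < u ∧ u < t ∧ K = groundField M.gram}

/-! ### The degree theorem for V-arithmetic edge chambers -/

/-- `N` is an admissible constant for `t` in the degree theorem: every V-arithmetic edge chamber of
minimality `t` whose ground field has degree greater than `N` over `ℚ` has a hyperbolic connected
component of its Gram graph with less than four elements. -/
def IsDegreeConstant (t : ℝ) (N : ℕ) : Prop :=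
  ∀ (n : ℕ) (ι : Type) [Fintype ι] (M : FundamentalChamber n ι),
    M.IsEdgeChamber → IsVArithmetic M.gram → HasMinimality M.gram t →
    N < Module.finrank ℚ (groundField M.gram) →
    ∀ C : (gramGraph M.gram).ConnectedComponent,
      IsHyperbolicComponent M.gram C → C.supp.ncard < 4

/-- `N` bounds the degrees over `ℚ` of all fields in the five sets `fieldsGamma i t`. -/
def IsGammaDegreeBound (t : ℝ) (N : ℕ) : Prop :=
  ∀ i : Fin 5, ∀ K ∈ fieldsGamma i t, Module.finrank ℚ K ≤ N

end VArith

/-! Exactly one face `e₁` of an edge chamber contains the vertex `v` but not `w`, and exactly one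
face `e₂` contains `w` but not `v`; all other faces contain the whole edge. The normals of the faces
through a finite point are linearly independent and orthogonal to a positive vector. Hence the Gram
matrix `A` is nondegenerate and becomes negative definite when either of `e₁`, `e₂` is deleted
(`IsEdgeChamber.exists_isEdgeMatrix`). All subgraphs that avoid `e₁` or `e₂` are thus spherical, and
only `u = A e₁ e₂` can reach `2`.

Nondegeneracy makes every conjugate that moves the ground field strictly negative definite. So a
subfield `F` of the field of entries contains the ground field as soon as the embeddings that fix
`F` preserve some evidence against negative definiteness (`IsVArithmetic.groundField_le`). The
evidence `u > 2` gives `ℚ(u²)`, `u = 2` gives `ℚ`, and a triangle of positive discriminant gives the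
field of that triangle.

If `u > 2`, the hyperbolic component contains four vertices `e₁, e₂, f, g` that span a connected
graph. A spherical triangle has a right angle, which leaves the five listed graphs. The
corresponding submatrix is the Gram matrix of a three-dimensional V-arithmetic edge chamber with the
same ground field `ℚ(u²)` (`IsEdgeMatrix.mem_fieldsGamma`).

If `u < 2`, either some triangle on `e₁, e₂` is not spherical, or all triples of the component are
spherical. In the second case all labels are at most `5` and the field lies in `ℚ(√2, √5)`. In the
first case the field is `ℚ` or that of a triangle satisfying Takeuchi's condition; a fourth vertex
makes it possible to choose this triangle with a right angle or with two labels at most `5`.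
Multiplying its angles by the least prime prime to its labels bounds the labels, and a kernel
computation finishes (`IsArithTri.right`, `IsArithTri.small`).

The fields in `fieldsT` have degree at most `5`, and the graphs of the five types are connected with
four vertices; this gives the equivalence of the two kinds of bounds. Bounded degree forces
finiteness because `u²` is an algebraic integer all of whose conjugates are bounded by `max (t²) 4`.
-/

namespace VArith

/-! ### Arithmetic triangles: finite bookkeeping -/

/-- `k ≡ ±1 mod p`. -/
def pmOne (k p : ℕ) : Bool := k % p == 1 % p || (k + 1) % p == 0

/-- Multiplication of angles by `k` fixes the squares of `wt p`, `wt q`, `wt r` and their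
product. -/
def fixesTri (k p q r : ℕ) : Bool :=
  pmOne k p && pmOne k q && pmOne k r &&
    (p == 2 || q == 2 || r == 2 || ((pmOne k (2 * p) == pmOne k (2 * q)) == pmOne k (2 * r)))

/-- `cos (π s / (2 M)) = 0`. -/
def cosZero (s M : ℕ) : Bool := (s + M) % (2 * M) == 0

/-- `cos (π s / (2 M)) ≤ 0`. -/
def cosNeg (s M : ℕ) : Bool := Nat.ble (2 * M) ((s + M) % (4 * M))

/-- The product of the cosines of `π s / (2 M)`, for four values of `s`, vanishes. -/
def prodZero (s t u v M : ℕ) : Bool := cosZero s M || cosZero t M || cosZero u M || cosZero v M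

/-- The product of the cosines of `π s / (2 M)`, for four values of `s`, is not negative, provided
that it does not vanish. -/
def prodPos (s t u v M : ℕ) : Bool :=
  (cosNeg s M == cosNeg t M) == (cosNeg u M == cosNeg v M)

/-- The discriminant of the triangle with angles `kπ/p`, `kπ/q`, `kπ/r` is not negative. -/
def discNonneg (k p q r : ℕ) : Bool :=
  prodZero (k * (q * r + p * r + p * q)) (k * (p * r + p * q + (4 * (p * q * r) - q * r)))
    (k * (q * r + p * q + (4 * (p * q * r) - p * r)))
    (k * (q * r + p * r + (4 * (p * q * r) - p * q))) (p * q * r) ||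
  prodPos (k * (q * r + p * r + p * q)) (k * (p * r + p * q + (4 * (p * q * r) - q * r)))
    (k * (q * r + p * q + (4 * (p * q * r) - p * r)))
    (k * (q * r + p * r + (4 * (p * q * r) - p * q))) (p * q * r)

/-- Two triangles have the same stabilizer among the residues prime to `N`. -/
def sameStabilizer (p q r p' q' r' : ℕ) : Bool :=
  (List.range (2 * Nat.lcm (Nat.lcm p (Nat.lcm q r)) (Nat.lcm p' (Nat.lcm q' r')))).all fun k =>
    !(Nat.gcd k (2 * Nat.lcm (Nat.lcm p (Nat.lcm q r)) (Nat.lcm p' (Nat.lcm q' r'))) == 1) ||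
      (fixesTri k p q r == fixesTri k p' q' r')

/-- Triangles that represent the thirteen fields of arithmetic triangles. -/
def triList : List (ℕ × ℕ × ℕ) :=
  [(2, 3, 2), (2, 3, 8), (2, 3, 12), (2, 3, 5), (3, 4, 6), (2, 8, 12), (2, 5, 8), (2, 3, 7),
    (2, 3, 9), (2, 3, 11), (2, 3, 15), (2, 3, 16), (2, 3, 20)]

/-- Either some `k` shows that the triangle is not arithmetic, or its field is known. -/
def triCheck (p q r : ℕ) : Bool :=
  Nat.ble (p * q * r) (q * r + p * r + p * q) ||
  ((List.range 60).any fun k => (Nat.gcd k (2 * (p * q * r)) == 1) && !fixesTri k p q r &&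
    discNonneg k p q r) ||
  triList.any fun T => sameStabilizer p q r T.1 T.2.1 T.2.2

/-- All right triangles `(2, q, r)` with `q < 4 k`, `r < 2 k q` and `P ∣ q r` are covered. -/
def rightCheck (k P : ℕ) : Bool :=
  (List.range (4 * k)).all fun q => Nat.blt q 3 ||
    (List.range (2 * k * q / (P / Nat.gcd P q) + 1)).all fun j =>
      Nat.blt (P / Nat.gcd P q * j) q || triCheck 2 q (P / Nat.gcd P q * j)

/-- All triangles `(a, b, m)` with `a`, `b` between `3` and `5`, `m < 60 k` and `P ∣ m` are
covered. -/
def smallCheck (k P : ℕ) : Bool :=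
  [3, 4, 5].all fun a => [3, 4, 5].all fun b => Nat.blt b a ||
    (List.range (60 * k / P + 1)).all fun j => Nat.blt (P * j) 3 || triCheck a b (P * j)

/-- If `k` is the least prime not dividing `2qr`, then `primorial (k - 1)` divides `2qr`; the second
argument is half of this primorial. Primes from `19` on are excluded by `le_primorial`. -/
theorem rightCheck_3 : rightCheck 3 1 = true := by decide +kernel
theorem rightCheck_5 : rightCheck 5 3 = true := by decide +kernel
theorem rightCheck_7 : rightCheck 7 15 = true := by decide +kernel
theorem rightCheck_11 : rightCheck 11 105 = true := by decide +kernel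
theorem rightCheck_13 : rightCheck 13 1155 = true := by decide +kernel
theorem rightCheck_17 : rightCheck 17 15015 = true := by decide +kernel
-- Here `k` is the least prime not dividing `30m`, and the second argument is `primorial (k - 1) /
-- 30`.
theorem smallCheck_7 : smallCheck 7 1 = true := by decide +kernel
theorem smallCheck_11 : smallCheck 11 7 = true := by decide +kernel
theorem smallCheck_13 : smallCheck 13 77 = true := by decide +kernel
theorem smallCheck_17 : smallCheck 17 1001 = true := by decide +kernel

end VArith

namespace VArith

open Real

/-! ### Arithmetic triangles: trigonometry -/

/-- Half of the determinant of the Gram matrix of a triangle with weights `a`, `b`, `c`. -/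
def disc (a b c : ℝ) : ℝ := a ^ 2 + b ^ 2 + c ^ 2 + a * b * c - 4

/-- The image of `wt p` under the multiplication of angles by `k`. -/
noncomputable def cwt (k p : ℕ) : ℝ := 2 * cos (k * (π / p))

/-- As a polynomial in its third argument, `disc` is a monic quadratic; for the first two arguments
`2 cos x`, `2 cos y` its roots are `-2 cos (x ± y)`. -/
theorem disc_two_cos (x y z : ℝ) : disc (2 * cos x) (2 * cos y) (2 * cos z) =
    4 * ((cos z + cos (x + y)) * (cos z + cos (x - y))) := by
  rw [cos_add, cos_sub, disc]
  have hx := sin_sq_add_cos_sq x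
  have hy := sin_sq_add_cos_sq y
  linear_combination (4 * sin y ^ 2 ) * hx + 4 * (1 - cos x ^ 2) * hy

/-- Sum-to-product leaves only cosines of single angles, whose signs at rational multiples of `π`
can be read off from residues. -/
theorem disc_two_cos_eq_prod (x y z : ℝ) : disc (2 * cos x) (2 * cos y) (2 * cos z) =
    16 * (cos ((x + y + z) / 2) * cos ((y + z - x) / 2) *
      (cos ((x + z - y) / 2) * cos ((x + y - z) / 2))) := by
  rw [disc_two_cos, cos_add_cos, cos_add_cos]
  rw [show (z + (x + y)) / 2 = (x + y + z) / 2 by ring,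
    show (z - (x + y)) / 2 = -((x + y - z) / 2) by ring,
    show (z + (x - y)) / 2 = (x + z - y) / 2 by ring,
    show (z - (x - y)) / 2 = (y + z - x) / 2 by ring, cos_neg]
  ring

theorem cos_eq_zero_of_cosZero {s M : ℕ} (hM : 0 < M) (h : cosZero s M = true) :
    cos (π * s / (2 * M)) = 0 := by
  simp only [cosZero, beq_iff_eq] at h
  obtain ⟨j, hj⟩ := Nat.dvd_of_mod_eq_zero h
  have hj' : (s : ℝ) + M = 2 * M * j := by exact_mod_cast hj
  rw [cos_eq_zero_iff]
  refine ⟨(j : ℤ) - 1, ?_⟩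
  have : (M : ℝ) ≠ 0 := by positivity
  field_simp
  push_cast
  linear_combination hj'

/-- Reduces the angle to `[-π/2, 3π/2)`, where the cosine changes sign only once, at `π/2`; this is
why `cosNeg` shifts `s` by `M`. -/
theorem angle_eq {s M : ℕ} (hM : 0 < M) : π * s / (2 * M) =
    π * (((s + M) % (4 * M) : ℕ) - M) / (2 * M) + ((s + M) / (4 * M) : ℕ) * (2 * π) := by
  have h : (s : ℝ) + M = 4 * M * ((s + M) / (4 * M) : ℕ) + ((s + M) % (4 * M) : ℕ) := by
    exact_mod_cast (Nat.div_add_mod (s + M) (4 * M)).symm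
  have : (M : ℝ) ≠ 0 := by positivity
  field_simp
  linear_combination h

theorem cos_nonneg_of_cosNeg {s M : ℕ} (hM : 0 < M) (h : cosNeg s M = false) :
    0 ≤ cos (π * s / (2 * M)) := by
  rw [angle_eq hM, cos_add_nat_mul_two_pi]
  have h1 : (s + M) % (4 * M) < 2 * M := by
    by_contra! hc
    rw [cosNeg, Nat.ble_eq_true_of_le hc] at h
    simp at h
  have h1' : (((s + M) % (4 * M) : ℕ) : ℝ) < 2 * M := by exact_mod_cast h1
  have hM' : (0 : ℝ) < M := by exact_mod_cast hM
  apply cos_nonneg_of_neg_pi_div_two_le_of_le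
  · rw [le_div_iff₀ (by positivity)]
    have : (0 : ℝ) ≤ π * ((s + M) % (4 * M) : ℕ) := by positivity
    nlinarith
  · rw [div_le_iff₀ (by positivity)]
    nlinarith [pi_pos]

theorem cos_nonpos_of_cosNeg {s M : ℕ} (hM : 0 < M) (h : cosNeg s M = true) :
    cos (π * s / (2 * M)) ≤ 0 := by
  rw [angle_eq hM, cos_add_nat_mul_two_pi]
  have h1 : 2 * M ≤ (s + M) % (4 * M) := Nat.le_of_ble_eq_true h
  have h2 : (s + M) % (4 * M) < 4 * M := Nat.mod_lt _ (by lia)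
  have h1' : 2 * M ≤ (((s + M) % (4 * M) : ℕ) : ℝ) := by exact_mod_cast h1
  have h2' : (((s + M) % (4 * M) : ℕ) : ℝ) < 4 * M := by exact_mod_cast h2
  have hM' : (0 : ℝ) < M := by exact_mod_cast hM
  apply cos_nonpos_of_pi_div_two_le_of_le
  · rw [le_div_iff₀ (by positivity)]
    nlinarith [pi_pos]
  · rw [div_le_iff₀ (by positivity)]
    nlinarith [pi_pos]

theorem prod_cos_nonneg {s t u v M : ℕ} (hM : 0 < M)
    (h : (prodZero s t u v M || prodPos s t u v M) = true) :
    0 ≤ cos (π * s / (2 * M)) * cos (π * t / (2 * M)) *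
      (cos (π * u / (2 * M)) * cos (π * v / (2 * M))) := by
  rw [Bool.or_eq_true] at h
  rcases h with h | h
  · simp only [prodZero, Bool.or_eq_true] at h
    rcases h with ((h | h) | h) | h <;> simp [cos_eq_zero_of_cosZero hM h]
  · have key : ∀ x : ℕ, (cosNeg x M = true ∧ cos (π * x / (2 * M)) ≤ 0) ∨
        (cosNeg x M = false ∧ 0 ≤ cos (π * x / (2 * M))) := fun x => by
      cases hx : cosNeg x M
      · exact Or.inr ⟨rfl, cos_nonneg_of_cosNeg hM hx⟩
      · exact Or.inl ⟨rfl, cos_nonpos_of_cosNeg hM hx⟩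
    rcases key s with ⟨hs, hs'⟩ | ⟨hs, hs'⟩ <;> rcases key t with ⟨ht, ht'⟩ | ⟨ht, ht'⟩ <;>
    rcases key u with ⟨hu, hu'⟩ | ⟨hu, hu'⟩ <;> rcases key v with ⟨hv, hv'⟩ | ⟨hv, hv'⟩ <;>
    simp only [prodPos, hs, ht, hu, hv] at h <;> first
    | (exact absurd h (by decide))
    | exact mul_nonneg (mul_nonneg hs' ht') (mul_nonneg hu' hv')
    | exact mul_nonneg (mul_nonneg hs' ht') (mul_nonneg_of_nonpos_of_nonpos hu' hv')
    | exact mul_nonneg (mul_nonneg_of_nonpos_of_nonpos hs' ht') (mul_nonneg hu' hv')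
    | exact mul_nonneg (mul_nonneg_of_nonpos_of_nonpos hs' ht')
        (mul_nonneg_of_nonpos_of_nonpos hu' hv')
    | exact mul_nonneg_of_nonpos_of_nonpos (mul_nonpos_of_nonpos_of_nonneg hs' ht')
        (mul_nonpos_of_nonpos_of_nonneg hu' hv')
    | exact mul_nonneg_of_nonpos_of_nonpos (mul_nonpos_of_nonpos_of_nonneg hs' ht')
        (mul_nonpos_of_nonneg_of_nonpos hu' hv')
    | exact mul_nonneg_of_nonpos_of_nonpos (mul_nonpos_of_nonneg_of_nonpos hs' ht')
        (mul_nonpos_of_nonpos_of_nonneg hu' hv')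
    | exact mul_nonneg_of_nonpos_of_nonpos (mul_nonpos_of_nonneg_of_nonpos hs' ht')
        (mul_nonpos_of_nonneg_of_nonpos hu' hv')

theorem disc_nonneg_of_discNonneg {k p q r : ℕ} (hp : 0 < p) (hq : 0 < q) (hr : 0 < r)
    (h : discNonneg k p q r = true) : 0 ≤ disc (cwt k p) (cwt k q) (cwt k r) := by
  have h := prod_cos_nonneg (by positivity) h
  have hp' : (p : ℝ) ≠ 0 := by positivity
  have hq' : (q : ℝ) ≠ 0 := by positivity
  have hr' : (r : ℝ) ≠ 0 := by positivity
  -- The summand `4 * c` keeps the subtraction in `ℕ` from truncating; multiplied by `k` it amounts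
  -- to `k` full turns.
  have e : ∀ a b c : ℕ, a ≤ 4 * c → 0 < c → cos (π * ((k * (b + (4 * c - a)) : ℕ) : ℝ) / (2 * c)) =
      cos (k * π * ((b : ℝ) - a) / (2 * c)) := by
    intro a b c hac hc
    have hc' : (c : ℝ) ≠ 0 := by positivity
    rw [← cos_add_nat_mul_two_pi (k * π * ((b : ℝ) - a) / (2 * c)) k]
    congr 1
    push_cast [Nat.cast_sub hac]
    field_simp
    ring
  have b1 : q * r ≤ 4 * (p * q * r) := by nlinarith [Nat.mul_pos hq hr]
  have b2 : p * r ≤ 4 * (p * q * r) := by nlinarith [Nat.mul_pos hp hr]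
  have b3 : p * q ≤ 4 * (p * q * r) := by nlinarith [Nat.mul_pos hp hq]
  rw [e _ _ _ b1 (by positivity), e _ _ _ b2 (by positivity), e _ _ _ b3 (by positivity)] at h
  simp only [cwt]
  rw [disc_two_cos_eq_prod]
  refine mul_nonneg (by norm_num) (le_of_le_of_eq h ?_)
  have f1 : π * ((k * (q * r + p * r + p * q) : ℕ) : ℝ) / (2 * ((p * q * r : ℕ) : ℝ)) =
      (k * (π / p) + k * (π / q) + k * (π / r)) / 2 := by push_cast; field_simp
  have f2 : k * π * (((p * r + p * q : ℕ) : ℝ) - ((q * r : ℕ) : ℝ)) / (2 * ((p * q * r : ℕ) : ℝ)) =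
      (k * (π / q) + k * (π / r) - k * (π / p)) / 2 := by push_cast; field_simp
  have f3 : k * π * (((q * r + p * q : ℕ) : ℝ) - ((p * r : ℕ) : ℝ)) / (2 * ((p * q * r : ℕ) : ℝ)) =
      (k * (π / p) + k * (π / r) - k * (π / q)) / 2 := by push_cast; field_simp
  have f4 : k * π * (((q * r + p * r : ℕ) : ℝ) - ((p * q : ℕ) : ℝ)) / (2 * ((p * q * r : ℕ) : ℝ)) =
      (k * (π / p) + k * (π / q) - k * (π / r)) / 2 := by push_cast; field_simp
  rw [f1, f2, f3, f4]

/-- A triangle of positive discriminant has an angle sum less than `π`. -/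
theorem lt_of_disc_pos {p q r : ℕ} (hp : 2 ≤ p) (hq : 2 ≤ q) (hr : 2 ≤ r)
    (h : 0 < disc (wt p) (wt q) (wt r)) : q * r + p * r + p * q < p * q * r := by
  by_contra! hc
  refine absurd h (not_lt.2 ?_)
  have hp' : (2 : ℝ) ≤ p := by exact_mod_cast hp
  have hq' : (2 : ℝ) ≤ q := by exact_mod_cast hq
  have hr' : (2 : ℝ) ≤ r := by exact_mod_cast hr
  have hc' : (p : ℝ) * q * r ≤ q * r + p * r + p * q := by exact_mod_cast hc
  have hx : π / p ≤ π / 2 := by gcongr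
  have hy : π / q ≤ π / 2 := by gcongr
  have hz : π / r ≤ π / 2 := by gcongr
  have hx0 : 0 < π / p := by positivity
  have hy0 : 0 < π / q := by positivity
  have hz0 : 0 < π / r := by positivity
  have hs : π ≤ π / p + π / q + π / r := by
    have : π / p + π / q + π / r = π * ((q * r + p * r + p * q) / (p * q * r)) := by
      field_simp
    rw [this]
    have : 1 ≤ ((q * r + p * r + p * q) / (p * q * r) : ℝ) := by
      rw [le_div_iff₀ (by positivity)]; linarith
    nlinarith [pi_pos]
  simp only [wt]
  rw [disc_two_cos_eq_prod]
  -- The half-sum lies between `π/2` and `3π/4`, the other three half-angles between `-π/4` and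
  -- `π/2`, so only this factor can be negative.
  have c1 : cos ((π / p + π / q + π / r) / 2) ≤ 0 :=
    cos_nonpos_of_pi_div_two_le_of_le (by linarith) (by linarith)
  have c2 : 0 ≤ cos ((π / q + π / r - π / p) / 2) :=
    cos_nonneg_of_neg_pi_div_two_le_of_le (by linarith) (by linarith)
  have c3 : 0 ≤ cos ((π / p + π / r - π / q) / 2) :=
    cos_nonneg_of_neg_pi_div_two_le_of_le (by linarith) (by linarith)
  have c4 : 0 ≤ cos ((π / p + π / q - π / r) / 2) :=
    cos_nonneg_of_neg_pi_div_two_le_of_le (by linarith) (by linarith)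
  have := mul_nonpos_of_nonpos_of_nonneg (mul_nonpos_of_nonpos_of_nonneg c1 c2) (mul_nonneg c3 c4)
  linarith

end VArith

namespace VArith

open Real

/-! ### Arithmetic triangles: bounds -/

/-- Takeuchi's necessary condition for the arithmeticity of a triangle with angles `π/p`, `π/q`,
`π/r`. -/
def IsArithTri (p q r : ℕ) : Prop :=
  ∀ k : ℕ, Nat.Coprime k (2 * (p * q * r)) →
    fixesTri k p q r = true ∨ disc (cwt k p) (cwt k q) (cwt k r) < 0

/-- The stabilizer of one of the thirteen reference triangles. -/
def HasKnownStabilizer (p q r : ℕ) : Prop :=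
  ∃ T ∈ triList, sameStabilizer p q r T.1 T.2.1 T.2.2 = true

theorem IsArithTri.hasKnownStabilizer_of_triCheck {p q r : ℕ} (hp : 2 ≤ p) (hq : 2 ≤ q)
    (hr : 2 ≤ r) (h : IsArithTri p q r) (hd : 0 < disc (wt p) (wt q) (wt r))
    (hc : triCheck p q r = true) : HasKnownStabilizer p q r := by
  simp only [triCheck, Bool.or_eq_true, List.any_eq_true, Bool.and_eq_true, List.mem_range] at hc
  rcases hc with (hc | ⟨k, -, ⟨hk1, hk2⟩, hk3⟩) | hc
  · exact absurd (lt_of_disc_pos hp hq hr hd) (not_lt.2 (Nat.le_of_ble_eq_true hc))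
  · rcases h k (by simpa using hk1) with h | h
    · simp [h] at hk2
    · exact absurd h
        (not_lt.2 (disc_nonneg_of_discNonneg (by lia) (by lia) (by lia) hk3))
  · exact hc

theorem le_primorial {k : ℕ} (hk : k.Prime) (h : 19 ≤ k) : 64 * k ^ 3 ≤ primorial (k - 1) := by
  induction k using Nat.strong_induction_on with
  | _ k ih =>
    rcases h.eq_or_lt with rfl | h
    · decide +kernel
    by_cases h' : k < 38
    · have h23 : 23 ≤ k := by
        by_contra!
        interval_cases k <;> revert hk <;> decide
      have : primorial 22 ≤ primorial (k - 1) := primorial_mono (by lia)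
      have h22 : primorial 22 = 9699690 := by decide +kernel
      have : k ^ 3 ≤ 37 ^ 3 := by gcongr; lia
      lia
    -- Bertrand's postulate. From `k ≥ 38` on, the prime `l` is at least `19`, and the new factor
    -- `l` of the primorial outweighs the growth of the cube from `l` to `2l + 2`.
    obtain ⟨l, hl, hl1, hl2⟩ := Nat.exists_prime_lt_and_le_two_mul ((k - 1) / 2) (by lia)
    have hl3 : 19 ≤ l := by lia
    have hlk : l < k := by lia
    have := ih l hlk hl hl3
    have hdvd : primorial (l - 1) * l ∣ primorial (k - 1) := by
      apply Nat.Coprime.mul_dvd_of_dvd_of_dvd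
      · rw [Nat.coprime_comm, hl.coprime_iff_not_dvd, hl.dvd_primorial_iff]
        lia
      · exact primorial_dvd_primorial (by lia)
      · exact hl.dvd_primorial_iff.2 (by lia)
    have h1 := Nat.le_of_dvd (primorial_pos _) hdvd
    have h2 : k ≤ 2 * l + 2 := by lia
    calc 64 * k ^ 3 ≤ 64 * (2 * l + 2) ^ 3 := by gcongr
      _ ≤ 64 * l ^ 3 * l := by
        have : (2 * l + 2) ^ 3 ≤ l ^ 3 * 19 := by nlinarith [sq_nonneg (l : ℤ)]
        have : l ^ 3 * 19 ≤ l ^ 3 * l := by gcongr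
        nlinarith
      _ ≤ primorial (l - 1) * l := by gcongr
      _ ≤ _ := h1

/-- The least prime that does not divide `n`. -/
theorem exists_least_prime {n : ℕ} (hn : 0 < n) :
    ∃ k, k.Prime ∧ ¬ k ∣ n ∧ primorial (k - 1) ∣ n := by
  have hex : ∃ k, k.Prime ∧ ¬ k ∣ n := by
    obtain ⟨k, hk, hp⟩ := Nat.exists_infinite_primes (n + 1)
    exact ⟨k, hp, fun hd => by have := Nat.le_of_dvd hn hd; lia⟩
  classical
  refine ⟨Nat.find hex, (Nat.find_spec hex).1, (Nat.find_spec hex).2, ?_⟩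
  rw [primorial_eq_prod_primesLE]
  apply Finset.prod_primes_dvd
  · intro p hp
    exact (Nat.mem_primesLE.1 hp).2.prime
  · intro p hp
    obtain ⟨h1, h2⟩ := Nat.mem_primesLE.1 hp
    by_contra hd
    have := (Nat.find_spec hex).1.pos
    exact Nat.find_min hex (m := p) (by lia) ⟨h2, hd⟩

/-- A multiple of `π / M` stays away from the odd multiples of `π`, by `π / M` at least. -/
theorem neg_cos_le {s : ℤ} {M : ℕ} (hM : 0 < M) (h : ¬ (2 * (M : ℤ)) ∣ s - M) :
    -cos (π * s / M) ≤ cos (π / M) := by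
  set t := (s - M) % (2 * M) with ht
  have h0 : 0 ≤ t := Int.emod_nonneg _ (by lia)
  have h1 : t < 2 * M := Int.emod_lt_of_pos _ (by lia)
  have h2 : t ≠ 0 := fun h' => h (Int.dvd_of_emod_eq_zero h')
  have hM' : (0 : ℝ) < M := by exact_mod_cast hM
  have hs : (s : ℝ) - M = 2 * M * ((s - M) / (2 * M) : ℤ) + t := by
    exact_mod_cast (Int.mul_ediv_add_emod (s - M) (2 * M)).symm
  have e : -cos (π * s / M) = cos (π * t / M) := by
    rw [← cos_sub_pi, ← cos_add_int_mul_two_pi (π * t / M) ((s - M) / (2 * M))]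
    congr 1
    field_simp
    linear_combination hs
  rw [e]
  have ht1 : (1 : ℝ) ≤ t := by exact_mod_cast (by lia : 1 ≤ t)
  have ht2 : (t : ℝ) ≤ 2 * M - 1 := by exact_mod_cast (by lia : t ≤ 2 * M - 1)
  by_cases hc : t ≤ M
  · have hc' : (t : ℝ) ≤ M := by exact_mod_cast hc
    apply cos_le_cos_of_nonneg_of_le_pi
    · positivity
    · rw [div_le_iff₀ hM']; nlinarith [pi_pos]
    · gcongr; nlinarith [pi_pos]
  · have hc' : (M : ℝ) ≤ t := by exact_mod_cast (by lia : (M : ℤ) ≤ t)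
    rw [← cos_two_pi_sub]
    have e : 2 * π - π * t / M = π * (2 * M - t) / M := by field_simp
    rw [e]
    apply cos_le_cos_of_nonneg_of_le_pi
    · positivity
    · rw [div_le_iff₀ hM']; nlinarith [pi_pos]
    · gcongr; nlinarith [pi_pos]

/-- If the third angle is so small that it does not exceed the distance of the sums and
differences of the other two to the odd multiples of `π`, the triangle is not spherical. -/
theorem disc_nonneg_of_small {p q r k M : ℕ} (hM : 0 < M) (hr : 0 < r) {s t : ℤ}
    (hs : (k : ℝ) * (π / p) + k * (π / q) = π * s / M) (hs' : ¬ (2 * (M : ℤ)) ∣ s - M)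
    (ht : (k : ℝ) * (π / p) - k * (π / q) = π * t / M) (ht' : ¬ (2 * (M : ℤ)) ∣ t - M)
    (h : M * k ≤ r) : 0 ≤ disc (cwt k p) (cwt k q) (cwt k r) := by
  have hM' : (0 : ℝ) < M := by exact_mod_cast hM
  have hr' : (0 : ℝ) < r := by exact_mod_cast hr
  have h' : (M : ℝ) * k ≤ r := by exact_mod_cast h
  simp only [cwt]
  rw [disc_two_cos, hs, ht]
  have c : cos (π / M) ≤ cos (k * (π / r)) := by
    apply cos_le_cos_of_nonneg_of_le_pi
    · positivity
    · apply div_le_self pi_pos.le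
      exact_mod_cast hM
    · rw [← mul_div_assoc, div_le_div_iff₀ hr' hM']
      nlinarith [pi_pos]
  have := neg_cos_le hM hs'
  have := neg_cos_le hM ht'
  have : 0 ≤ (cos (k * (π / r)) + cos (π * s / M)) * (cos (k * (π / r)) + cos (π * t / M)) :=
    mul_nonneg (by linarith) (by linarith)
  linarith

theorem fixesTri_eq_false {k p q r : ℕ} (hk : 2 ≤ k) (h : k + 1 < r) :
    fixesTri k p q r = false := by
  have : pmOne k r = false := by
    simp only [pmOne, Bool.or_eq_false_iff, beq_eq_false_iff_ne]
    rw [Nat.mod_eq_of_lt h, Nat.mod_eq_of_lt (by lia), Nat.mod_eq_of_lt (by lia)]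
    lia
  simp [fixesTri, this]

theorem triCheck_of_rightCheck {k P q r : ℕ} (h : rightCheck k P = true) (hP : 0 < P)
    (h3 : 3 ≤ q) (hqr : q ≤ r) (hq : q < 4 * k) (hr : r < 2 * k * q) (hd : P ∣ q * r) :
    triCheck 2 q r = true := by
  simp only [rightCheck, List.all_eq_true, List.mem_range, Bool.or_eq_true] at h
  have hg : 0 < Nat.gcd P q := Nat.gcd_pos_of_pos_left _ hP
  have hpos : 0 < P / Nat.gcd P q := Nat.div_pos (Nat.gcd_le_left _ hP) hg
  -- After division by the gcd, `P` is prime to what remains of `q`, so it must divide `r`.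
  obtain ⟨j, rfl⟩ : P / Nat.gcd P q ∣ r := by
    apply (Nat.coprime_div_gcd_div_gcd (m := P) (n := q) hg).dvd_of_dvd_mul_left
    obtain ⟨c, hc⟩ := hd
    refine ⟨c, Nat.eq_of_mul_eq_mul_left hg ?_⟩
    rw [← mul_assoc, ← mul_assoc, Nat.mul_div_cancel' (Nat.gcd_dvd_right P q),
      Nat.mul_div_cancel' (Nat.gcd_dvd_left P q), hc]
  rcases h q hq with h | h
  · rw [Nat.blt_eq] at h; lia
  have hj : j < 2 * k * q / (P / Nat.gcd P q) + 1 := by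
    rw [Nat.lt_succ_iff, Nat.le_div_iff_mul_le hpos]
    nlinarith
  rcases h j hj with h | h
  · rw [Nat.blt_eq] at h; lia
  · exact h

/-- For the least prime `k` prime to the labels, Takeuchi's condition gives `q < 4k` and `r < 2kq`,
hence `2qr < 64k³`. Since `primorial (k - 1)` divides `2qr`, this forces `k < 19`, and the finite
checks apply. -/
theorem IsArithTri.right {q r : ℕ} (hq : 3 ≤ q) (hqr : q ≤ r) (h : IsArithTri 2 q r)
    (hd : 0 < disc (wt 2) (wt q) (wt r)) : HasKnownStabilizer 2 q r := by
  have hq0 : 0 < q := by lia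
  have hr0 : 0 < r := by lia
  obtain ⟨k, hk, hkn, hkd⟩ := exists_least_prime (n := 2 * (q * r)) (by positivity)
  have hk2 : k ≠ 2 := fun h => hkn (h ▸ dvd_mul_right _ _)
  have hk3 : 3 ≤ k := by have := hk.two_le; lia
  have hcop : Nat.Coprime k (2 * (2 * q * r)) := by
    rw [hk.coprime_iff_not_dvd]
    intro h'
    rcases hk.dvd_mul.1 h' with h' | h'
    · exact hkn (h'.mul_right _)
    · exact hkn (by rwa [mul_assoc] at h')
  have hkq : ¬ k ∣ q := fun h => hkn (((h.mul_right r)).mul_left 2)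
  have hbound : q < 4 * k ∧ r < 2 * k * q := by
    by_cases hsm : r ≤ k + 1
    · exact ⟨by lia, by nlinarith⟩
    rcases h k hcop with h | h
    · rw [fixesTri_eq_false (by lia) (by lia)] at h; simp at h
    by_contra hcon
    refine absurd h (not_lt.2 ?_)
    have hq' : (3 : ℝ) ≤ q := by exact_mod_cast hq
    have hr' : (3 : ℝ) ≤ r := by exact_mod_cast hq.trans hqr
    by_cases hq4 : q < 4 * k
    · have hr2 : 2 * q * k ≤ r := by
        by_contra! hc
        exact hcon ⟨hq4, by linarith⟩
      have hcopq : IsCoprime (q : ℤ) k := by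
        rw [Nat.isCoprime_iff_coprime, Nat.coprime_comm, hk.coprime_iff_not_dvd]
        exact hkq
      have key : ∀ e : ℤ, e = 2 ∨ e = -2 → ¬ (2 * ((2 * q : ℕ) : ℤ)) ∣ k * (q + e) - (2 * q : ℕ) := by
        intro e he hdv
        have h1 : (q : ℤ) ∣ k * e := by
          have h2 : (q : ℤ) ∣ k * (q + e) - (2 * q : ℕ) :=
            (Dvd.intro_left (4 : ℤ) (by push_cast; ring)).trans hdv
          have h3 := dvd_sub h2 (Dvd.intro_left ((k : ℤ) - 2) rfl : (q : ℤ) ∣ (k - 2) * q)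
          push_cast at h3
          ring_nf at h3
          exact h3
        have h4 : (q : ℤ) ∣ 2 := by
          have := hcopq.dvd_of_dvd_mul_left h1
          rcases he with rfl | rfl
          · exact this
          · simpa using this
        have := Int.le_of_dvd (by norm_num) h4
        lia
      refine disc_nonneg_of_small (M := 2 * q) (s := k * (q + 2)) (t := k * (q + -2)) (by lia) (by lia)
        ?_ (key 2 (Or.inl rfl)) ?_ (key (-2) (Or.inr rfl)) hr2
      · push_cast
        have : (q : ℝ) ≠ 0 := by positivity
        field_simp
      · push_cast
        have : (q : ℝ) ≠ 0 := by positivity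
        field_simp
        ring
    · have hq4' : (4 : ℝ) * k ≤ q := by exact_mod_cast not_lt.1 hq4
      have hr4' : (4 : ℝ) * k ≤ r := hq4'.trans (by exact_mod_cast hqr)
      have a1 : (k : ℝ) * (π / q) ≤ π / 4 := by
        rw [← mul_div_assoc, div_le_div_iff₀ (by linarith) (by norm_num)]
        nlinarith [pi_pos]
      have a2 : (k : ℝ) * (π / r) ≤ π / 4 := by
        rw [← mul_div_assoc, div_le_div_iff₀ (by linarith) (by norm_num)]
        nlinarith [pi_pos]
      have b1 : 0 ≤ (k : ℝ) * (π / q) := by positivity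
      have b2 : 0 ≤ (k : ℝ) * (π / r) := by positivity
      have c1 : cos (π / 4) ≤ cos (k * (π / q)) :=
        cos_le_cos_of_nonneg_of_le_pi b1 (by linarith [pi_pos]) a1
      have c2 : cos (π / 4) ≤ cos (k * (π / r)) :=
        cos_le_cos_of_nonneg_of_le_pi b2 (by linarith [pi_pos]) a2
      have c3 : cos (π / 4) ^ 2 = 1 / 2 := by
        rw [cos_pi_div_four, div_pow, sq_sqrt (by norm_num)]; norm_num
      have c4 : 0 ≤ cos (π / 4) := by rw [cos_pi_div_four]; positivity
      have c5 : cwt k 2 * cwt k 2 * 0 ≤ cwt k 2 ^ 2 := by nlinarith [sq_nonneg (cwt k 2)]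
      have hk0 : cwt k 2 = 0 := by
        obtain ⟨j, hj⟩ := hk.odd_of_ne_two hk2
        simp only [cwt, mul_eq_zero]
        right
        rw [cos_eq_zero_iff]
        refine ⟨j, ?_⟩
        rw [hj]; push_cast; ring
      rw [hk0]
      simp only [cwt, disc]
      nlinarith
  obtain ⟨hb1, hb2⟩ := hbound
  have hlt : k < 19 := by
    by_contra! hc
    have h1 := Nat.le_of_dvd (by positivity) hkd
    have h2 := le_primorial hk hc
    have h3 : q * r < 4 * k * (2 * k * q) := by
      have := Nat.mul_lt_mul'' hb1 hb2
      nlinarith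
    have h4 : 4 * k * (2 * k * q) ≤ 4 * k * (2 * k * (4 * k)) := by gcongr
    have h5 : 4 * k * (2 * k * (4 * k)) = 32 * k ^ 3 := by ring
    lia
  have hP : ∀ P : ℕ, primorial (k - 1) = 2 * P → P ∣ q * r := fun P hP => by
    rw [hP] at hkd
    exact Nat.dvd_of_mul_dvd_mul_left (by norm_num) hkd
  refine h.hasKnownStabilizer_of_triCheck le_rfl (by lia) (by lia) hd ?_
  interval_cases k <;> first | (exfalso; revert hk; decide) | skip
  · exact triCheck_of_rightCheck rightCheck_3 (by norm_num) hq hqr hb1 hb2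
      (hP _ (by decide +kernel))
  · exact triCheck_of_rightCheck rightCheck_5 (by norm_num) hq hqr hb1 hb2
      (hP _ (by decide +kernel))
  · exact triCheck_of_rightCheck rightCheck_7 (by norm_num) hq hqr hb1 hb2
      (hP _ (by decide +kernel))
  · exact triCheck_of_rightCheck rightCheck_11 (by norm_num) hq hqr hb1 hb2
      (hP _ (by decide +kernel))
  · exact triCheck_of_rightCheck rightCheck_13 (by norm_num) hq hqr hb1 hb2
      (hP _ (by decide +kernel))
  · exact triCheck_of_rightCheck rightCheck_17 (by norm_num) hq hqr hb1 hb2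
      (hP _ (by decide +kernel))

theorem triCheck_of_smallCheck {k P a b m : ℕ} (h : smallCheck k P = true) (hP : 0 < P)
    (ha : 3 ≤ a) (ha' : a ≤ b) (hb' : b ≤ 5) (h3 : 3 ≤ m) (hm : m < 60 * k)
    (hd : P ∣ m) : triCheck a b m = true := by
  simp only [smallCheck, List.all_eq_true, List.mem_range, Bool.or_eq_true, List.mem_cons,
    List.not_mem_nil, or_false] at h
  obtain ⟨j, rfl⟩ := hd
  rcases h a (by lia) b (by lia) with h | h
  · rw [Nat.blt_eq] at h; lia
  have hj : j < 60 * k / P + 1 := by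
    rw [Nat.lt_succ_iff, Nat.le_div_iff_mul_le hP]
    nlinarith
  rcases h j hj with h | h
  · rw [Nat.blt_eq] at h; lia
  · exact h

/-- All angles `π/a`, `π/b` are multiples of `π/60`, so Takeuchi's condition at the least prime `k`
not dividing `30m` bounds `m` by `60k`. Divisibility of `30m` by `primorial (k - 1)` then bounds
`k`. -/
theorem IsArithTri.small {a b m : ℕ} (ha : 3 ≤ a) (hab : a ≤ b) (hb : b ≤ 5) (hm : 3 ≤ m)
    (h : IsArithTri a b m) (hd : 0 < disc (wt a) (wt b) (wt m)) : HasKnownStabilizer a b m := by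
  have ha5 : a ≤ 5 := hab.trans hb
  obtain ⟨k, hk, hkn, hkd⟩ := exists_least_prime (n := 30 * m) (by lia)
  have hk30 : ¬ k ∣ 30 := fun h => hkn (h.mul_right _)
  have hkm : ¬ k ∣ m := fun h => hkn (h.mul_left _)
  have hk7 : 7 ≤ k := by
    by_contra!
    interval_cases k <;> first | (exact hk30 (by decide)) | (revert hk; decide)
  have hab60 : a * b ∣ 60 * 60 := by
    interval_cases a <;> interval_cases b <;> decide
  have hk2 : Nat.Coprime k 2 := by
    rw [hk.coprime_iff_not_dvd]; exact fun h => hk30 (h.trans (by norm_num))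
  have hk60 : Nat.Coprime k 60 := by
    have h1 : Nat.Coprime k 30 := by rwa [hk.coprime_iff_not_dvd]
    exact Nat.Coprime.mul_right h1 hk2
  have hcop : Nat.Coprime k (2 * (a * b * m)) := by
    refine hk2.mul_right (Nat.Coprime.mul_right ?_ ?_)
    · exact (hk60.mul_right hk60).coprime_dvd_right hab60
    · rwa [hk.coprime_iff_not_dvd]
  have hbound : m < 60 * k := by
    by_contra! hcon
    rcases h k hcop with h | h
    · rw [fixesTri_eq_false (by lia) (by lia)] at h; simp at h
    refine absurd h (not_lt.2 ?_)
    have hcz : IsCoprime (60 : ℤ) k := by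
      have := hk60.symm
      exact_mod_cast (Nat.isCoprime_iff_coprime.2 this)
    -- An odd multiple of `π` would require `60 ∣ k * e`, hence `60 ∣ e`; the sums `60/a + 60/b` are
    -- not divisible by `60`, and a difference is so only when it is zero.
    have key : ∀ e : ℤ, (¬ (60 : ℤ) ∣ e) ∨ e = 0 → ¬ (2 * ((60 : ℕ) : ℤ)) ∣ k * e - (60 : ℕ) := by
      rintro e he hdv
      rcases he with he | rfl
      · apply he
        apply hcz.dvd_of_dvd_mul_left
        have h2 : (60 : ℤ) ∣ k * e - (60 : ℕ) := (by norm_num : (60 : ℤ) ∣ 2 * (60 : ℕ)).trans hdv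
        simpa using dvd_add h2 (dvd_refl (60 : ℤ))
      · revert hdv; simp
    have ha' : a ≠ 0 := by lia
    have hb' : b ≠ 0 := by lia
    refine disc_nonneg_of_small (M := 60) (s := k * (60 / a + 60 / b)) (t := k * (60 / a - 60 / b))
      (by lia) (by lia) ?_ (key _ ?_) ?_ (key _ ?_) hcon
    · interval_cases a <;> interval_cases b <;> norm_num <;> ring
    · interval_cases a <;> interval_cases b <;> decide
    · interval_cases a <;> interval_cases b <;> norm_num <;> ring
    · interval_cases a <;> interval_cases b <;> decide
  have hlt : k < 19 := by
    by_contra! hc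
    have h1 := Nat.le_of_dvd (by positivity) hkd
    have h2 := le_primorial hk hc
    nlinarith [mul_le_mul hc hc (by lia) (by lia)]
  have hP : ∀ P : ℕ, primorial (k - 1) = 30 * P → P ∣ m := fun P hP => by
    rw [hP] at hkd
    exact Nat.dvd_of_mul_dvd_mul_left (by norm_num) hkd
  refine h.hasKnownStabilizer_of_triCheck (by lia) (by lia) (by lia) hd ?_
  interval_cases k <;> first | (exfalso; revert hk; decide) | skip
  · exact triCheck_of_smallCheck smallCheck_7 (by norm_num) ha hab hb hm hbound
      (hP _ (by decide +kernel))
  · exact triCheck_of_smallCheck smallCheck_11 (by norm_num) ha hab hb hm hbound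
      (hP _ (by decide +kernel))
  · exact triCheck_of_smallCheck smallCheck_13 (by norm_num) ha hab hb hm hbound
      (hP _ (by decide +kernel))
  · exact triCheck_of_smallCheck smallCheck_17 (by norm_num) ha hab hb hm hbound
      (hP _ (by decide +kernel))

end VArith

namespace VArith

open Real Polynomial

/-! ### Embeddings of fields of real algebraic numbers -/

/-- The field of real algebraic numbers. -/
noncomputable abbrev algReal : IntermediateField ℚ ℝ := algebraicClosure ℚ ℝ

theorem mem_algReal_iff {x : ℝ} : x ∈ algReal ↔ IsAlgebraic ℚ x :=
  _root_.mem_algebraicClosure_iff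

theorem le_algReal (E : IntermediateField ℚ ℝ) [Algebra.IsAlgebraic ℚ E] : E ≤ algReal := by
  intro x hx
  rw [mem_algReal_iff]
  exact (isAlgebraic_algebraMap_iff (A := ℝ) (algebraMap E ℝ).injective).2
    (Algebra.IsAlgebraic.isAlgebraic (R := ℚ) (⟨x, hx⟩ : E))

instance : Algebra.IsAlgebraic ℚ algReal :=
  ⟨fun x => isAlgebraic_algebraMap_iff (A := ℝ) (algebraMap algReal ℝ).injective |>.1
    (mem_algReal_iff.1 x.2)⟩

/-- An element outside of a subfield is moved by some embedding that fixes the subfield. -/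
theorem exists_embedding_ne {F : IntermediateField ℚ ℝ} (hF : F ≤ algReal) (x : algReal)
    (hx : (x : ℝ) ∉ F) : ∃ σ : algReal →ₐ[ℚ] ℂ,
      (∀ y : algReal, (y : ℝ) ∈ F → σ y = ((y : ℝ) : ℂ)) ∧ σ x ≠ ((x : ℝ) : ℂ) := by
  let E := IntermediateField.extendScalars hF
  have halg' : Algebra.IsAlgebraic ℚ E := (inferInstance : Algebra.IsAlgebraic ℚ algReal)
  have halg : Algebra.IsAlgebraic F E := Algebra.IsAlgebraic.tower_top (K := ℚ) F
  let x' : E := ⟨x, x.2⟩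
  have hint : IsIntegral F x' := Algebra.IsIntegral.isIntegral x'
  have hsplit : ((minpoly F x').map (algebraMap F ℂ)).Splits := IsAlgClosed.splits _
  have hsep : (minpoly F x').Separable := (minpoly.irreducible hint).separable
  have hdeg : (minpoly F x').natDegree ≠ 1 := by
    intro h
    obtain ⟨y, hy⟩ := minpoly.natDegree_eq_one_iff.1 h
    apply hx
    have : (y : ℝ) = x := congrArg (fun z : E => (z : ℝ)) hy
    rw [← this]
    exact y.2
  -- The minimal polynomial of `x` over `F` is separable of degree at least two, so it has a root
  -- other than `x`, to which an embedding over `F` can send `x`.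
  obtain ⟨y, hy, hyx⟩ : ∃ y ∈ (minpoly F x').rootSet ℂ, y ≠ ((x : ℝ) : ℂ) := by
    by_contra! hcon
    have hcard := card_rootSet_eq_natDegree hsep hsplit
    have hpos := minpoly.natDegree_pos hint
    have : Fintype.card ((minpoly F x').rootSet ℂ) ≤ 1 := by
      rw [Fintype.card_le_one_iff]
      rintro ⟨a, ha⟩ ⟨b, hb⟩
      exact Subtype.ext ((hcon a ha).trans (hcon b hb).symm)
    lia
  rw [← Algebra.IsAlgebraic.range_eval_eq_rootSet_minpoly_of_splits ℂ
    (fun z => IsAlgClosed.splits _) x'] at hy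
  obtain ⟨ψ, hψ⟩ := hy
  refine ⟨(ψ.restrictScalars ℚ : E →ₐ[ℚ] ℂ), fun y hyF => ?_, fun h => hyx (hψ.symm.trans h)⟩
  exact ψ.commutes ⟨y, hyF⟩

/-- Twice the cosine of `2π/N`. -/
noncomputable def twoCos (N : ℕ) : ℝ := 2 * cos (2 * π / N)

theorem isAlgebraic_twoCos (N : ℕ) : IsAlgebraic ℚ (twoCos N) := by
  have := Real.isIntegral_two_mul_cos_rat_mul_pi (2 / N)
  have h : twoCos N = 2 * cos (((2 / N : ℚ) : ℝ) * π) := by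
    rw [twoCos]; push_cast; ring_nf
  rw [h]
  exact (this.isAlgebraic).extendScalars (algebraMap ℤ ℚ).injective_int

theorem isIntegral_wt (p : ℕ) : IsIntegral ℤ (wt p) := by
  have := Real.isIntegral_two_mul_cos_rat_mul_pi (1 / p)
  have h : wt p = 2 * cos (((1 / p : ℚ) : ℝ) * π) := by
    rw [wt]; push_cast; ring_nf
  rwa [h]

theorem isAlgebraic_wt (p : ℕ) : IsAlgebraic ℚ (wt p) :=
  (isIntegral_wt p).isAlgebraic.extendScalars (algebraMap ℤ ℚ).injective_int

theorem wt_mem_algReal (p : ℕ) : wt p ∈ algReal := mem_algReal_iff.2 (isAlgebraic_wt p)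

/-- `wt p` in the field of real algebraic numbers. -/
noncomputable def awt (p : ℕ) : algReal := ⟨wt p, wt_mem_algReal p⟩

noncomputable def aTwoCos (N : ℕ) : algReal := ⟨twoCos N, mem_algReal_iff.2 (isAlgebraic_twoCos N)⟩

theorem coe_eval_C (x : algReal) (n : ℤ) :
    (((Chebyshev.C algReal n).eval x : algReal) : ℝ) = (Chebyshev.C ℝ n).eval (x : ℝ) :=
  Chebyshev.algebraMap_eval_C (R' := ℝ) x n

theorem map_eval_C (σ : algReal →+* ℂ) (x : algReal) (n : ℤ) :
    σ ((Chebyshev.C algReal n).eval x) = (Chebyshev.C ℂ n).eval (σ x) := by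
  rw [← Chebyshev.map_C σ, eval_map_apply]

theorem wt_eq_of_dvd {N p : ℕ} (hN : 0 < N) (hp : 2 * p ∣ N) :
    wt p = 2 * cos ((N / (2 * p) : ℕ) * (2 * π / N)) := by
  obtain ⟨c, rfl⟩ := hp
  have hp : 0 < p := by by_contra h; simp_all
  have hc : 0 < c := Nat.pos_of_mul_pos_left hN
  have hp' : (p : ℝ) ≠ 0 := by positivity
  have hc' : (c : ℝ) ≠ 0 := by positivity
  rw [Nat.mul_div_cancel_left _ (by positivity), wt]
  congr 2
  push_cast
  field_simp

/-- Since `wt p = 2 cos (2π/(2p))`, it is an integral Chebyshev polynomial in `2 cos (2π/N)` when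
`2p ∣ N`, and such polynomials commute with `σ`. -/
theorem apply_awt_of_apply_aTwoCos {N k : ℕ} (hN : 0 < N) (σ : algReal →+* ℂ)
    (h : σ (aTwoCos N) = ((2 * cos (k * (2 * π / N)) : ℝ) : ℂ)) {p : ℕ} (hp : 2 * p ∣ N) :
    σ (awt p) = (cwt k p : ℂ) := by
  have e : awt p = (Chebyshev.C algReal (N / (2 * p) : ℕ)).eval (aTwoCos N) := by
    apply Subtype.ext
    rw [coe_eval_C]
    simp only [aTwoCos, twoCos, awt]
    rw [Chebyshev.C_two_mul_real_cos, wt_eq_of_dvd hN hp]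
    norm_cast
  obtain ⟨c, rfl⟩ := hp
  have hp : 0 < p := by by_contra h; simp_all
  have hc : 0 < c := Nat.pos_of_mul_pos_left hN
  have hp' : (p : ℂ) ≠ 0 := by exact_mod_cast hp.ne'
  have hc' : (c : ℂ) ≠ 0 := by exact_mod_cast hc.ne'
  rw [e, map_eval_C, h, Nat.mul_div_cancel_left _ (by positivity)]
  push_cast
  rw [Chebyshev.C_two_mul_complex_cos, cwt]
  push_cast
  congr 2
  field_simp

theorem coe_eval_aTwoCos (N n : ℕ) :
    (((Chebyshev.C algReal n).eval (aTwoCos N) : algReal) : ℝ) = 2 * cos (n * (2 * π / N)) := by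
  rw [coe_eval_C]
  simp only [aTwoCos, twoCos]
  rw [Chebyshev.C_two_mul_real_cos]
  norm_cast

/-- Every embedding acts on cosines by multiplication of angles. -/
theorem exists_mul_of_embedding (σ : algReal →+* ℂ) {N : ℕ} (hN : 0 < N) :
    ∃ k : ℕ, k < N ∧ Nat.Coprime k N ∧ ∀ p, 2 * p ∣ N → σ (awt p) = (cwt k p : ℂ) := by
  -- The image of `2 cos (2π/N)` is written as `2 cos w` with a complex `w`; Chebyshev relations
  -- then show that `w` is a multiple of `2π/N`.
  obtain ⟨w, hw⟩ := Complex.cos_surjective (σ (aTwoCos N) / 2)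
  have hw2 : σ (aTwoCos N) = 2 * Complex.cos w := by rw [hw]; ring
  have hN' : (N : ℝ) ≠ 0 := by positivity
  have hNc : (N : ℂ) ≠ 0 := by exact_mod_cast hN.ne'
  -- Injectivity of `σ` transports `cos (n w) = 1` back to `cos (2πn/N) = 1`; this later yields that
  -- `k` is prime to `N`.
  have key : ∀ n : ℕ, Complex.cos (n * w) = 1 → N ∣ n := by
    intro n hn
    have h1 : σ ((Chebyshev.C algReal n).eval (aTwoCos N)) = 2 := by
      rw [map_eval_C, hw2, Chebyshev.C_two_mul_complex_cos]
      push_cast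
      rw [hn]; norm_num
    have h2 : (Chebyshev.C algReal n).eval (aTwoCos N) = 2 := by
      apply σ.injective
      rw [h1, map_ofNat]
    have h3 := coe_eval_aTwoCos N n
    rw [h2] at h3
    have h4 : cos (n * (2 * π / N)) = 1 := by
      have : ((2 : algReal) : ℝ) = 2 := rfl
      rw [this] at h3
      linarith
    obtain ⟨m, hm⟩ := (cos_eq_one_iff _).1 h4
    have h5 : (m : ℝ) * N = n := by
      field_simp at hm
      linarith
    have h6 : (N : ℤ) ∣ n := ⟨m, by rw [mul_comm]; exact_mod_cast h5.symm⟩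
    exact_mod_cast h6
  have h1 : Complex.cos (N * w) = 1 := by
    have h2 : (Chebyshev.C algReal N).eval (aTwoCos N) = 2 := by
      apply Subtype.ext
      rw [coe_eval_aTwoCos]
      have : (N : ℝ) * (2 * π / N) = 2 * π := by field_simp
      rw [this, cos_two_pi, mul_one]
      rfl
    have h3 := map_eval_C σ (aTwoCos N) N
    rw [h2, hw2, Chebyshev.C_two_mul_complex_cos, map_ofNat] at h3
    push_cast at h3
    linear_combination -h3 / 2
  obtain ⟨m, hm⟩ := Complex.cos_eq_one_iff.1 h1
  have hw3 : w = m * (2 * π / N) := by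
    field_simp
    linear_combination -hm
  have hk0 : 0 ≤ m % N := Int.emod_nonneg _ (by lia)
  obtain ⟨k, hk⟩ := Int.eq_ofNat_of_zero_le hk0
  have hcos : ∀ n : ℕ, Complex.cos (n * w) = Complex.cos (n * (k * (2 * π / N))) := by
    intro n
    have hmm : (m : ℂ) = N * (m / N : ℤ) + k := by
      have := (Int.mul_ediv_add_emod m N).symm
      rw [hk] at this
      exact_mod_cast this
    rw [hw3, hmm, ← Complex.cos_add_int_mul_two_pi (n * (k * (2 * π / N))) (n * (m / N : ℤ))]
    congr 1
    push_cast
    field_simp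
    ring
  refine ⟨k, ?_, ?_, fun p hp => apply_awt_of_apply_aTwoCos hN σ ?_ hp⟩
  · have := Int.emod_lt_of_pos m (by lia : 0 < (N : ℤ))
    lia
  · set g := Nat.gcd k N with hg
    have hgpos : 0 < g := Nat.gcd_pos_of_pos_right _ hN
    obtain ⟨a, ha⟩ := Nat.gcd_dvd_left k N
    obtain ⟨b, hb⟩ := Nat.gcd_dvd_right k N
    rw [← hg] at ha hb
    have h2 : N ∣ b := by
      apply key
      rw [hcos, Complex.cos_eq_one_iff]
      refine ⟨a, ?_⟩
      have hgc : (g : ℂ) ≠ 0 := by exact_mod_cast hgpos.ne'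
      have hbpos : 0 < b := Nat.pos_of_mul_pos_left (hb ▸ hN)
      have hbc : (b : ℂ) ≠ 0 := by exact_mod_cast hbpos.ne'
      have hNN : (N : ℂ) = g * b := by exact_mod_cast hb
      have hkk : (k : ℂ) = g * a := by exact_mod_cast ha
      rw [hNN, hkk]
      push_cast
      field_simp
    have h3 : g * b ∣ 1 * b := by rw [← hb, one_mul]; exact h2
    have hbpos : 0 < b := Nat.pos_of_mul_pos_left (hb ▸ hN)
    exact Nat.dvd_one.1 (Nat.dvd_of_mul_dvd_mul_right hbpos h3)
  · rw [hw2]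
    have := hcos 1
    simp only [Nat.cast_one, one_mul] at this
    rw [this]
    push_cast
    rfl

/-- With `ζ = exp (2πi/N)` one has `2 cos (2πk/N) = ζᵏ + (ζᵏ)^(N-1)`. The roots of unity `ζ` and
`ζᵏ` share the cyclotomic minimal polynomial, so a polynomial relation for `ζ` holds for `ζᵏ` too.
-/
theorem isConjugate_twoCos {N k : ℕ} (hN : 0 < N) (hk : Nat.Coprime k N) :
    aeval ((2 * cos (k * (2 * π / N)) : ℝ) : ℂ) (minpoly ℚ (aTwoCos N)) = 0 := by
  have hNc : (N : ℂ) ≠ 0 := by exact_mod_cast hN.ne'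
  set ζ : ℂ := Complex.exp (2 * π * Complex.I / N) with hζ
  have hprim : IsPrimitiveRoot ζ N := Complex.isPrimitiveRoot_exp N hN.ne'
  have hpow : ∀ k : ℕ, ζ ^ k + (ζ ^ k) ^ (N - 1) = ((2 * cos (k * (2 * π / N)) : ℝ) : ℂ) := by
    intro k
    have h1 : ζ ^ k * (ζ ^ k) ^ (N - 1) = 1 := by
      rw [← pow_succ', Nat.sub_add_cancel hN, ← pow_mul, mul_comm, pow_mul, hprim.pow_eq_one,
        one_pow]
    have h2 : (ζ ^ k) ^ (N - 1) = (ζ ^ k)⁻¹ := eq_inv_of_mul_eq_one_right h1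
    have h3 : ζ ^ k = Complex.exp ((k * (2 * π / N) : ℂ) * Complex.I) := by
      rw [hζ, ← Complex.exp_nat_mul]
      congr 1
      ring
    rw [h2, h3, ← Complex.exp_neg]
    push_cast
    rw [Complex.cos]
    ring_nf
  set P := (minpoly ℚ (aTwoCos N)).comp (X + X ^ (N - 1)) with hP
  have h1 : aeval ζ P = 0 := by
    have e : aeval ζ P = aeval (ζ ^ 1 + (ζ ^ 1) ^ (N - 1)) (minpoly ℚ (aTwoCos N)) := by
      rw [hP, aeval_comp]; simp
    rw [e, hpow]
    have e2 : ((2 * cos ((1 : ℕ) * (2 * π / N)) : ℝ) : ℂ) =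
        (Complex.ofRealAm.restrictScalars ℚ) (algebraMap algReal ℝ (aTwoCos N)) := by
      simp [aTwoCos, twoCos]
    rw [e2, aeval_algHom_apply, aeval_algebraMap_apply, minpoly.aeval]
    simp
  have h2 : minpoly ℚ ζ ∣ P := minpoly.dvd ℚ ζ h1
  have h3 : minpoly ℚ ζ = minpoly ℚ (ζ ^ k) := by
    rw [← cyclotomic_eq_minpoly_rat hprim hN,
      ← cyclotomic_eq_minpoly_rat (hprim.pow_of_coprime k hk) hN]
  have h4 : aeval (ζ ^ k) P = 0 := by
    obtain ⟨Q, hQ⟩ := h2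
    rw [hQ, map_mul, h3, minpoly.aeval, zero_mul]
  rw [← hpow]
  rw [hP, aeval_comp] at h4
  simpa using h4

/-- Multiplication of angles is realized by an embedding. -/
theorem exists_embedding_mul {N k : ℕ} (hN : 0 < N) (hk : Nat.Coprime k N) :
    ∃ σ : algReal →ₐ[ℚ] ℂ, ∀ p, 2 * p ∣ N → σ (awt p) = (cwt k p : ℂ) := by
  have h := isConjugate_twoCos hN hk
  have hmem : ((2 * cos (k * (2 * π / N)) : ℝ) : ℂ) ∈ (minpoly ℚ (aTwoCos N)).rootSet ℂ := by
    rw [mem_rootSet_of_ne (minpoly.ne_zero (Algebra.IsIntegral.isIntegral _))]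
    exact h
  rw [← Algebra.IsAlgebraic.range_eval_eq_rootSet_minpoly_of_splits ℂ
    (fun z => IsAlgClosed.splits _)] at hmem
  obtain ⟨σ, hσ⟩ := hmem
  exact ⟨σ, fun p hp => apply_awt_of_apply_aTwoCos hN σ.toRingHom hσ hp⟩

/-- Embeddings of totally real fields are real. -/
theorem exists_real_embedding {E : IntermediateField ℚ ℝ} [NumberField E]
    [NumberField.IsTotallyReal E] (φ : algReal →+* ℂ) :
    ∃ σ : E →+* ℝ, ∀ (x : E) (hx : (x : ℝ) ∈ algReal), ((σ x : ℝ) : ℂ) = φ ⟨x, hx⟩ := by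
  let ψ : E →+* ℂ := φ.comp (IntermediateField.inclusion (le_algReal E)).toRingHom
  have hψ := NumberField.IsTotallyReal.complexEmbedding_isReal ψ
  exact ⟨hψ.embedding, fun x hx => hψ.coe_embedding_apply x⟩

/-- In a totally real field, an element outside of a subfield is moved by some real embedding
that fixes the subfield. -/
theorem exists_real_embedding_ne {E F : IntermediateField ℚ ℝ} [NumberField E]
    [NumberField.IsTotallyReal E] (hF : F ≤ E) (x : E) (hx : (x : ℝ) ∉ F) :
    ∃ σ : E →+* ℝ, (∀ y : E, (y : ℝ) ∈ F → σ y = y) ∧ σ x ≠ x := by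
  have hE := le_algReal E
  obtain ⟨φ, hφ, hφx⟩ := exists_embedding_ne (hF.trans hE) ⟨x, hE x.2⟩ hx
  obtain ⟨σ, hσ⟩ := exists_real_embedding (E := E) φ.toRingHom
  refine ⟨σ, fun y hy => ?_, fun h => hφx ?_⟩
  · exact_mod_cast (hσ y (hE y.2)).trans (hφ ⟨y, hE y.2⟩ hy)
  · have := (hσ x (hE x.2)).symm
    rwa [h] at this

/-- In a totally real field, multiplication of angles is realized by a real embedding. -/
theorem exists_real_embedding_mul (E : IntermediateField ℚ ℝ) [NumberField E]
    [NumberField.IsTotallyReal E] {N k : ℕ} (hN : 0 < N) (hk : Nat.Coprime k N) :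
    ∃ σ : E →+* ℝ, ∀ p, 2 * p ∣ N → ∀ x : E, (x : ℝ) = wt p → σ x = cwt k p := by
  obtain ⟨φ, hφ⟩ := exists_embedding_mul hN hk
  obtain ⟨σ, hσ⟩ := exists_real_embedding (E := E) φ.toRingHom
  refine ⟨σ, fun p hp x hx => ?_⟩
  have h1 := hσ x (le_algReal E x.2)
  have h2 : (⟨x, le_algReal E x.2⟩ : algReal) = awt p := Subtype.ext hx
  rw [h2] at h1
  exact_mod_cast h1.trans (hφ p hp)

end VArith

namespace VArith

open Real

/-! ### Ground fields of triangles -/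

/-- The ground field of a triangle with angles `π/p`, `π/q`, `π/r`. -/
noncomputable def triField (p q r : ℕ) : IntermediateField ℚ ℝ :=
  IntermediateField.adjoin ℚ {wt p ^ 2, wt q ^ 2, wt r ^ 2, wt p * wt q * wt r}

theorem wt_two : wt 2 = 0 := by simp [wt]

theorem wt_three : wt 3 = 1 := by simp [wt]

theorem wt_pos {p : ℕ} (hp : 3 ≤ p) : 0 < wt p := by
  have hp' : (3 : ℝ) ≤ p := by exact_mod_cast hp
  have : 0 < cos (π / p) := by
    apply cos_pos_of_mem_Ioo
    constructor
    · have : 0 < π / p := by positivity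
      linarith [pi_pos]
    · rw [div_lt_div_iff₀ (by positivity) (by positivity)]
      nlinarith [pi_pos]
  rw [wt]; positivity

theorem wt_lt_two {p : ℕ} (hp : 2 ≤ p) : wt p < 2 := by
  have hp' : (2 : ℝ) ≤ p := by exact_mod_cast hp
  have h1 : 0 < π / p := by positivity
  have h2 : π / p ≤ π / 2 := by gcongr
  have : cos (π / p) < cos 0 := cos_lt_cos_of_nonneg_of_le_pi le_rfl (by linarith) h1
  rw [cos_zero] at this
  rw [wt]; linarith

theorem wt_sq (p : ℕ) : wt p ^ 2 = 2 + 2 * cos (2 * π / p) := by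
  rw [wt, show 2 * π / p = 2 * (π / p) by ring, cos_two_mul]; ring

theorem cwt_sq (k p : ℕ) : cwt k p ^ 2 = 2 + 2 * cos (k * (2 * π / p)) := by
  rw [cwt, show k * (2 * π / p) = 2 * (k * (π / p)) by ring, cos_two_mul]; ring

theorem pmOne_iff {k p : ℕ} :
    pmOne k p = true ↔ ∃ j : ℤ, (k : ℤ) = 1 + p * j ∨ (k : ℤ) = -1 + p * j := by
  simp only [pmOne, Bool.or_eq_true, beq_iff_eq]
  constructor
  · rintro (h | h)
    · obtain ⟨j, hj⟩ := (Nat.modEq_iff_dvd.1 (show 1 ≡ k [MOD p] from h.symm))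
      exact ⟨j, Or.inl (by push_cast at hj; lia)⟩
    · obtain ⟨j, hj⟩ := Nat.dvd_of_mod_eq_zero h
      exact ⟨j, Or.inr (by have : ((k + 1 : ℕ) : ℤ) = p * j := by exact_mod_cast hj
                           push_cast at this; lia)⟩
  · rintro ⟨j, h | h⟩
    · left
      exact ((Nat.modEq_iff_dvd (n := p) (a := 1) (b := k)).2 ⟨j, by push_cast; lia⟩).symm
    · right
      apply Nat.mod_eq_zero_of_dvd
      have : (p : ℤ) ∣ ((k + 1 : ℕ) : ℤ) := ⟨j, by push_cast; lia⟩
      exact_mod_cast this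

theorem cwt_sq_eq_iff {k p : ℕ} (hp : 0 < p) : cwt k p ^ 2 = wt p ^ 2 ↔ pmOne k p = true := by
  have hp' : (p : ℝ) ≠ 0 := by positivity
  rw [cwt_sq, wt_sq, pmOne_iff]
  have : (2 + 2 * cos (k * (2 * π / p)) = 2 + 2 * cos (2 * π / p)) ↔
      cos (2 * π / p) = cos (k * (2 * π / p)) := by
    constructor <;> intro h <;> linarith
  rw [this, cos_eq_cos_iff]
  refine exists_congr fun j => or_congr ?_ ?_
  · constructor
    · intro h
      have : (k : ℝ) = 1 + p * j := by
        field_simp at h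
        linarith
      exact_mod_cast this
    · intro h
      have : (k : ℝ) = 1 + p * j := by exact_mod_cast h
      rw [this]; field_simp; ring
  · constructor
    · intro h
      have : (k : ℝ) = -1 + p * j := by
        field_simp at h
        linarith
      exact_mod_cast this
    · intro h
      have : (k : ℝ) = -1 + p * j := by exact_mod_cast h
      rw [this]; field_simp; ring

/-- Writing `k = ±1 + p j`, the angle `kπ/p` is `±π/p` shifted by `jπ`, so the sign is the parity of
`j`, that is, the residue of `k` modulo `2p`. -/
theorem cwt_eq_of_pmOne {k p : ℕ} (hp : 0 < p) (h : pmOne k p = true) :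
    cwt k p = (if pmOne k (2 * p) then 1 else -1) * wt p := by
  have hp' : (p : ℝ) ≠ 0 := by positivity
  obtain ⟨j, hj⟩ := pmOne_iff.1 h
  have e : cos (k * (π / p)) = cos (π / p + j * π) := by
    rcases hj with hj | hj
    · have : (k : ℝ) = 1 + p * j := by exact_mod_cast hj
      rw [this]; congr 1; field_simp
    · have : (k : ℝ) = -1 + p * j := by exact_mod_cast hj
      rw [this, ← cos_neg, ← cos_add_int_mul_two_pi _ j]; congr 1; field_simp; ring
  rcases Int.even_or_odd j with hev | hodd
  · have : pmOne k (2 * p) = true := by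
      obtain ⟨i, hi⟩ := hev
      rw [pmOne_iff]
      refine ⟨i, ?_⟩
      subst hi
      push_cast
      rcases hj with hj | hj
      · left; linear_combination hj
      · right; linear_combination hj
    rw [this, if_pos rfl, cwt, e, wt, cos_add_int_mul_pi, hev.neg_one_zpow]; ring
  · have e2 : cwt k p = -wt p := by
      rw [cwt, e, wt, cos_add_int_mul_pi, hodd.neg_one_zpow]; ring
    -- This is not contradictory with `j` odd: for `p = 2`, `k = 3` both hold, and then `wt 2 = 0`
    -- makes the two signs agree.
    by_cases h2 : pmOne k (2 * p) = true
    · rw [h2, if_pos rfl, one_mul]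
      obtain ⟨i, hi⟩ := pmOne_iff.1 h2
      rw [cwt, wt]
      congr 1
      rcases hi with hi | hi
      · have : (k : ℝ) = 1 + (2 * p : ℕ) * i := by exact_mod_cast hi
        rw [this, ← cos_add_int_mul_two_pi (π / p) i]
        push_cast; congr 1; field_simp
      · have : (k : ℝ) = -1 + (2 * p : ℕ) * i := by exact_mod_cast hi
        rw [this, ← cos_neg (π / p), ← cos_add_int_mul_two_pi (-(π / p)) i]
        push_cast; congr 1; field_simp
    · rw [if_neg h2, e2]; ring

/-- The squares are fixed iff `k ≡ ±1` modulo each label. The product is then fixed iff it vanishes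
(a label `2`) or the number of minus signs is even; for three factors this is what the chain of `==`
expresses. -/
theorem fixesTri_iff {k p q r : ℕ} (hp : 2 ≤ p) (hq : 2 ≤ q) (hr : 2 ≤ r) :
    fixesTri k p q r = true ↔ cwt k p ^ 2 = wt p ^ 2 ∧ cwt k q ^ 2 = wt q ^ 2 ∧
      cwt k r ^ 2 = wt r ^ 2 ∧ cwt k p * cwt k q * cwt k r = wt p * wt q * wt r := by
  rw [cwt_sq_eq_iff (by lia), cwt_sq_eq_iff (by lia), cwt_sq_eq_iff (by lia)]
  simp only [fixesTri, Bool.and_eq_true, Bool.or_eq_true, and_assoc]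
  refine and_congr_right fun h1 => and_congr_right fun h2 => and_congr_right fun h3 => ?_
  rw [cwt_eq_of_pmOne (by lia) h1, cwt_eq_of_pmOne (by lia) h2, cwt_eq_of_pmOne (by lia) h3]
  by_cases hz : p = 2 ∨ q = 2 ∨ r = 2
  · have : wt p * wt q * wt r = 0 := by
      rcases hz with rfl | rfl | rfl <;> simp [wt_two]
    refine iff_of_true ?_ ?_
    · simp only [beq_iff_eq]; tauto
    · rw [this, show ∀ a b c : ℝ, a * wt p * (b * wt q) * (c * wt r) =
        a * b * c * (wt p * wt q * wt r) by intros; ring, this, mul_zero]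
  · push Not at hz
    have hpos : 0 < wt p * wt q * wt r :=
      mul_pos (mul_pos (wt_pos (by lia)) (wt_pos (by lia))) (wt_pos (by lia))
    have hne : ¬ (-(wt p * wt q * wt r) = wt p * wt q * wt r) := fun h => by linarith
    cases pmOne k (2 * p) <;> cases pmOne k (2 * q) <;> cases pmOne k (2 * r) <;>
      simp [hz] <;> linarith

theorem triField_le_algReal (p q r : ℕ) : triField p q r ≤ algReal := by
  rw [triField, IntermediateField.adjoin_le_iff]
  rintro x (rfl | rfl | rfl | rfl)
  · exact pow_mem (wt_mem_algReal _) 2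
  · exact pow_mem (wt_mem_algReal _) 2
  · exact pow_mem (wt_mem_algReal _) 2
  · exact mul_mem (mul_mem (wt_mem_algReal _) (wt_mem_algReal _)) (wt_mem_algReal _)

/-- A triangle field embeds in another one if its stabilizer is larger. -/
theorem triField_le {p q r p' q' r' N : ℕ} (hp : 2 ≤ p) (hq : 2 ≤ q) (hr : 2 ≤ r)
    (hp' : 2 ≤ p') (hq' : 2 ≤ q') (hr' : 2 ≤ r') (hN : 0 < N) (h1 : 2 * p ∣ N) (h2 : 2 * q ∣ N)
    (h3 : 2 * r ∣ N) (h1' : 2 * p' ∣ N) (h2' : 2 * q' ∣ N) (h3' : 2 * r' ∣ N)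
    (h : ∀ k < N, Nat.Coprime k N → fixesTri k p' q' r' = true → fixesTri k p q r = true) :
    triField p q r ≤ triField p' q' r' := by
  -- An embedding that fixes the target field acts as some multiplier `k` in the stabilizer of the
  -- second triangle, hence of the first. Then `exists_embedding_ne` excludes generators outside of
  -- the target.
  have key : ∀ σ : algReal →ₐ[ℚ] ℂ,
      (∀ y : algReal, (y : ℝ) ∈ triField p' q' r' → σ y = ((y : ℝ) : ℂ)) →
      σ (awt p ^ 2) = ((wt p ^ 2 : ℝ) : ℂ) ∧ σ (awt q ^ 2) = ((wt q ^ 2 : ℝ) : ℂ) ∧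
      σ (awt r ^ 2) = ((wt r ^ 2 : ℝ) : ℂ) ∧
      σ (awt p * awt q * awt r) = ((wt p * wt q * wt r : ℝ) : ℂ) := by
    intro σ hσ
    obtain ⟨k, hk, hkN, hkσ⟩ := exists_mul_of_embedding σ.toRingHom hN
    have hkσ' : ∀ p, 2 * p ∣ N → σ (awt p) = (cwt k p : ℂ) := hkσ
    have hfix := h k hk hkN ((fixesTri_iff hp' hq' hr').2 ⟨?_, ?_, ?_, ?_⟩)
    · obtain ⟨f1, f2, f3, f4⟩ := (fixesTri_iff hp hq hr).1 hfix
      rw [← f1, ← f2, ← f3, ← f4]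
      simp only [map_pow, map_mul, hkσ' _ h1, hkσ' _ h2, hkσ' _ h3]
      norm_cast
    · have := hσ (awt p' ^ 2) (IntermediateField.subset_adjoin _ _ (by simp [awt]))
      rw [map_pow, hkσ' _ h1'] at this
      exact_mod_cast this
    · have := hσ (awt q' ^ 2) (IntermediateField.subset_adjoin _ _ (by simp [awt]))
      rw [map_pow, hkσ' _ h2'] at this
      exact_mod_cast this
    · have := hσ (awt r' ^ 2) (IntermediateField.subset_adjoin _ _ (by simp [awt]))
      rw [map_pow, hkσ' _ h3'] at this
      exact_mod_cast this
    · have := hσ (awt p' * awt q' * awt r') (IntermediateField.subset_adjoin _ _ (by simp [awt]))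
      rw [map_mul, map_mul, hkσ' _ h1', hkσ' _ h2', hkσ' _ h3'] at this
      exact_mod_cast this
  rw [triField, IntermediateField.adjoin_le_iff]
  rintro x (rfl | rfl | rfl | rfl)
  · by_contra hx
    obtain ⟨σ, hσ, hσx⟩ := exists_embedding_ne (triField_le_algReal p' q' r') (awt p ^ 2) hx
    exact hσx (key σ hσ).1
  · by_contra hx
    obtain ⟨σ, hσ, hσx⟩ := exists_embedding_ne (triField_le_algReal p' q' r') (awt q ^ 2) hx
    exact hσx (key σ hσ).2.1
  · by_contra hx
    obtain ⟨σ, hσ, hσx⟩ := exists_embedding_ne (triField_le_algReal p' q' r') (awt r ^ 2) hx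
    exact hσx (key σ hσ).2.2.1
  · by_contra hx
    obtain ⟨σ, hσ, hσx⟩ := exists_embedding_ne (triField_le_algReal p' q' r')
      (awt p * awt q * awt r) hx
    exact hσx (key σ hσ).2.2.2

theorem triField_eq_of_sameStabilizer {p q r p' q' r' : ℕ} (hp : 2 ≤ p) (hq : 2 ≤ q) (hr : 2 ≤ r)
    (hp' : 2 ≤ p') (hq' : 2 ≤ q') (hr' : 2 ≤ r') (h : sameStabilizer p q r p' q' r' = true) :
    triField p q r = triField p' q' r' := by
  simp only [sameStabilizer, List.all_eq_true, List.mem_range, Bool.or_eq_true,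
    Bool.not_eq_true', beq_eq_false_iff_ne, beq_iff_eq] at h
  set M := Nat.lcm (Nat.lcm p (Nat.lcm q r)) (Nat.lcm p' (Nat.lcm q' r')) with hM
  have hMpos : 0 < M := by
    apply Nat.lcm_pos <;> refine Nat.lcm_pos (by lia) (Nat.lcm_pos (by lia) (by lia))
  have h1 : p ∣ M := (Nat.dvd_lcm_left _ _).trans (Nat.dvd_lcm_left _ _)
  have h2 : q ∣ M := ((Nat.dvd_lcm_left _ _).trans (Nat.dvd_lcm_right _ _)).trans
    (Nat.dvd_lcm_left _ _)
  have h3 : r ∣ M := ((Nat.dvd_lcm_right _ _).trans (Nat.dvd_lcm_right _ _)).trans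
    (Nat.dvd_lcm_left _ _)
  have h1' : p' ∣ M := (Nat.dvd_lcm_left _ _).trans (Nat.dvd_lcm_right _ _)
  have h2' : q' ∣ M := ((Nat.dvd_lcm_left _ _).trans (Nat.dvd_lcm_right _ _)).trans
    (Nat.dvd_lcm_right _ _)
  have h3' : r' ∣ M := ((Nat.dvd_lcm_right _ _).trans (Nat.dvd_lcm_right _ _)).trans
    (Nat.dvd_lcm_right _ _)
  have hk : ∀ k < 2 * M, Nat.Coprime k (2 * M) → fixesTri k p q r = fixesTri k p' q' r' :=
    fun k hk hc => (h k hk).resolve_left fun hne => hne hc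
  apply le_antisymm
  · exact triField_le hp hq hr hp' hq' hr' (by positivity) (mul_dvd_mul_left 2 h1)
      (mul_dvd_mul_left 2 h2) (mul_dvd_mul_left 2 h3) (mul_dvd_mul_left 2 h1')
      (mul_dvd_mul_left 2 h2') (mul_dvd_mul_left 2 h3') fun k h1 h2 h3 => (hk k h1 h2).trans h3
  · exact triField_le hp' hq' hr' hp hq hr (by positivity) (mul_dvd_mul_left 2 h1')
      (mul_dvd_mul_left 2 h2') (mul_dvd_mul_left 2 h3') (mul_dvd_mul_left 2 h1)
      (mul_dvd_mul_left 2 h2) (mul_dvd_mul_left 2 h3) fun k h1 h2 h3 =>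
        (hk k h1 h2).symm.trans h3

theorem adjoin_eq_adjoin {S T : Set ℝ} (h1 : S ⊆ IntermediateField.adjoin ℚ T)
    (h2 : T ⊆ IntermediateField.adjoin ℚ S) :
    IntermediateField.adjoin ℚ S = IntermediateField.adjoin ℚ T :=
  le_antisymm (IntermediateField.adjoin_le_iff.2 h1) (IntermediateField.adjoin_le_iff.2 h2)

theorem wt_eight_sq : wt 8 ^ 2 = 2 + √2 := by
  rw [wt_sq]
  push_cast
  rw [show 2 * π / 8 = π / 4 by ring, cos_pi_div_four]
  ring

theorem wt_twelve_sq : wt 12 ^ 2 = 2 + √3 := by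
  rw [wt_sq]
  push_cast
  rw [show 2 * π / 12 = π / 6 by ring, cos_pi_div_six]
  ring

theorem wt_five : wt 5 = (1 + √5) / 2 := by
  rw [wt]
  push_cast
  rw [cos_pi_div_five]
  ring

theorem wt_five_sq : wt 5 ^ 2 = (3 + √5) / 2 := by
  have := sq_sqrt (show (0 : ℝ) ≤ 5 by norm_num)
  rw [wt_five]
  linear_combination this / 4

theorem wt_four : wt 4 = √2 := by
  rw [wt]
  push_cast
  rw [cos_pi_div_four]
  ring

theorem wt_six : wt 6 = √3 := by
  rw [wt]
  push_cast
  rw [cos_pi_div_six]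
  ring

theorem triField_two_three (b : ℕ) :
    triField 2 3 b = IntermediateField.adjoin ℚ {cos (2 * π / b)} := by
  rw [triField, wt_two, wt_three, wt_sq]
  apply adjoin_eq_adjoin
  · have h : cos (2 * π / b) ∈ IntermediateField.adjoin ℚ {cos (2 * π / b)} :=
      IntermediateField.subset_adjoin _ _ rfl
    rintro x (rfl | rfl | rfl | rfl)
    · simp
    · simp
    · exact add_mem (ofNat_mem _ 2) (mul_mem (ofNat_mem _ 2) h)
    · simp
  · rintro x rfl
    set F := IntermediateField.adjoin ℚ (_ : Set ℝ)
    have h : 2 + 2 * cos (2 * π / b) ∈ F := IntermediateField.subset_adjoin _ _ (by simp)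
    have e : cos (2 * π / b) = (2 + 2 * cos (2 * π / b) - 2) / 2 := by ring
    have h' := div_mem (sub_mem h (ofNat_mem F 2)) (ofNat_mem F 2)
    rwa [← e] at h'

theorem adjoin_singleton_eq_of_rat {x y : ℝ} (a b : ℚ) (ha : a ≠ 0) (h : y = a * x + b) :
    IntermediateField.adjoin ℚ {x} = IntermediateField.adjoin ℚ {y} := by
  have ha' : (a : ℝ) ≠ 0 := by exact_mod_cast ha
  apply adjoin_eq_adjoin
  · rintro z rfl
    have hy : y ∈ IntermediateField.adjoin ℚ {y} := IntermediateField.subset_adjoin _ _ rfl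
    have e : z = (y - b) / a := by rw [h]; field_simp; ring
    rw [e]
    exact div_mem (sub_mem hy (SubfieldClass.ratCast_mem _ b)) (SubfieldClass.ratCast_mem _ a)
  · rintro z rfl
    have hx : x ∈ IntermediateField.adjoin ℚ {x} := IntermediateField.subset_adjoin _ _ rfl
    rw [h]
    exact add_mem (mul_mem (SubfieldClass.ratCast_mem _ a) hx) (SubfieldClass.ratCast_mem _ b)

theorem triField_2_3_2 : triField 2 3 2 = ⊥ := by
  rw [triField_two_three, IntermediateField.adjoin_simple_eq_bot_iff]
  push_cast
  rw [show 2 * π / 2 = π by ring, cos_pi]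
  exact neg_mem (one_mem _)

theorem triField_2_3_8 : triField 2 3 8 = IntermediateField.adjoin ℚ {√2} := by
  rw [triField_two_three]
  refine adjoin_singleton_eq_of_rat 2 0 (by norm_num) ?_
  push_cast
  rw [show 2 * π / 8 = π / 4 by ring, cos_pi_div_four]; ring

theorem triField_2_3_12 : triField 2 3 12 = IntermediateField.adjoin ℚ {√3} := by
  rw [triField_two_three]
  refine adjoin_singleton_eq_of_rat 2 0 (by norm_num) ?_
  push_cast
  rw [show 2 * π / 12 = π / 6 by ring, cos_pi_div_six]; ring

theorem triField_2_3_5 : triField 2 3 5 = IntermediateField.adjoin ℚ {√5} := by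
  rw [triField_two_three]
  refine adjoin_singleton_eq_of_rat 4 1 (by norm_num) ?_
  have h := wt_sq 5
  rw [wt_five_sq] at h
  push_cast at h ⊢
  linarith

theorem triField_3_4_6 : triField 3 4 6 = IntermediateField.adjoin ℚ {√6} := by
  have h2 := sq_sqrt (show (0 : ℝ) ≤ 2 by norm_num)
  have h3 := sq_sqrt (show (0 : ℝ) ≤ 3 by norm_num)
  rw [triField, wt_three, wt_four, wt_six, h2, h3, one_mul, ← sqrt_mul (by norm_num)]
  norm_num
  apply adjoin_eq_adjoin
  · rintro x (rfl | rfl | rfl | rfl)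
    · exact one_mem _
    · exact ofNat_mem _ 2
    · exact ofNat_mem _ 3
    · exact IntermediateField.subset_adjoin _ _ rfl
  · rintro x rfl
    exact IntermediateField.subset_adjoin _ _ (by simp)

theorem triField_2_8_12 : triField 2 8 12 = IntermediateField.adjoin ℚ {√2, √3} := by
  rw [triField, wt_two, wt_eight_sq, wt_twelve_sq]
  apply adjoin_eq_adjoin
  · rintro x (rfl | rfl | rfl | rfl)
    · simp
    · exact add_mem (ofNat_mem _ 2) (IntermediateField.subset_adjoin _ _ (by simp))
    · exact add_mem (ofNat_mem _ 2) (IntermediateField.subset_adjoin _ _ (by simp))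
    · simp
  · set F := IntermediateField.adjoin ℚ (_ : Set ℝ)
    have h2 : 2 + √2 ∈ F := IntermediateField.subset_adjoin _ _ (by simp)
    have h3 : 2 + √3 ∈ F := IntermediateField.subset_adjoin _ _ (by simp)
    rintro x (rfl | rfl)
    · simpa using sub_mem h2 (ofNat_mem F 2)
    · simpa using sub_mem h3 (ofNat_mem F 2)

theorem triField_2_5_8 : triField 2 5 8 = IntermediateField.adjoin ℚ {√2, √5} := by
  rw [triField, wt_two, wt_eight_sq, wt_five_sq]
  apply adjoin_eq_adjoin
  · rintro x (rfl | rfl | rfl | rfl)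
    · simp
    · exact div_mem (add_mem (ofNat_mem _ 3) (IntermediateField.subset_adjoin _ _ (by simp)))
        (ofNat_mem _ 2)
    · exact add_mem (ofNat_mem _ 2) (IntermediateField.subset_adjoin _ _ (by simp))
    · simp
  · set F := IntermediateField.adjoin ℚ (_ : Set ℝ)
    have h2 : 2 + √2 ∈ F := IntermediateField.subset_adjoin _ _ (by simp)
    have h3 : (3 + √5) / 2 ∈ F := IntermediateField.subset_adjoin _ _ (by simp)
    rintro x (rfl | rfl)
    · simpa using sub_mem h2 (ofNat_mem F 2)
    · have := sub_mem (mul_mem h3 (ofNat_mem F 2)) (ofNat_mem F 3)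
      have e : (3 + √5) / 2 * 2 - 3 = √5 := by ring
      rwa [e] at this

theorem sqrt_field_mem {a : ℕ} (ha : a ∈ ({2, 3, 5, 6} : Set ℕ)) :
    IntermediateField.adjoin ℚ {√(a : ℝ)} ∈ fieldsT :=
  Or.inl (Or.inl (Or.inr ⟨a, ha, rfl⟩))

theorem cos_field_mem {b : ℕ} (hb : b ∈ ({7, 9, 11, 15, 16, 20} : Set ℕ)) :
    triField 2 3 b ∈ fieldsT :=
  Or.inr ⟨b, hb, triField_two_three b⟩

theorem bot_mem_fieldsT : ⊥ ∈ fieldsT := Or.inl (Or.inl (Or.inl rfl))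

theorem sqrt_two_mem_fieldsT : IntermediateField.adjoin ℚ {√2} ∈ fieldsT := by
  simpa using sqrt_field_mem (a := 2) (by simp)

theorem sqrt_five_mem_fieldsT : IntermediateField.adjoin ℚ {√5} ∈ fieldsT := by
  simpa using sqrt_field_mem (a := 5) (by simp)

theorem sqrt_two_five_mem_fieldsT : IntermediateField.adjoin ℚ {√2, √5} ∈ fieldsT :=
  Or.inl (Or.inr (Or.inr rfl))

theorem HasKnownStabilizer.mem_fieldsT {p q r : ℕ} (hp : 2 ≤ p) (hq : 2 ≤ q) (hr : 2 ≤ r)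
    (h : HasKnownStabilizer p q r) : triField p q r ∈ fieldsT := by
  obtain ⟨T, hT, h⟩ := h
  have hT2 : ∀ T ∈ triList, 2 ≤ T.1 ∧ 2 ≤ T.2.1 ∧ 2 ≤ T.2.2 := by decide
  obtain ⟨h1, h2, h3⟩ := hT2 T hT
  rw [triField_eq_of_sameStabilizer hp hq hr h1 h2 h3 h]
  simp only [triList, List.mem_cons, List.not_mem_nil, or_false] at hT
  rcases hT with rfl | rfl | rfl | rfl | rfl | rfl | rfl | rfl | rfl | rfl | rfl | rfl | rfl
  · rw [triField_2_3_2]; exact bot_mem_fieldsT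
  · rw [triField_2_3_8]; exact sqrt_two_mem_fieldsT
  · rw [triField_2_3_12]; simpa using sqrt_field_mem (a := 3) (by simp)
  · rw [triField_2_3_5]; exact sqrt_five_mem_fieldsT
  · rw [triField_3_4_6]; simpa using sqrt_field_mem (a := 6) (by simp)
  · rw [triField_2_8_12]; exact Or.inl (Or.inr (Or.inl rfl))
  · rw [triField_2_5_8]; exact sqrt_two_five_mem_fieldsT
  all_goals exact cos_field_mem (by simp)

end VArith

namespace VArith

open Real Matrix

/-! ### Quadratic forms of matrices -/

section Quad

variable {ι κ : Type} [Fintype ι] [Fintype κ]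

theorem quad_eq_sum (M : Matrix ι ι ℝ) (x : ι → ℝ) :
    x ⬝ᵥ M *ᵥ x = ∑ i, x i * ∑ j, M i j * x j := rfl

/-- Extension of vectors by zero is compatible with passing to a submatrix. -/
theorem exists_extend (M : Matrix ι ι ℝ) {f : κ → ι} (hf : Function.Injective f) (w : κ → ℝ) :
    ∃ x : ι → ℝ, (∀ k, x (f k) = w k) ∧ (∀ i, i ∉ Set.range f → x i = 0) ∧
      x ⬝ᵥ M *ᵥ x = w ⬝ᵥ (M.submatrix f f) *ᵥ w := by
  refine ⟨Function.extend f w 0, fun k => hf.extend_apply _ _ _,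
    fun i hi => Function.extend_apply' _ _ _ hi, ?_⟩
  have key : ∀ g : ι → ℝ, ∑ i, Function.extend f w 0 i * g i = ∑ k, w k * g (f k) := fun g =>
    (Fintype.sum_of_injective f hf _ _
      (fun i hi => by rw [Function.extend_apply' _ _ _ hi]; simp)
      (fun k => by rw [hf.extend_apply])).symm
  rw [quad_eq_sum, key, quad_eq_sum]
  refine Finset.sum_congr rfl fun k _ => ?_
  congr 1
  simp only [mul_comm (M (f k) _), key]
  simp [mul_comm]

theorem exists_pair_vector {M : Matrix ι ι ℝ} (hM : M.IsSymm) (hd : ∀ i, M i i = -2) {i j : ι}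
    (hij : i ≠ j) (a b : ℝ) : ∃ x : ι → ℝ, x i = a ∧ x j = b ∧ (∀ l, l ≠ i → l ≠ j → x l = 0) ∧
      x ⬝ᵥ M *ᵥ x = -2 * a ^ 2 - 2 * b ^ 2 + 2 * a * b * M i j := by
  have hf : Function.Injective ![i, j] := by
    intro k l
    fin_cases k <;> fin_cases l <;> simp [hij, hij.symm]
  obtain ⟨x, h1, h2, h3⟩ := exists_extend M hf ![a, b]
  refine ⟨x, by simpa using h1 0, by simpa using h1 1, fun l hi hj => h2 l ?_, ?_⟩
  · rintro ⟨k, hk⟩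
    fin_cases k
    · exact hi hk.symm
    · exact hj hk.symm
  · rw [h3, quad_eq_sum]
    simp [Fin.sum_univ_two, hd, hM.apply i j]
    ring

theorem exists_triple_vector {M : Matrix ι ι ℝ} (hM : M.IsSymm) (hd : ∀ i, M i i = -2) {i j l : ι}
    (hij : i ≠ j) (hil : i ≠ l) (hjl : j ≠ l) (a b c : ℝ) :
    ∃ x : ι → ℝ, x i = a ∧ x j = b ∧ x l = c ∧ (∀ m, m ≠ i → m ≠ j → m ≠ l → x m = 0) ∧
      x ⬝ᵥ M *ᵥ x = -2 * a ^ 2 - 2 * b ^ 2 - 2 * c ^ 2 + 2 * a * b * M i j + 2 * a * c * M i l +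
        2 * b * c * M j l := by
  have hf : Function.Injective ![i, j, l] := by
    intro k m
    fin_cases k <;> fin_cases m <;> simp [hij, hij.symm, hil, hil.symm, hjl, hjl.symm]
  obtain ⟨x, h1, h2, h3⟩ := exists_extend M hf ![a, b, c]
  refine ⟨x, by simpa using h1 0, by simpa using h1 1, by simpa using h1 2,
    fun m hi hj hl => h2 m ?_, ?_⟩
  · rintro ⟨k, hk⟩
    fin_cases k
    · exact hi hk.symm
    · exact hj hk.symm
    · exact hl hk.symm
  · rw [h3, quad_eq_sum]
    simp [Fin.sum_univ_three, hd, hM.apply i j, hM.apply i l, hM.apply j l]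
    ring

/-- Entries outside of `P` are small if the form is negative definite on the vectors that vanish
on `P`. -/
theorem sq_lt_four_of_neg {M : Matrix ι ι ℝ} (hM : M.IsSymm) (hd : ∀ i, M i i = -2)
    {P : ι → Prop} (hneg : ∀ x : ι → ℝ, (∀ i, P i → x i = 0) → x ≠ 0 → x ⬝ᵥ M *ᵥ x < 0) {i j : ι}
    (hij : i ≠ j) (hi : ¬ P i) (hj : ¬ P j) : M i j ^ 2 < 4 := by
  -- On this vector the form takes the value `2 * M i j ^ 2 - 8`.
  obtain ⟨x, h1, h2, h3, h4⟩ := exists_pair_vector hM hd hij 2 (M i j)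
  have := hneg x (fun m hm => h3 m (fun h => hi (h ▸ hm)) (fun h => hj (h ▸ hm)))
    (fun h => by rw [h] at h1; simp at h1)
  rw [h4] at this
  nlinarith

theorem disc_neg_of_neg {M : Matrix ι ι ℝ} (hM : M.IsSymm) (hd : ∀ i, M i i = -2)
    {P : ι → Prop} (hneg : ∀ x : ι → ℝ, (∀ i, P i → x i = 0) → x ≠ 0 → x ⬝ᵥ M *ᵥ x < 0) {i j l : ι}
    (hij : i ≠ j) (hil : i ≠ l) (hjl : j ≠ l) (hi : ¬ P i) (hj : ¬ P j) (hl : ¬ P l) :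
    disc (M i j) (M i l) (M j l) < 0 := by
  have h0 := sq_lt_four_of_neg hM hd hneg hij hi hj
  -- The coordinates are the cofactors of the last row of the `3 × 3` Gram matrix, so the form takes
  -- the value `(4 - M i j ^ 2)` times the determinant, which is twice `disc`.
  obtain ⟨x, h1, h2, h3, h4, h5⟩ := exists_triple_vector hM hd hij hil hjl
    (M i j * M j l + 2 * M i l) (M i j * M i l + 2 * M j l) (4 - M i j ^ 2)
  have := hneg x (fun m hm => h4 m (fun h => hi (h ▸ hm)) (fun h => hj (h ▸ hm))
    (fun h => hl (h ▸ hm))) (fun h => by rw [h] at h3; simp at h3; linarith)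
  rw [h5] at this
  have e : (4 - M i j ^ 2) * (2 * disc (M i j) (M i l) (M j l)) < 0 := by
    refine lt_of_eq_of_lt ?_ this
    rw [disc]; ring
  have := (pos_iff_neg_of_mul_neg e).1 (by linarith)
  linarith

theorem exists_pos_of_isHyperbolic {M : Matrix ι ι ℝ} (h : IsHyperbolic M) :
    ∃ x : ι → ℝ, 0 < x ⬝ᵥ M *ᵥ x := by
  classical
  have h' : sigPos (Matrix.toQuadraticForm' M) = 1 := by
    unfold IsHyperbolic at h
    convert h
  obtain ⟨V, hV, hp⟩ := exists_finrank_eq_sigPos_and_posDef (Matrix.toQuadraticForm' M)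
  rw [h'] at hV
  obtain ⟨⟨v, hv⟩, hv0, -⟩ := finrank_eq_one_iff'.1 hV
  refine ⟨v, ?_⟩
  have := hp ⟨v, hv⟩ hv0
  rw [QuadraticMap.restrict_apply] at this
  simpa [Matrix.toQuadraticForm', Matrix.toLinearMap₂'_apply'] using this

/-- A subspace of codimension one on which the form is nonpositive bounds the positive index by one.
-/
theorem isHyperbolic_of_pos {M : Matrix ι ι ℝ} {x : ι → ℝ} (hx : 0 < x ⬝ᵥ M *ᵥ x) (i : ι)
    (h : ∀ y : ι → ℝ, y i = 0 → y ⬝ᵥ M *ᵥ y ≤ 0) : IsHyperbolic M := by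
  classical
  have hQ : ∀ y, Matrix.toQuadraticForm' M y = y ⬝ᵥ M *ᵥ y := fun y => by
    simp [Matrix.toQuadraticForm', Matrix.toLinearMap₂'_apply']
  suffices h' : sigPos (Matrix.toQuadraticForm' M) = 1 by
    unfold IsHyperbolic
    convert h'
  apply le_antisymm
  · have hker := QuadraticForm.sigPos_add_finrank_le_of_nonpos (Q := Matrix.toQuadraticForm' M)
      (V := LinearMap.ker (LinearMap.proj i : (ι → ℝ) →ₗ[ℝ] ℝ)) (fun y hy => by
        rw [hQ]
        exact h y hy)
    have hr := LinearMap.finrank_range_add_finrank_ker (LinearMap.proj i : (ι → ℝ) →ₗ[ℝ] ℝ)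
    have hr1 : Module.finrank ℝ (LinearMap.range (LinearMap.proj i : (ι → ℝ) →ₗ[ℝ] ℝ)) ≤ 1 := by
      simpa using Submodule.finrank_le (LinearMap.range (LinearMap.proj i : (ι → ℝ) →ₗ[ℝ] ℝ))
    lia
  · have hx0 : x ≠ 0 := by rintro rfl; simp at hx
    have := le_sigPos_of_posDef (Matrix.toQuadraticForm' M) (V := Submodule.span ℝ {x}) (by
      rintro ⟨y, hy⟩ hy0
      obtain ⟨c, rfl⟩ := Submodule.mem_span_singleton.1 hy
      have hc : c ≠ 0 := by rintro rfl; simp at hy0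
      rw [QuadraticMap.restrict_apply, QuadraticMap.map_smul, hQ]
      have : 0 < c * c := mul_self_pos.2 hc
      exact smul_pos this hx)
    rwa [finrank_span_singleton hx0] at this

end Quad

end VArith

namespace VArith

open Real Matrix

/-! ### Ground fields of V-arithmetic matrices -/

section Ground

variable {ι : Type} {A : Matrix ι ι ℝ}

theorem cyclicProduct_mem_groundField (A : Matrix ι ι ℝ) {m : ℕ} (i : Fin (m + 1) → ι) :
    cyclicProduct A i ∈ groundField A :=
  IntermediateField.subset_adjoin _ _ ⟨m, i, rfl⟩

theorem entry_mem_entryField (A : Matrix ι ι ℝ) (i j : ι) : A i j ∈ entryField A :=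
  (entry A i j).2

theorem sq_mem_groundField (hA : A.IsSymm) (i j : ι) : A i j ^ 2 ∈ groundField A := by
  have h := cyclicProduct_mem_groundField A ![i, j]
  have e : cyclicProduct A ![i, j] = A i j ^ 2 := by
    simp [cyclicProduct, Fin.prod_univ_two, hA.apply i j]
    ring
  rwa [e] at h

theorem triple_mem_groundField (hA : A.IsSymm) (i j l : ι) :
    A i j * A i l * A j l ∈ groundField A := by
  have h := cyclicProduct_mem_groundField A ![i, j, l]
  have e : cyclicProduct A ![i, j, l] = A i j * A i l * A j l := by
    have h2 : (2 : Fin 3) + 1 = 0 := rfl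
    simp [cyclicProduct, Fin.prod_univ_three, hA.apply i l, h2]
    ring
  rwa [e] at h

theorem groundField_le_entryField (A : Matrix ι ι ℝ) : groundField A ≤ entryField A := by
  rw [groundField, IntermediateField.adjoin_le_iff]
  rintro x ⟨m, i, rfl⟩
  exact prod_mem fun k _ => entry_mem_entryField A _ _

theorem isSymm_conjugate (hA : A.IsSymm) (σ : entryField A →+* ℝ) : (conjugate A σ).IsSymm := by
  ext i j
  simp only [conjugate, transpose_apply, of_apply]
  congr 1
  exact Subtype.ext (hA.apply i j)

theorem conjugate_diag (hA : ∀ i, A i i = -2) (σ : entryField A →+* ℝ) (i : ι) :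
    conjugate A σ i i = -2 := by
  have : entry A i i = -2 := Subtype.ext (hA i)
  rw [conjugate, of_apply, this, map_neg, map_ofNat]

variable [Fintype ι]

/-- Nontrivial conjugates of a nondegenerate V-arithmetic matrix are negative definite. -/
theorem IsVArithmetic.conjugate_neg (h : IsVArithmetic A) (hA : ∀ x, A *ᵥ x = 0 → x = 0)
    (σ : entryField A →+* ℝ) (hσ : ∃ x : entryField A, (x : ℝ) ∈ groundField A ∧ σ x ≠ (x : ℝ))
    (x : ι → ℝ) (hx : x ≠ 0) : x ⬝ᵥ conjugate A σ *ᵥ x < 0 := by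
  classical
  refine h.negDef σ hσ x fun h0 => ?_
  -- The determinant of the conjugate is the image of `det A`, so it vanishes only if `A` itself is
  -- degenerate.
  have hdet : (conjugate A σ).det = 0 := Matrix.exists_mulVec_eq_zero_iff.1 ⟨x, hx, h0⟩
  let a : Matrix ι ι (entryField A) := Matrix.of (entry A)
  have h1 : σ a.det = (conjugate A σ).det := by
    rw [RingHom.map_det]; rfl
  have h2 : ((a.det : entryField A) : ℝ) = A.det :=
    (RingHom.map_det (algebraMap (entryField A) ℝ) a).trans rfl
  rw [hdet, map_eq_zero] at h1
  rw [h1] at h2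
  obtain ⟨y, hy, hy0⟩ := Matrix.exists_mulVec_eq_zero_iff.2 h2.symm
  exact hy (hA y hy0)

/-- The ground field lies in a subfield if no conjugate over the subfield is negative definite. -/
theorem IsVArithmetic.groundField_le (h : IsVArithmetic A) (hA : ∀ x, A *ᵥ x = 0 → x = 0)
    {F : IntermediateField ℚ ℝ} (hF : F ≤ entryField A)
    (hσ : ∀ σ : entryField A →+* ℝ, (∀ y : entryField A, (y : ℝ) ∈ F → σ y = y) →
      ¬ ∀ x : ι → ℝ, x ≠ 0 → x ⬝ᵥ conjugate A σ *ᵥ x < 0) : groundField A ≤ F := by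
  intro x hx
  by_contra hxF
  have := h.numberField
  have := h.totallyReal
  obtain ⟨σ, h1, h2⟩ := exists_real_embedding_ne hF ⟨x, groundField_le_entryField A hx⟩ hxF
  exact hσ σ h1 (h.conjugate_neg hA σ ⟨⟨x, groundField_le_entryField A hx⟩, hx, h2⟩)

variable (h : IsVArithmetic A) (hA : ∀ x, A *ᵥ x = 0 → x = 0)

include h in
theorem IsVArithmetic.symm : A.IsSymm := h.fundamental.1

include h in
theorem IsVArithmetic.diag (i : ι) : A i i = -2 := h.fundamental.2.1 i

include h in
theorem IsVArithmetic.conjugate_sq_lt (σ : entryField A →+* ℝ)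
    (hneg : ∀ x : ι → ℝ, x ≠ 0 → x ⬝ᵥ conjugate A σ *ᵥ x < 0) {i j : ι} (hij : i ≠ j) :
    σ (entry A i j) ^ 2 < 4 :=
  sq_lt_four_of_neg (isSymm_conjugate h.symm σ) (conjugate_diag h.diag σ)
    (P := fun _ => False) (fun x _ => hneg x) hij id id

include h in
theorem IsVArithmetic.conjugate_disc_neg (σ : entryField A →+* ℝ)
    (hneg : ∀ x : ι → ℝ, x ≠ 0 → x ⬝ᵥ conjugate A σ *ᵥ x < 0) {i j l : ι} (hij : i ≠ j)
    (hil : i ≠ l) (hjl : j ≠ l) :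
    disc (σ (entry A i j)) (σ (entry A i l)) (σ (entry A j l)) < 0 :=
  disc_neg_of_neg (isSymm_conjugate h.symm σ) (conjugate_diag h.diag σ)
    (P := fun _ => False) (fun x _ => hneg x) hij hil hjl id id id

include h hA in
-- A vanishing discriminant is a polynomial identity over `ℚ` between the entries and survives every
-- embedding, whereas negative definiteness needs a negative discriminant.
theorem IsVArithmetic.groundField_eq_bot_of_disc_eq_zero {i j l : ι} (hij : i ≠ j) (hil : i ≠ l)
    (hjl : j ≠ l) (hd : disc (A i j) (A i l) (A j l) = 0) : groundField A = ⊥ := by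
  rw [eq_bot_iff]
  refine h.groundField_le hA bot_le fun σ _ hneg => ?_
  have h1 := h.conjugate_disc_neg σ hneg hij hil hjl
  have h2 : entry A i j ^ 2 + entry A i l ^ 2 + entry A j l ^ 2 +
      entry A i j * entry A i l * entry A j l - 4 = 0 := Subtype.ext hd
  have h3 := congrArg σ h2
  simp only [map_sub, map_add, map_mul, map_pow, map_ofNat, map_zero] at h3
  rw [disc] at h1
  linarith

include h hA in
theorem IsVArithmetic.groundField_eq_bot_of_eq_two {i j : ι} (hij : i ≠ j) (hd : A i j = 2) :
    groundField A = ⊥ := by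
  rw [eq_bot_iff]
  refine h.groundField_le hA bot_le fun σ _ hneg => ?_
  have h1 := h.conjugate_sq_lt σ hneg hij
  have h2 : entry A i j = 2 := Subtype.ext hd
  rw [h2, map_ofNat] at h1
  norm_num at h1

include h hA in
-- An embedding that fixes `A i j ^ 2` keeps it above `4`, so its conjugate form is not negative
-- definite.
theorem IsVArithmetic.groundField_eq_of_two_lt {i j : ι} (hij : i ≠ j) (hd : 2 < A i j) :
    groundField A = IntermediateField.adjoin ℚ {A i j ^ 2} := by
  apply le_antisymm
  · have hmem : IntermediateField.adjoin ℚ {A i j ^ 2} ≤ entryField A := by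
      rw [IntermediateField.adjoin_le_iff]
      rintro x rfl
      exact pow_mem (entry_mem_entryField A i j) 2
    refine h.groundField_le hA hmem fun σ hσ hneg => ?_
    have h1 := h.conjugate_sq_lt σ hneg hij
    have h2 := hσ (entry A i j ^ 2) (IntermediateField.subset_adjoin _ _ (by simp [entry]))
    rw [map_pow] at h2
    rw [h2] at h1
    have h3 : A i j ^ 2 < 4 := h1
    nlinarith
  · rw [IntermediateField.adjoin_le_iff]
    rintro x rfl
    exact sq_mem_groundField h.symm i j

include h hA in
-- `disc` is a rational polynomial in the generators of `triField`, so an embedding that fixes this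
-- field preserves its positivity.
theorem IsVArithmetic.groundField_eq_triField {i j l : ι} (hij : i ≠ j) (hil : i ≠ l)
    (hjl : j ≠ l) {p q r : ℕ} (hp : A i j = wt p) (hq : A i l = wt q) (hr : A j l = wt r)
    (hd : 0 < disc (wt p) (wt q) (wt r)) : groundField A = triField p q r := by
  have hle : triField p q r ≤ groundField A := by
    rw [triField, IntermediateField.adjoin_le_iff, ← hp, ← hq, ← hr]
    rintro x (rfl | rfl | rfl | rfl)
    · exact sq_mem_groundField h.symm i j
    · exact sq_mem_groundField h.symm i l
    · exact sq_mem_groundField h.symm j l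
    · exact triple_mem_groundField h.symm i j l
  refine le_antisymm ?_ hle
  refine h.groundField_le hA (hle.trans (groundField_le_entryField A)) fun σ hσ hneg => ?_
  have h1 := h.conjugate_disc_neg σ hneg hij hil hjl
  have f1 := hσ (entry A i j ^ 2) (IntermediateField.subset_adjoin _ _ (by simp [entry, hp]))
  have f2 := hσ (entry A i l ^ 2) (IntermediateField.subset_adjoin _ _ (by simp [entry, hq]))
  have f3 := hσ (entry A j l ^ 2) (IntermediateField.subset_adjoin _ _ (by simp [entry, hr]))
  have f4 := hσ (entry A i j * entry A i l * entry A j l)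
    (IntermediateField.subset_adjoin _ _ (by simp [entry, hp, hq, hr]))
  simp only [map_pow, map_mul] at f1 f2 f3 f4
  rw [disc, f1, f2, f3, f4] at h1
  have h2 : disc (A i j) (A i l) (A j l) < 0 := h1
  rw [hp, hq, hr] at h2
  exact lt_asymm h2 hd

include h hA in
/-- Triangles in V-arithmetic matrices are arithmetic. -/
theorem IsVArithmetic.isArithTri {i j l : ι} (hij : i ≠ j) (hil : i ≠ l) (hjl : j ≠ l) {p q r : ℕ}
    (hp2 : 2 ≤ p) (hq2 : 2 ≤ q) (hr2 : 2 ≤ r) (hp : A i j = wt p) (hq : A i l = wt q)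
    (hr : A j l = wt r) : IsArithTri p q r := by
  intro k hk
  have := h.numberField
  have := h.totallyReal
  obtain ⟨σ, hσ⟩ := exists_real_embedding_mul (entryField A) (by positivity) hk
  have e1 : σ (entry A i j) = cwt k p :=
    hσ p (mul_dvd_mul_left 2 ⟨q * r, by ring⟩) (entry A i j) hp
  have e2 : σ (entry A i l) = cwt k q :=
    hσ q (mul_dvd_mul_left 2 ⟨p * r, by ring⟩) (entry A i l) hq
  have e3 : σ (entry A j l) = cwt k r :=
    hσ r (mul_dvd_mul_left 2 ⟨p * q, by ring⟩) (entry A j l) hr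
  -- Either `σ` moves the ground field and the conjugate triangle is spherical, or `σ` fixes all
  -- cyclic products of the triangle.
  by_cases hmove : ∃ x : entryField A, (x : ℝ) ∈ groundField A ∧ σ x ≠ (x : ℝ)
  · right
    have := h.conjugate_disc_neg σ (h.conjugate_neg hA σ hmove) hij hil hjl
    rwa [e1, e2, e3] at this
  · left
    push Not at hmove
    have f1 := hmove (entry A i j ^ 2) (sq_mem_groundField h.symm i j)
    have f2 := hmove (entry A i l ^ 2) (sq_mem_groundField h.symm i l)
    have f3 := hmove (entry A j l ^ 2) (sq_mem_groundField h.symm j l)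
    have f4 := hmove (entry A i j * entry A i l * entry A j l)
      (triple_mem_groundField h.symm i j l)
    simp only [map_pow, map_mul, e1, e2, e3] at f1 f2 f3 f4
    rw [fixesTri_iff hp2 hq2 hr2]
    refine ⟨f1.trans ?_, f2.trans ?_, f3.trans ?_, f4.trans ?_⟩
    all_goals simp [entry, hp, hq, hr]

end Ground

/-! ### Edge matrices without broken edges -/

section Edge

theorem one_le_wt_sq {p : ℕ} (hp : 3 ≤ p) : 1 ≤ wt p ^ 2 := by
  have hp' : (3 : ℝ) ≤ p := by exact_mod_cast hp
  have h1 : π / p ≤ π / 3 := by gcongr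
  have h2 : cos (π / 3) ≤ cos (π / p) :=
    cos_le_cos_of_nonneg_of_le_pi (by positivity) (by linarith [pi_pos]) h1
  rw [cos_pi_div_three] at h2
  have h3 : 1 ≤ wt p := by rw [wt]; linarith
  nlinarith

theorem le_five_of_wt_sq_lt {p : ℕ} (h : wt p ^ 2 < 3) : p ≤ 5 := by
  by_contra! hp
  have hp' : (6 : ℝ) ≤ p := by exact_mod_cast hp
  have h1 : π / p ≤ π / 6 := by gcongr
  have h2 : cos (π / 6) ≤ cos (π / p) :=
    cos_le_cos_of_nonneg_of_le_pi (by positivity) (by linarith [pi_pos]) h1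
  rw [cos_pi_div_six] at h2
  have h3 : √3 ≤ wt p := by rw [wt]; linarith
  have h4 := sq_sqrt (show (0 : ℝ) ≤ 3 by norm_num)
  have h5 := sqrt_nonneg 3
  nlinarith

/-- The labels at a vertex of a spherical triangle that is joined to the other two. -/
theorem le_five_of_disc_neg {p q : ℕ} {c : ℝ} (hp : 3 ≤ p) (hq : 3 ≤ q) (hc : 0 ≤ c)
    (h : disc (wt p) (wt q) c < 0) : p ≤ 5 ∧ q ≤ 5 := by
  have h1 := one_le_wt_sq hp
  have h2 := one_le_wt_sq hq
  have h3 : 0 ≤ wt p * wt q * c :=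
    mul_nonneg (mul_nonneg (wt_pos hp).le (wt_pos hq).le) hc
  rw [disc] at h
  -- Each label from `3` on contributes at least `1` to a sum that is less than `4`, so the other
  -- square is less than `3 = wt 6 ^ 2`.
  constructor <;> apply le_five_of_wt_sq_lt <;> nlinarith [sq_nonneg c]

theorem disc_comm (a b c : ℝ) : disc a b c = disc b a c := by simp only [disc]; ring

theorem disc_rotate (a b c : ℝ) : disc a b c = disc b c a := by simp only [disc]; ring

variable {ι : Type} [Fintype ι] {A : Matrix ι ι ℝ}

/-- The Gram matrix of an edge chamber: it is nondegenerate, and the forms obtained by omitting one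
of the two distinguished indices are negative definite. -/
structure IsEdgeMatrix (A : Matrix ι ι ℝ) (e₁ e₂ : ι) : Prop where
  ne : e₁ ≠ e₂
  neg_left : ∀ x : ι → ℝ, x e₁ = 0 → x ≠ 0 → x ⬝ᵥ A *ᵥ x < 0
  neg_right : ∀ x : ι → ℝ, x e₂ = 0 → x ≠ 0 → x ⬝ᵥ A *ᵥ x < 0
  nondeg : ∀ x, A *ᵥ x = 0 → x = 0

theorem IsEdgeMatrix.swap {e₁ e₂ : ι} (h : IsEdgeMatrix A e₁ e₂) : IsEdgeMatrix A e₂ e₁ :=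
  ⟨h.ne.symm, h.neg_right, h.neg_left, h.nondeg⟩

variable {e₁ e₂ : ι} (hE : IsEdgeMatrix A e₁ e₂) (h : IsVArithmetic A)

include hE h in
theorem IsEdgeMatrix.disc_neg_of_ne {i j l : ι} (hij : i ≠ j) (hil : i ≠ l) (hjl : j ≠ l)
    (hi : i ≠ e₁) (hj : j ≠ e₁) (hl : l ≠ e₁) : disc (A i j) (A i l) (A j l) < 0 :=
  disc_neg_of_neg h.symm h.diag (P := fun i => i = e₁) (fun x hx => hE.neg_left x (hx e₁ rfl))
    hij hil hjl hi hj hl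

include h in
theorem IsVArithmetic.nonneg {i j : ι} (hij : i ≠ j) : 0 ≤ A i j := (h.fundamental.2.2 i j hij).1

include h in
theorem IsVArithmetic.exists_wt {i j : ι} (hij : i ≠ j) (h2 : A i j < 2) :
    ∃ m : ℕ, 2 ≤ m ∧ A i j = wt m :=
  (h.fundamental.2.2 i j hij).2 h2

include hE h in
theorem IsEdgeMatrix.exists_wt {i j : ι} (hij : i ≠ j) (hi : i ≠ e₁) (hj : j ≠ e₁) :
    ∃ m : ℕ, 2 ≤ m ∧ A i j = wt m := by
  refine h.exists_wt hij ?_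
  have := sq_lt_four_of_neg h.symm h.diag (P := fun i => i = e₁)
    (fun x hx => hE.neg_left x (hx e₁ rfl)) hij hi hj
  have := h.nonneg hij
  nlinarith

include hE h in
-- A hyperbolic right triangle inside the graph determines the ground field; it is among the
-- arithmetic right triangles handled by `IsArithTri.right`.
theorem IsEdgeMatrix.mem_fieldsT_of_right {i j l : ι} (hij : i ≠ j) (hil : i ≠ l) (hjl : j ≠ l)
    {q r : ℕ} (hq2 : 2 ≤ q) (hr2 : 2 ≤ r) (hp : A i j = 0) (hq : A i l = wt q)
    (hr : A j l = wt r) (hd : 0 < disc 0 (wt q) (wt r)) : groundField A ∈ fieldsT := by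
  wlog hqr : q ≤ r generalizing i j q r
  · exact this hij.symm hjl hil hr2 hq2 (by rw [h.symm.apply, hp]) hr hq
      (by rw [disc] at hd ⊢; linarith) (by lia)
  rw [← wt_two] at hp
  replace hd : 0 < disc (wt 2) (wt q) (wt r) := by rwa [wt_two]
  have hq3 : 3 ≤ q := by
    by_contra! hq3
    obtain rfl : q = 2 := by lia
    have := lt_of_disc_pos le_rfl le_rfl hr2 hd
    lia
  rw [h.groundField_eq_triField hE.nondeg hij hil hjl hp hq hr hd]
  exact ((h.isArithTri hE.nondeg hij hil hjl le_rfl hq2 hr2 hp hq hr).right hq3 hqr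
    hd).mem_fieldsT le_rfl hq2 hr2

include hE h in
theorem IsEdgeMatrix.mem_fieldsT_of_small {i j l : ι} (hij : i ≠ j) (hil : i ≠ l) (hjl : j ≠ l)
    {a b m : ℕ} (ha : 3 ≤ a) (ha5 : a ≤ 5) (hb : 3 ≤ b) (hb5 : b ≤ 5) (hm : 3 ≤ m)
    (hp : A i j = wt a) (hq : A i l = wt b) (hr : A j l = wt m)
    (hd : 0 < disc (wt a) (wt b) (wt m)) : groundField A ∈ fieldsT := by
  wlog hab : a ≤ b generalizing j l a b
  · exact this hil hij hjl.symm hb hb5 ha ha5 hq hp (by rw [h.symm.apply, hr])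
      (by rw [disc_comm]; exact hd) (by lia)
  rw [h.groundField_eq_triField hE.nondeg hij hil hjl hp hq hr hd]
  exact ((h.isArithTri hE.nondeg hij hil hjl (by lia) (by lia) (by lia) hp hq hr).small ha hab hb5
    hm hd).mem_fieldsT (by lia) (by lia) (by lia)

include hE h in
/-- A hyperbolic triangle with a further vertex joined to an end of the edge. -/
theorem IsEdgeMatrix.mem_fieldsT_of_adj_left {f g : ι} {p q r : ℕ} (hf1 : f ≠ e₁) (hf2 : f ≠ e₂)
    (hg1 : g ≠ e₁) (hg2 : g ≠ e₂) (hgf : g ≠ f) (hp3 : 3 ≤ p) (hq3 : 3 ≤ q) (hr3 : 3 ≤ r)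
    (hp : A e₁ e₂ = wt p) (hq : A e₁ f = wt q) (hr : A e₂ f = wt r)
    (hd : 0 < disc (wt p) (wt q) (wt r)) (hg : A e₁ g ≠ 0) : groundField A ∈ fieldsT := by
  obtain ⟨c, hc2, hc⟩ := hE.swap.exists_wt h hg1.symm hE.ne hg2
  obtain ⟨d, hd2, hdd⟩ := hE.exists_wt h hg2.symm hE.ne.symm hg1
  have hc3 : 3 ≤ c := by
    by_contra!
    obtain rfl : c = 2 := by lia
    exact hg (by rw [hc, wt_two])
  -- The triangle `e₁, f, g` avoids `e₂` and is spherical, with both `f` and `g` joined to `e₁`: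
  -- this bounds their labels by `5`.
  have h1 := hE.swap.disc_neg_of_ne h hf1.symm hg1.symm hgf.symm hE.ne hf2 hg2
  rw [hq, hc] at h1
  obtain ⟨hq5, hc5⟩ := le_five_of_disc_neg hq3 hc3 (h.nonneg hgf.symm) h1
  by_cases hd3 : 3 ≤ d
  · have h2 := hE.disc_neg_of_ne h hf2.symm hg2.symm hgf.symm hE.ne.symm hf1 hg1
    rw [hr, hdd] at h2
    obtain ⟨hr5, -⟩ := le_five_of_disc_neg hr3 hd3 (h.nonneg hgf.symm) h2
    refine hE.mem_fieldsT_of_small h (i := f) (j := e₁) (l := e₂) hf1 hf2 hE.ne hq3 hq5 hr3 hr5 hp3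
      (by rw [h.symm.apply, hq]) (by rw [h.symm.apply, hr]) hp ?_
    rwa [disc_rotate] at hd
  · obtain rfl : d = 2 := by lia
    rw [wt_two] at hdd
    -- Now `e₁, e₂, g` has a right angle at the pair `e₂, g`. If it is spherical, `p` is also small;
    -- if it is hyperbolic, it replaces the original triangle.
    rcases lt_trichotomy (disc (wt p) (wt c) 0) 0 with hlt | heq | hgt
    · obtain ⟨hp5, -⟩ := le_five_of_disc_neg hp3 hc3 le_rfl hlt
      exact hE.mem_fieldsT_of_small h hE.ne hf1.symm hf2.symm hp3 hp5 hq3 hq5 hr3 hp hq hr hd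
    · rw [h.groundField_eq_bot_of_disc_eq_zero hE.nondeg hE.ne hg1.symm hg2.symm
        (by rw [hp, hc, hdd, heq])]
      exact bot_mem_fieldsT
    · refine hE.mem_fieldsT_of_right h (i := e₂) (j := g) (l := e₁) hg2.symm hE.ne.symm hg1
        (q := p) (r := c) (by lia) hc2 hdd (by rw [h.symm.apply, hp]) (by rw [h.symm.apply, hc]) ?_
      rw [disc] at hgt ⊢
      linarith

include hE h in
/-- A hyperbolic triangle without broken edges, with a further vertex joined to it. -/
theorem IsEdgeMatrix.mem_fieldsT_of_triangle {f g : ι} (hf1 : f ≠ e₁) (hf2 : f ≠ e₂)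
    (hg1 : g ≠ e₁) (hg2 : g ≠ e₂) (hgf : g ≠ f) (hu : A e₁ e₂ < 2)
    (hd : 0 ≤ disc (A e₁ e₂) (A e₁ f) (A e₂ f))
    (hg : A e₁ g ≠ 0 ∨ A e₂ g ≠ 0 ∨ A f g ≠ 0) : groundField A ∈ fieldsT := by
  rcases hd.eq_or_lt with hd | hd
  · rw [h.groundField_eq_bot_of_disc_eq_zero hE.nondeg hE.ne hf1.symm hf2.symm hd.symm]
    exact bot_mem_fieldsT
  obtain ⟨p, hp2, hp⟩ := h.exists_wt hE.ne hu
  obtain ⟨q, hq2, hq⟩ := hE.swap.exists_wt h hf1.symm hE.ne hf2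
  obtain ⟨r, hr2, hr⟩ := hE.exists_wt h hf2.symm hE.ne.symm hf1
  rw [hp, hq, hr] at hd
  rcases hp2.eq_or_lt with rfl | hp3
  · rw [wt_two] at hp hd
    exact hE.mem_fieldsT_of_right h hE.ne hf1.symm hf2.symm hq2 hr2 hp hq hr hd
  rcases hq2.eq_or_lt with rfl | hq3
  · rw [wt_two] at hq hd
    exact hE.mem_fieldsT_of_right h hf1.symm hE.ne hf2 hp2 hr2 hq hp
      (by rw [h.symm.apply, hr]) (by rw [disc_comm]; exact hd)
  rcases hr2.eq_or_lt with rfl | hr3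
  · rw [wt_two] at hr hd
    exact hE.mem_fieldsT_of_right h hf2.symm hE.ne.symm hf1 hp2 hq2 hr
      (by rw [h.symm.apply, hp]) (by rw [h.symm.apply, hq])
      (by rw [disc_rotate]; exact hd)
  rcases hg with hg | hg | hg
  · exact hE.mem_fieldsT_of_adj_left h hf1 hf2 hg1 hg2 hgf hp3 hq3 hr3 hp hq hr hd hg
  · exact hE.swap.mem_fieldsT_of_adj_left h hf2 hf1 hg2 hg1 hgf hp3 hr3 hq3
      (by rw [h.symm.apply, hp]) hr hq (by rw [disc] at hd ⊢; linarith) hg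
  · obtain ⟨c, hc2, hc⟩ := hE.exists_wt h hgf.symm hf1 hg1
    have hc3 : 3 ≤ c := by
      by_contra!
      obtain rfl : c = 2 := by lia
      exact hg (by rw [hc, wt_two])
    have h1 := hE.swap.disc_neg_of_ne h hf1 hgf.symm hg1.symm hf2 hE.ne hg2
    have h2 := hE.disc_neg_of_ne h hf2 hgf.symm hg2.symm hf1 hE.ne.symm hg1
    rw [h.symm.apply, hq, hc] at h1
    rw [h.symm.apply, hr, hc] at h2
    obtain ⟨hq5, -⟩ := le_five_of_disc_neg hq3 hc3 (h.nonneg hg1.symm) h1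
    obtain ⟨hr5, -⟩ := le_five_of_disc_neg hr3 hc3 (h.nonneg hg2.symm) h2
    refine hE.mem_fieldsT_of_small h (i := f) (j := e₁) (l := e₂) hf1 hf2 hE.ne hq3 hq5 hr3 hr5 hp3
      (by rw [h.symm.apply, hq]) (by rw [h.symm.apply, hr]) hp ?_
    rwa [disc_rotate] at hd

end Edge

end VArith

namespace VArith

open Real Matrix

/-! ### Small fields -/

theorem finrank_adjoin_sqrt_le (a : ℕ) :
    Module.finrank ℚ (IntermediateField.adjoin ℚ {√(a : ℝ)}) ≤ 2 := by
  have hroot : Polynomial.aeval (√(a : ℝ)) (Polynomial.X ^ 2 - Polynomial.C (a : ℚ)) = 0 := by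
    simp
  have hmon : (Polynomial.X ^ 2 - Polynomial.C (a : ℚ)).Monic :=
    Polynomial.monic_X_pow_sub_C _ (by norm_num)
  have hint : IsIntegral ℚ √(a : ℝ) := ⟨_, hmon, hroot⟩
  rw [IntermediateField.adjoin.finrank hint]
  refine (Polynomial.natDegree_le_of_dvd (minpoly.dvd ℚ _ hroot) hmon.ne_zero).trans ?_
  rw [Polynomial.natDegree_X_pow_sub_C]

instance finiteDimensional_adjoin_sqrt (a : ℕ) :
    FiniteDimensional ℚ (IntermediateField.adjoin ℚ {√(a : ℝ)}) := by
  apply IntermediateField.adjoin.finiteDimensional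
  exact ⟨_, Polynomial.monic_X_pow_sub_C (a : ℚ) (n := 2) (by norm_num), by simp⟩

theorem adjoin_sqrt_pair (a b : ℕ) : IntermediateField.adjoin ℚ {√(a : ℝ), √(b : ℝ)} =
    IntermediateField.adjoin ℚ {√(a : ℝ)} ⊔ IntermediateField.adjoin ℚ {√(b : ℝ)} := by
  rw [← IntermediateField.adjoin_union]; rfl

instance finiteDimensional_adjoin_sqrt_pair (a b : ℕ) :
    FiniteDimensional ℚ (IntermediateField.adjoin ℚ {√(a : ℝ), √(b : ℝ)}) := by
  rw [adjoin_sqrt_pair]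
  exact IntermediateField.finiteDimensional_sup _ _

theorem finrank_adjoin_sqrt_pair_le (a b : ℕ) :
    Module.finrank ℚ (IntermediateField.adjoin ℚ {√(a : ℝ), √(b : ℝ)}) ≤ 4 := by
  rw [adjoin_sqrt_pair]
  exact (IntermediateField.finrank_sup_le _ _).trans
    (Nat.mul_le_mul (finrank_adjoin_sqrt_le a) (finrank_adjoin_sqrt_le b))

theorem eq_bot_or_eq_adjoin_sqrt {K : IntermediateField ℚ ℝ} {a : ℕ}
    (h : K ≤ IntermediateField.adjoin ℚ {√(a : ℝ)}) :
    K = ⊥ ∨ K = IntermediateField.adjoin ℚ {√(a : ℝ)} := by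
  have : FiniteDimensional ℚ K :=
    FiniteDimensional.of_injective (IntermediateField.inclusion h).toLinearMap
      (IntermediateField.inclusion h).injective
  by_cases h1 : Module.finrank ℚ K = 1
  · exact Or.inl (IntermediateField.finrank_eq_one_iff.1 h1)
  · right
    apply IntermediateField.eq_of_le_of_finrank_le h
    have := finrank_adjoin_sqrt_le a
    have : 0 < Module.finrank ℚ K := Module.finrank_pos
    lia

theorem finrank_adjoin_sqrt_five :
    Module.finrank ℚ (IntermediateField.adjoin ℚ {√(5 : ℝ)}) = 2 := by
  have h1 : Module.finrank ℚ (IntermediateField.adjoin ℚ {√(5 : ℝ)}) ≤ 2 := by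
    exact_mod_cast finrank_adjoin_sqrt_le 5
  have hfd : FiniteDimensional ℚ (IntermediateField.adjoin ℚ {√(5 : ℝ)}) := by
    exact_mod_cast finiteDimensional_adjoin_sqrt 5
  have h2 : 0 < Module.finrank ℚ (IntermediateField.adjoin ℚ {√(5 : ℝ)}) := Module.finrank_pos
  have h3 : Module.finrank ℚ (IntermediateField.adjoin ℚ {√(5 : ℝ)}) ≠ 1 := by
    intro h
    rw [IntermediateField.finrank_eq_one_iff, IntermediateField.adjoin_simple_eq_bot_iff,
      IntermediateField.mem_bot] at h
    obtain ⟨q, hq⟩ := h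
    have := Nat.Prime.irrational_sqrt (show Nat.Prime 5 by norm_num)
    exact this ⟨q, by exact_mod_cast hq⟩
  lia

/-- The degree of `K` is a multiple of `2` and at most `4`, so `K` coincides with one of the two
ends. -/
theorem eq_adjoin_of_sqrt_five_le {K : IntermediateField ℚ ℝ}
    (h5 : IntermediateField.adjoin ℚ {√(5 : ℝ)} ≤ K)
    (h : K ≤ IntermediateField.adjoin ℚ {√(2 : ℝ), √(5 : ℝ)}) :
    K = IntermediateField.adjoin ℚ {√(5 : ℝ)} ∨
      K = IntermediateField.adjoin ℚ {√(2 : ℝ), √(5 : ℝ)} := by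
  have hfd : FiniteDimensional ℚ (IntermediateField.adjoin ℚ {√(2 : ℝ), √(5 : ℝ)}) := by
    exact_mod_cast finiteDimensional_adjoin_sqrt_pair 2 5
  have h4 : Module.finrank ℚ (IntermediateField.adjoin ℚ {√(2 : ℝ), √(5 : ℝ)}) ≤ 4 := by
    exact_mod_cast finrank_adjoin_sqrt_pair_le 2 5
  have : FiniteDimensional ℚ K :=
    FiniteDimensional.of_injective (IntermediateField.inclusion h).toLinearMap
      (IntermediateField.inclusion h).injective
  by_cases h2 : Module.finrank ℚ K ≤ 2
  · left
    symm
    apply IntermediateField.eq_of_le_of_finrank_le h5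
    rwa [finrank_adjoin_sqrt_five]
  · right
    apply IntermediateField.eq_of_le_of_finrank_le h
    have := IntermediateField.finrank_dvd_of_le_right h5
    rw [finrank_adjoin_sqrt_five] at this
    lia

/-! ### Components of Gram graphs -/

section Component

variable {ι : Type} [Fintype ι] {A : Matrix ι ι ℝ}

omit [Fintype ι] in
theorem gramGraph_adj (hA : A.IsSymm) {i j : ι} : (gramGraph A).Adj i j ↔ i ≠ j ∧ A i j ≠ 0 := by
  rw [gramGraph, SimpleGraph.fromRel_adj, hA.apply i j, or_self]

/-- A component with more elements than `S` has an edge that leaves `S`. -/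
theorem exists_adj_of_ncard_lt {V : Type} [Finite V] {G : SimpleGraph V} (C : G.ConnectedComponent)
    (S : Set V) (hS : S.ncard < C.supp.ncard) {v : V} (hv : v ∈ C.supp) (hvS : v ∈ S) :
    ∃ a ∈ S, ∃ b ∉ S, a ∈ C.supp ∧ b ∈ C.supp ∧ G.Adj a b := by
  by_contra! hcon
  refine absurd (Set.ncard_le_ncard (s := C.supp) (t := S) ?_ S.toFinite) (not_le.2 hS)
  intro w hw
  have hr : G.Reachable v w := by
    rw [SimpleGraph.ConnectedComponent.mem_supp_iff] at hv hw
    exact SimpleGraph.ConnectedComponent.exact (hv.trans hw.symm)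
  obtain ⟨p⟩ := hr
  clear hS
  induction p with
  | nil => exact hvS
  | cons hadj p ih =>
    have h2 := (C.mem_supp_congr_adj hadj).1 hv
    refine ih h2 ?_ hw
    by_contra hb
    exact hcon _ hvS _ hb hv h2 hadj

variable {C : (gramGraph A).ConnectedComponent}

theorem exists_pos_of_isHyperbolicComponent (hC : IsHyperbolicComponent A C) :
    ∃ x : ι → ℝ, (∀ i, i ∉ C.supp → x i = 0) ∧ 0 < x ⬝ᵥ A *ᵥ x := by
  classical
  obtain ⟨w, hw⟩ := exists_pos_of_isHyperbolic hC
  obtain ⟨x, h1, h2, h3⟩ := exists_extend A (f := fun i : C.supp => (i : ι))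
    Subtype.val_injective w
  refine ⟨x, fun i hi => h2 i ?_, by rwa [h3]⟩
  rintro ⟨k, rfl⟩
  exact hi k.2

/-- Without `e₁` the form is negative definite, so the vector of positive square carried by the
component must involve `e₁`. -/
theorem IsEdgeMatrix.left_mem {e₁ e₂ : ι} (hE : IsEdgeMatrix A e₁ e₂)
    (hC : IsHyperbolicComponent A C) : e₁ ∈ C.supp := by
  by_contra hcon
  obtain ⟨x, h1, h2⟩ := exists_pos_of_isHyperbolicComponent hC
  have hx : x ≠ 0 := by rintro rfl; simp at h2
  exact lt_asymm h2 (hE.neg_left x (h1 e₁ hcon) hx)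

/-- If all entries between elements of a hyperbolic component lie in a field, so does the ground
field. -/
theorem IsVArithmetic.groundField_le_of_component (h : IsVArithmetic A)
    (hA : ∀ x, A *ᵥ x = 0 → x = 0) (hC : IsHyperbolicComponent A C) {F : IntermediateField ℚ ℝ}
    (hF : ∀ i ∈ C.supp, ∀ j ∈ C.supp, A i j ∈ F) : groundField A ≤ F := by
  set F' := IntermediateField.adjoin ℚ {x | ∃ i ∈ C.supp, ∃ j ∈ C.supp, x = A i j}
  have hF' : F' ≤ F := by
    rw [IntermediateField.adjoin_le_iff]
    rintro x ⟨i, hi, j, hj, rfl⟩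
    exact hF i hi j hj
  have hE : F' ≤ entryField A := by
    rw [IntermediateField.adjoin_le_iff]
    rintro x ⟨i, -, j, -, rfl⟩
    exact entry_mem_entryField A i j
  refine (h.groundField_le hA hE fun σ hσ hneg => ?_).trans hF'
  obtain ⟨x, h1, h2⟩ := exists_pos_of_isHyperbolicComponent hC
  have hx : x ≠ 0 := by rintro rfl; simp at h2
  -- A vector of positive square supported on the component has the same square for the conjugate
  -- form, since `σ` fixes all entries that enter.
  refine lt_asymm h2 (lt_of_eq_of_lt ?_ (hneg x hx))
  rw [quad_eq_sum, quad_eq_sum]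
  refine Finset.sum_congr rfl fun i _ => ?_
  by_cases hi : i ∈ C.supp
  · congr 1
    refine Finset.sum_congr rfl fun j _ => ?_
    by_cases hj : j ∈ C.supp
    · congr 1
      exact (hσ (entry A i j) (IntermediateField.subset_adjoin _ _ ⟨i, hi, j, hj, rfl⟩)).symm
    · rw [h1 j hj]; simp
  · rw [h1 i hi]; simp

/-- The ground field of an edge matrix without broken edges, with a large hyperbolic component. -/
theorem IsEdgeMatrix.mem_fieldsT {e₁ e₂ : ι} (hE : IsEdgeMatrix A e₁ e₂) (h : IsVArithmetic A)
    (hu : A e₁ e₂ ≤ 2) (hC : IsHyperbolicComponent A C) (hcard : 4 ≤ C.supp.ncard) :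
    groundField A ∈ fieldsT := by
  rcases hu.eq_or_lt with hu | hu
  · rw [h.groundField_eq_bot_of_eq_two hE.nondeg hE.ne hu]
    exact bot_mem_fieldsT
  have he₁ := hE.left_mem hC
  have he₂ := hE.swap.left_mem hC
  by_cases hf : ∃ f ∈ C.supp, f ≠ e₁ ∧ f ≠ e₂ ∧ 0 ≤ disc (A e₁ e₂) (A e₁ f) (A e₂ f)
  · obtain ⟨f, hfC, hf1, hf2, hd⟩ := hf
    have hS : ({e₁, e₂, f} : Set ι).ncard < C.supp.ncard := by
      refine lt_of_le_of_lt ((Set.ncard_insert_le _ _).trans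
        (Nat.succ_le_succ (Set.ncard_insert_le _ _))) ?_
      rw [Set.ncard_singleton]; lia
    obtain ⟨a, ha, g, hg, -, -, hadj⟩ := exists_adj_of_ncard_lt C {e₁, e₂, f} hS he₁ (by simp)
    rw [gramGraph_adj h.symm] at hadj
    simp only [Set.mem_insert_iff, Set.mem_singleton_iff, not_or] at ha hg
    refine hE.mem_fieldsT_of_triangle h hf1 hf2 hg.1 hg.2.1 hg.2.2 hu hd ?_
    rcases ha with rfl | rfl | rfl
    · exact Or.inl hadj.2
    · exact Or.inr (Or.inl hadj.2)
    · exact Or.inr (Or.inr hadj.2)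
  -- All triples are spherical from here on: those that avoid `e₁` or `e₂` always are, and the
  -- remaining ones contain both.
  push Not at hf
  have htriple : ∀ i ∈ C.supp, ∀ j ∈ C.supp, ∀ l ∈ C.supp, i ≠ j → i ≠ l → j ≠ l →
      disc (A i j) (A i l) (A j l) < 0 := by
    intro i hi j hj l hl hij hil hjl
    by_cases h1 : i ≠ e₁ ∧ j ≠ e₁ ∧ l ≠ e₁
    · exact hE.disc_neg_of_ne h hij hil hjl h1.1 h1.2.1 h1.2.2
    by_cases h2 : i ≠ e₂ ∧ j ≠ e₂ ∧ l ≠ e₂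
    · exact hE.swap.disc_neg_of_ne h hij hil hjl h2.1 h2.2.1 h2.2.2
    have s := h.symm.apply
    have hff : ∀ f ∈ C.supp, f ≠ e₁ → f ≠ e₂ → disc (A e₁ e₂) (A e₁ f) (A e₂ f) < 0 :=
      fun f hf' h1 h2 => hf f hf' h1 h2
    have hne := hE.ne
    simp only [disc] at hff ⊢
    rcases eq_or_ne i e₁ with rfl | i1
    · rcases eq_or_ne j e₂ with rfl | j2
      · exact hff l hl hil.symm hjl.symm
      · obtain rfl : l = e₂ := by by_contra hl2; exact h2 ⟨hne, j2, hl2⟩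
        have := hff j hj hij.symm hjl
        simp only [s j l] at this; linarith
    · rcases eq_or_ne j e₁ with rfl | j1
      · rcases eq_or_ne i e₂ with rfl | i2
        · have := hff l hl hjl.symm hil.symm
          simp only [s i j] at this; linarith
        · obtain rfl : l = e₂ := by by_contra hl2; exact h2 ⟨i2, hne, hl2⟩
          have := hff i hi hij hil
          simp only [s i j, s i l] at this; linarith
      · obtain rfl : l = e₁ := by by_contra hl1; exact h1 ⟨i1, j1, hl1⟩
        rcases eq_or_ne i e₂ with rfl | i2
        · have := hff j hj hjl hij.symm
          simp only [s i l, s j l] at this; linarith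
        · obtain rfl : j = e₂ := by by_contra hj2; exact h2 ⟨i2, hj2, hne⟩
          have := hff i hi hil hij
          simp only [s i j, s i l, s j l] at this; linarith
  have hlabel : ∀ i ∈ C.supp, ∀ j ∈ C.supp, i ≠ j → ∃ m : ℕ, 2 ≤ m ∧ m ≤ 5 ∧ A i j = wt m := by
    intro i hi j hj hij
    have hlt : A i j < 2 := by
      by_cases h1 : i ≠ e₁ ∧ j ≠ e₁
      · obtain ⟨m, hm, hm'⟩ := hE.exists_wt h hij h1.1 h1.2
        rw [hm']; exact wt_lt_two hm
      by_cases h2 : i ≠ e₂ ∧ j ≠ e₂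
      · obtain ⟨m, hm, hm'⟩ := hE.swap.exists_wt h hij h2.1 h2.2
        rw [hm']; exact wt_lt_two hm
      have hne := hE.ne
      rcases eq_or_ne i e₁ with rfl | i1
      · obtain rfl : j = e₂ := by by_contra hj2; exact h2 ⟨hne, hj2⟩
        exact hu
      · obtain rfl : j = e₁ := by by_contra hj1; exact h1 ⟨i1, hj1⟩
        obtain rfl : i = e₂ := by by_contra hi2; exact h2 ⟨hi2, hne⟩
        rwa [h.symm.apply]
    obtain ⟨m, hm2, hm⟩ := h.exists_wt hij hlt
    refine ⟨m, hm2, ?_, hm⟩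
    by_cases hm3 : m < 3
    · lia
    push Not at hm3
    -- A joined pair has a third vertex of the component adjacent to it; the resulting spherical
    -- triple bounds the label by `5`.
    have hS : ({i, j} : Set ι).ncard < C.supp.ncard := by
      rw [Set.ncard_pair hij]; lia
    obtain ⟨a, ha, l, hl, -, hlC, hadj⟩ := exists_adj_of_ncard_lt C {i, j} hS hi (by simp)
    rw [gramGraph_adj h.symm] at hadj
    simp only [Set.mem_insert_iff, Set.mem_singleton_iff, not_or] at ha hl
    have key : ∀ a ∈ C.supp, ∀ b ∈ C.supp, a ≠ b → l ≠ a → l ≠ b → A a l ≠ 0 → A a b = wt m →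
        m ≤ 5 := by
      intro a ha b hb hab hla hlb hal habm
      have hd := htriple a ha b hb l hlC hab hla.symm hlb.symm
      have h1 := h.nonneg hlb.symm
      have h2 := h.nonneg hab
      have h3 := h.nonneg hla.symm
      have hlt2 : A a l < 2 := by
        rw [disc] at hd
        nlinarith [mul_nonneg (mul_nonneg h2 h3) h1, sq_nonneg (A a b), sq_nonneg (A b l)]
      obtain ⟨c, hc2, hc⟩ := h.exists_wt hla.symm hlt2
      have hc3 : 3 ≤ c := by
        by_contra!
        obtain rfl : c = 2 := by lia
        exact hal (by rw [hc, wt_two])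
      rw [habm, hc] at hd
      exact (le_five_of_disc_neg hm3 hc3 h1 hd).1
    rcases ha with rfl | rfl
    · exact key a hi j hj hij hl.1 hl.2 hadj.2 hm
    · exact key a hj i hi hij.symm hl.2 hl.1 hadj.2 (by rw [h.symm.apply, hm])
  by_cases h5 : ∃ i ∈ C.supp, ∃ j ∈ C.supp, i ≠ j ∧ A i j = wt 5
  · obtain ⟨i, -, j, -, -, hij5⟩ := h5
    have hle : IntermediateField.adjoin ℚ {√(5 : ℝ)} ≤ groundField A := by
      rw [IntermediateField.adjoin_le_iff]
      rintro x rfl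
      have h1 := sq_mem_groundField h.symm i j
      rw [hij5, wt_five_sq] at h1
      have := sub_mem (mul_mem h1 (ofNat_mem _ 2)) (ofNat_mem (groundField A) 3)
      have e : (3 + √5) / 2 * 2 - 3 = √5 := by ring
      rwa [e] at this
    have hle2 : groundField A ≤ IntermediateField.adjoin ℚ {√(2 : ℝ), √(5 : ℝ)} := by
      refine h.groundField_le_of_component hE.nondeg hC fun i hi j hj => ?_
      rcases eq_or_ne i j with rfl | hij
      · rw [h.diag]; exact neg_mem (ofNat_mem _ 2)
      obtain ⟨m, hm2, hm5, hm⟩ := hlabel i hi j hj hij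
      rw [hm]
      interval_cases m
      · rw [wt_two]; exact zero_mem _
      · rw [wt_three]; exact one_mem _
      · rw [wt_four]; exact IntermediateField.subset_adjoin _ _ (by simp)
      · rw [wt_five]
        exact div_mem (add_mem (one_mem _) (IntermediateField.subset_adjoin _ _ (by simp)))
          (ofNat_mem _ 2)
    rcases eq_adjoin_of_sqrt_five_le hle hle2 with hK | hK
    · rw [hK]; exact sqrt_five_mem_fieldsT
    · rw [hK]; exact sqrt_two_five_mem_fieldsT
  · push Not at h5
    have hle2 : groundField A ≤ IntermediateField.adjoin ℚ {√((2 : ℕ) : ℝ)} := by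
      refine h.groundField_le_of_component hE.nondeg hC fun i hi j hj => ?_
      rcases eq_or_ne i j with rfl | hij
      · rw [h.diag]; exact neg_mem (ofNat_mem _ 2)
      obtain ⟨m, hm2, hm5, hm⟩ := hlabel i hi j hj hij
      have := h5 i hi j hj hij
      rw [hm] at this ⊢
      interval_cases m
      · rw [wt_two]; exact zero_mem _
      · rw [wt_three]; exact one_mem _
      · rw [wt_four]; exact IntermediateField.subset_adjoin _ _ (by simp)
      · exact absurd rfl this
    rcases eq_bot_or_eq_adjoin_sqrt hle2 with hK | hK
    · rw [hK]; exact bot_mem_fieldsT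
    · rw [hK]; exact_mod_cast sqrt_two_mem_fieldsT

end Component

end VArith

namespace VArith

open Real Matrix

/-! ### The geometry of edge chambers -/

namespace FundamentalChamber

variable {n : ℕ} {ι : Type} (M : FundamentalChamber n ι)

/-- The indices `1` and `n` already exhaust the dimension, so the radical is zero. -/
theorem eq_zero_of_form_eq_zero {y : Fin (n + 1) → ℝ} (h : ∀ z, M.form y z = 0) : y = 0 := by
  have hr := QuadraticForm.sigPos_add_sigNeg_add_radical
    (Q := LinearMap.BilinMap.toQuadraticMap M.form)
  rw [M.sigPos_form, M.sigNeg_form, Module.finrank_fintype_fun_eq_card, Fintype.card_fin] at hr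
  have h0 : Module.finrank ℝ (LinearMap.BilinMap.toQuadraticMap M.form).radical = 0 := by lia
  have hbot := Submodule.finrank_eq_zero.1 h0
  have : y ∈ (LinearMap.BilinMap.toQuadraticMap M.form).radical := by
    rw [QuadraticMap.mem_radical_iff']
    constructor
    · rw [LinearMap.BilinMap.toQuadraticMap_apply, h]
    · intro z
      simp only [LinearMap.BilinMap.toQuadraticMap_apply, map_add, LinearMap.add_apply, h,
        M.form_symm z y]
      ring
  rw [hbot] at this
  exact (Submodule.mem_bot ℝ).1 this

/-- Two orthogonal vectors of positive square would span a positive definite plane. -/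
theorem not_pos_of_orthogonal {v z : Fin (n + 1) → ℝ} (hv : 0 < M.form v v)
    (hvz : M.form v z = 0) : ¬ 0 < M.form z z := by
  intro hz
  have hq : ∀ a b : ℝ, M.form (a • v + b • z) (a • v + b • z) =
      a ^ 2 * M.form v v + b ^ 2 * M.form z z := by
    intro a b
    simp only [map_add, map_smul, LinearMap.add_apply, LinearMap.smul_apply, smul_eq_mul,
      M.form_symm z v, hvz]
    ring
  have hli : LinearIndependent ℝ ![v, z] := by
    rw [LinearIndependent.pair_iff]
    intro a b hab
    have := hq a b
    rw [hab] at this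
    simp only [map_zero] at this
    constructor <;> by_contra hne
    · nlinarith [mul_pos (pow_pos (abs_pos.2 hne) 2) hv, sq_abs a, sq_nonneg b,
        mul_nonneg (sq_nonneg b) hz.le]
    · nlinarith [mul_pos (pow_pos (abs_pos.2 hne) 2) hz, sq_abs b, sq_nonneg a,
        mul_nonneg (sq_nonneg a) hv.le]
  have hfr : Module.finrank ℝ (Submodule.span ℝ (Set.range ![v, z])) = 2 := by
    rw [finrank_span_eq_card hli, Fintype.card_fin]
  have := le_sigPos_of_posDef (LinearMap.BilinMap.toQuadraticMap M.form)
    (V := Submodule.span ℝ (Set.range ![v, z])) (by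
      rintro ⟨y, hy⟩ hy0
      rw [Matrix.range_cons_cons_empty, Submodule.mem_span_pair] at hy
      obtain ⟨a, b, rfl⟩ := hy
      rw [QuadraticMap.restrict_apply, LinearMap.BilinMap.toQuadraticMap_apply, hq]
      by_cases ha : a = 0
      · have hb : b ≠ 0 := by
          rintro rfl
          simp [ha] at hy0
        rw [ha]
        have : 0 < b ^ 2 := by positivity
        nlinarith [mul_pos this hz]
      · have : 0 < a ^ 2 := by positivity
        nlinarith [mul_pos this hv, mul_nonneg (sq_nonneg b) hz.le])
  rw [hfr, M.sigPos_form] at this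
  lia

/-- The form is negative definite on the orthogonal complement of a positive vector. -/
theorem form_neg_of_orthogonal {v y : Fin (n + 1) → ℝ} (hv : 0 < M.form v v)
    (hvy : M.form v y = 0) (hy : y ≠ 0) : M.form y y < 0 := by
  refine lt_of_le_of_ne (not_lt.1 (M.not_pos_of_orthogonal hv hvy)) fun hyy => ?_
  obtain ⟨z, hz⟩ : ∃ z, M.form y z ≠ 0 := by
    by_contra! hcon
    exact hy (M.eq_zero_of_form_eq_zero hcon)
  set z' := z - (M.form v z / M.form v v) • v with hz'
  have h1 : M.form v z' = 0 := by
    simp only [hz', map_sub, map_smul, smul_eq_mul]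
    field_simp
    ring
  have h2 : M.form y z' = M.form y z := by
    simp only [hz', map_sub, map_smul, smul_eq_mul, M.form_symm y v, hvy]
    ring
  -- Chosen so that the isotropic `y` corrects the square of `z'` to `1`, giving a positive vector
  -- orthogonal to `v`.
  set t := (1 - M.form z' z') / (2 * M.form y z) with ht
  refine M.not_pos_of_orthogonal hv (z := t • y + z') ?_ ?_
  · simp only [map_add, map_smul, smul_eq_mul, hvy, h1]
    ring
  · have : M.form (t • y + z') (t • y + z') = 1 := by
      simp only [map_add, map_smul, LinearMap.add_apply, LinearMap.smul_apply, smul_eq_mul, hyy,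
        M.form_symm z' y, h2]
      rw [ht]
      field_simp
      ring
    rw [this]
    norm_num

variable [Fintype ι]

theorem quad_gram (x : ι → ℝ) : x ⬝ᵥ M.gram *ᵥ x =
    M.form (∑ i, x i • M.normal i) (∑ i, x i • M.normal i) := by
  rw [quad_eq_sum]
  simp only [map_sum, map_smul, LinearMap.sum_apply, LinearMap.smul_apply, smul_eq_mul,
    Finset.mul_sum, gram, Matrix.of_apply]
  rw [Finset.sum_comm]
  refine Finset.sum_congr rfl fun i _ => Finset.sum_congr rfl fun j _ => ?_
  rw [M.form_symm (M.normal j)]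
  ring

omit [Fintype ι] in
theorem form_normal_self (i : ι) : M.form (M.normal i) (M.normal i) = -2 := M.fundamental.2.1 i

omit [Fintype ι] in
theorem form_normal_nonneg {i j : ι} (h : i ≠ j) : 0 ≤ M.form (M.normal i) (M.normal j) :=
  (M.fundamental.2.2 i j h).1

theorem form_sum (v : Fin (n + 1) → ℝ) (x : ι → ℝ) :
    M.form v (∑ i, x i • M.normal i) = ∑ i, x i * M.form v (M.normal i) := by
  simp only [map_sum, map_smul, smul_eq_mul]

/-- Splitting a relation into positive and negative parts gives one vector `y` with two non-negative
expressions of disjoint support. The normals have non-negative mutual products, so `y² ≥ 0`; as `y`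
is orthogonal to `v`, it is zero. Pairing with an inner point of the face `i` kills all positive
coefficients other than the one at `i`, and `(normal i)² = -2` kills that one. -/
theorem coeff_nonpos {v : Fin (n + 1) → ℝ} (hv : 0 < M.form v v) {c : ι → ℝ}
    (hc : ∀ i, M.form v (M.normal i) ≠ 0 → c i = 0) (h0 : ∑ i, c i • M.normal i = 0) (i : ι) :
    c i ≤ 0 := by
  have hpm : ∀ i, max (c i) 0 - max (-c i) 0 = c i := fun i => by
    rcases le_total (c i) 0 with h | h
    · rw [max_eq_right h, max_eq_left (by linarith)]; ring
    · rw [max_eq_left h, max_eq_right (by linarith)]; ring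
  have hmul : ∀ i, max (c i) 0 * max (-c i) 0 = 0 := fun i => by
    rcases le_total (c i) 0 with h | h
    · rw [max_eq_right h]; ring
    · rw [max_eq_right (by linarith : -c i ≤ 0)]; ring
  set y := ∑ i, max (c i) 0 • M.normal i with hy
  have hy' : y = ∑ i, max (-c i) 0 • M.normal i := by
    rw [← sub_eq_zero, hy, ← Finset.sum_sub_distrib, ← h0]
    exact Finset.sum_congr rfl fun i _ => by rw [← sub_smul, hpm]
  have hvy : M.form v y = 0 := by
    rw [hy, form_sum]
    refine Finset.sum_eq_zero fun i _ => ?_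
    by_cases h : M.form v (M.normal i) = 0
    · rw [h, mul_zero]
    · rw [hc i h]; simp
  have hyy : 0 ≤ M.form y y := by
    nth_rewrite 2 [hy']
    rw [form_sum, hy]
    refine Finset.sum_nonneg fun j _ => ?_
    rw [M.form_symm, form_sum, Finset.mul_sum]
    refine Finset.sum_nonneg fun i _ => ?_
    by_cases hij : i = j
    · subst hij
      rw [← mul_assoc, mul_comm (max (-c i) 0), hmul, zero_mul]
    · exact mul_nonneg (le_max_right _ _) (mul_nonneg (le_max_right _ _)
        (M.form_normal_nonneg (Ne.symm hij)))
  have hy0 : y = 0 := by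
    by_contra hne
    exact absurd (M.form_neg_of_orthogonal hv hvy hne) (not_lt.2 hyy)
  obtain ⟨x, -, -, hxi, hxj⟩ := M.facet i
  have hsum : ∑ j, max (c j) 0 * M.form x (M.normal j) = 0 := by
    rw [← form_sum, ← hy, hy0, map_zero]
  have hnn : ∀ j ∈ Finset.univ, 0 ≤ max (c j) 0 * M.form x (M.normal j) := fun j _ => by
    by_cases hji : j = i
    · rw [hji, hxi, mul_zero]
    · exact mul_nonneg (le_max_right _ _) (hxj j hji).le
  have hz := (Finset.sum_eq_zero_iff_of_nonneg hnn).1 hsum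
  have hz' : ∀ j, j ≠ i → max (c j) 0 = 0 := fun j hj =>
    (mul_eq_zero.1 (hz j (Finset.mem_univ j))).resolve_right (hxj j hj).ne'
  have hyi : y = max (c i) 0 • M.normal i := by
    rw [hy]
    exact Fintype.sum_eq_single i fun j hj => by rw [hz' j hj, zero_smul]
  have hf : M.form y (M.normal i) = 0 := by rw [hy0]; simp
  rw [hyi, map_smul, LinearMap.smul_apply, M.form_normal_self, smul_eq_mul] at hf
  have := le_max_left (c i) 0
  linarith

/-- The normals of the faces through a finite point are linearly independent. -/
theorem coeff_eq_zero {v : Fin (n + 1) → ℝ} (hv : 0 < M.form v v) {c : ι → ℝ}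
    (hc : ∀ i, M.form v (M.normal i) ≠ 0 → c i = 0) (h0 : ∑ i, c i • M.normal i = 0) (i : ι) :
    c i = 0 := by
  refine le_antisymm (M.coeff_nonpos hv hc h0 i) ?_
  have := M.coeff_nonpos hv (c := fun i => -c i) (fun i hi => by rw [hc i hi, neg_zero])
    (by simp only [neg_smul, Finset.sum_neg_distrib, h0, neg_zero]) i
  linarith

omit [Fintype ι] in
theorem IsEdge.symm {M : FundamentalChamber n ι} {v w : Fin (n + 1) → ℝ} (h : M.IsEdge v w) :
    M.IsEdge w v := by
  obtain ⟨hv, hw, hne, hx⟩ := h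
  refine ⟨hw, hv, fun c hc => ?_, fun x hx' => ?_⟩
  · have hc0 : c ≠ 0 := by
      rintro rfl
      have := hv.1.1
      rw [hc] at this
      simp at this
    exact hne c⁻¹ (by rw [hc, smul_smul, inv_mul_cancel₀ hc0, one_smul])
  · obtain ⟨a, b, hab⟩ := hx x fun i h1 h2 => hx' i h2 h1
    exact ⟨b, a, hab.trans (add_comm _ _)⟩

omit [Fintype ι] in
theorem IsEdge.exists_face {M : FundamentalChamber n ι} {v w : Fin (n + 1) → ℝ}
    (h : M.IsEdge v w) : ∃ i, M.form v (M.normal i) = 0 ∧ M.form w (M.normal i) ≠ 0 := by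
  by_contra! hcon
  obtain ⟨c, hc⟩ := h.1.2 w hcon
  exact h.2.2.1 c hc

/-- A combination of the normals `i` and `j` is orthogonal to both `v` and `w`, hence lies in the
span of the normals of the faces containing the edge. This is a relation between normals at `v`, so
its coefficients vanish. -/
theorem IsEdge.face_unique {M : FundamentalChamber n ι} {v w : Fin (n + 1) → ℝ}
    (h : M.IsEdge v w) {i j : ι} (hi : M.form v (M.normal i) = 0) (hi' : M.form w (M.normal i) ≠ 0)
    (hj : M.form v (M.normal j) = 0) (hj' : M.form w (M.normal j) ≠ 0) : i = j := by
  classical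
  by_contra hij
  set y := M.form w (M.normal j) • M.normal i - M.form w (M.normal i) • M.normal j with hy
  let S := {k : ι // M.form v (M.normal k) = 0 ∧ M.form w (M.normal k) = 0}
  -- Duality: the common kernel of the functionals of the faces through the edge is spanned by `v`
  -- and `w`, where the functional of `y` vanishes.
  have hmem : M.form y ∈ Submodule.span ℝ (Set.range fun k : S => M.form (M.normal k)) := by
    refine mem_span_of_iInf_ker_le_ker ?_
    intro x hx
    simp only [Submodule.mem_iInf, LinearMap.mem_ker] at hx ⊢
    obtain ⟨a, b, rfl⟩ := h.2.2.2 x fun k h1 h2 => by rw [M.form_symm]; exact hx ⟨k, h1, h2⟩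
    rw [M.form_symm]
    simp only [hy, map_sub, map_smul, map_add, LinearMap.add_apply, LinearMap.smul_apply,
      smul_eq_mul, hi, hj]
    ring
  obtain ⟨d, hd⟩ := (Submodule.mem_span_range_iff_exists_fun ℝ).1 hmem
  have hyd : y = ∑ k : S, d k • M.normal k := by
    rw [← sub_eq_zero]
    refine M.eq_zero_of_form_eq_zero fun z => ?_
    rw [map_sub, ← hd]
    simp only [map_sum, map_smul, sub_self, LinearMap.zero_apply]
  let c : ι → ℝ := fun k => (if k = i then M.form w (M.normal j) else 0) -
    (if k = j then M.form w (M.normal i) else 0) -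
    (if hk : M.form v (M.normal k) = 0 ∧ M.form w (M.normal k) = 0 then d ⟨k, hk⟩ else 0)
  have hc0 : ∑ k, c k • M.normal k = 0 := by
    simp only [c, sub_smul, Finset.sum_sub_distrib, ite_smul, zero_smul, Finset.sum_ite_eq',
      Finset.mem_univ, if_true]
    rw [← hy, hyd, sub_eq_zero]
    symm
    refine (Fintype.sum_of_injective (fun k : S => (k : ι)) Subtype.val_injective _ _ ?_ ?_).symm
    · intro k hk
      rw [dif_neg, zero_smul]
      exact fun h => hk ⟨⟨k, h⟩, rfl⟩
    · intro k
      rw [dif_pos k.2]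
  have := M.coeff_eq_zero h.1.1.1 (c := c) (fun k hk => by
    have h1 : k ≠ i := fun h => hk (h ▸ hi)
    have h2 : k ≠ j := fun h => hk (h ▸ hj)
    simp [c, h1, h2, hk]) hc0 i
  simp only [c, if_true, if_neg hij, hi'] at this
  simp only [and_false, dif_neg, not_false_iff, sub_zero] at this
  exact hj' this

/-- The Gram matrix of an edge chamber is an edge matrix. -/
theorem IsEdgeChamber.exists_isEdgeMatrix {M : FundamentalChamber n ι} (hM : M.IsEdgeChamber) :
    ∃ e₁ e₂, IsEdgeMatrix M.gram e₁ e₂ := by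
  obtain ⟨v, w, h, hface⟩ := hM
  obtain ⟨e₁, h1, h1'⟩ := h.exists_face
  obtain ⟨e₂, h2, h2'⟩ := h.symm.exists_face
  have key : ∀ (v w : Fin (n + 1) → ℝ) (e : ι), M.IsEdge v w →
      (∀ i, M.form v (M.normal i) = 0 ∨ M.form w (M.normal i) = 0) →
      M.form w (M.normal e) = 0 → M.form v (M.normal e) ≠ 0 →
      ∀ x : ι → ℝ, x e = 0 → ∀ i, M.form v (M.normal i) ≠ 0 → x i = 0 := by
    intro v w e h hface he he' x hx i hi
    rw [h.symm.face_unique ((hface i).resolve_left hi) hi he he', hx]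
  have key2 : ∀ (v w : Fin (n + 1) → ℝ) (e : ι), M.IsEdge v w →
      (∀ i, M.form v (M.normal i) = 0 ∨ M.form w (M.normal i) = 0) →
      M.form w (M.normal e) = 0 → M.form v (M.normal e) ≠ 0 →
      ∀ x : ι → ℝ, x e = 0 → x ≠ 0 → x ⬝ᵥ M.gram *ᵥ x < 0 := by
    intro v w e h hface he he' x hx hx0
    have hz := key v w e h hface he he' x hx
    rw [M.quad_gram]
    refine M.form_neg_of_orthogonal h.1.1.1 ?_ fun h0 => ?_
    · rw [form_sum]
      refine Finset.sum_eq_zero fun i _ => ?_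
      by_cases hi : M.form v (M.normal i) = 0
      · rw [hi, mul_zero]
      · rw [hz i hi, zero_mul]
    · exact hx0 (funext fun i => M.coeff_eq_zero h.1.1.1 hz h0 i)
  refine ⟨e₁, e₂, ?_, key2 w v e₁ h.symm (fun i => (hface i).symm) h1 h1',
    key2 v w e₂ h hface h2 h2', fun x hx => ?_⟩
  · rintro rfl
    exact h2' h1
  · set y := ∑ i, x i • M.normal i with hy
    have hyn : ∀ i, M.form y (M.normal i) = 0 := fun i => by
      have := congrFun hx i
      rw [M.form_symm, hy, form_sum]
      rw [Pi.zero_apply] at this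
      rw [← this]
      exact Finset.sum_congr rfl fun j _ => by rw [mul_comm]; rfl
    -- A vector orthogonal to all normals is a multiple of the vertex `v`; since `v` does not lie on
    -- the face `e₂`, the multiple is zero.
    obtain ⟨c, hc⟩ := h.1.2 y fun i _ => hyn i
    have hc0 : c = 0 := by
      have := hyn e₂
      rw [hc, map_smul, LinearMap.smul_apply, smul_eq_mul, mul_eq_zero] at this
      exact this.resolve_right h2'
    have hy0 : y = 0 := by rw [hc, hc0, zero_smul]
    have hz : M.form v y = x e₂ * M.form v (M.normal e₂) := by
      rw [hy, form_sum]
      refine Fintype.sum_eq_single e₂ fun i hi => ?_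
      by_cases hvi : M.form v (M.normal i) = 0
      · rw [hvi, mul_zero]
      · exact absurd (h.symm.face_unique ((hface i).resolve_left hvi) hvi h2 h2') hi
    rw [hy0, map_zero] at hz
    have hxe : x e₂ = 0 := (mul_eq_zero.1 hz.symm).resolve_right h2'
    exact funext fun i => M.coeff_eq_zero h.1.1.1 (key v w e₂ h hface h2 h2' x hxe) hy0 i

end FundamentalChamber

end VArith

namespace VArith

open Real Matrix

/-! ### Edge chambers from edge matrices -/

section EdgeVectors

variable {ι : Type} [Fintype ι] {B : Matrix ι ι ℝ}

theorem dotProduct_mulVec_comm (hB : B.IsSymm) (x y : ι → ℝ) :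
    x ⬝ᵥ B *ᵥ y = y ⬝ᵥ B *ᵥ x := by
  rw [dotProduct_mulVec, ← mulVec_transpose, hB.eq, dotProduct_comm]

theorem exists_mulVec_eq (hB : ∀ x, B *ᵥ x = 0 → x = 0) (y : ι → ℝ) : ∃ x, B *ᵥ x = y := by
  have hinj : Function.Injective B.mulVecLin :=
    (injective_iff_map_eq_zero _).2 fun x hx => hB x hx
  exact LinearMap.injective_iff_surjective.1 hinj y

theorem eq_of_mulVec_eq (hB : ∀ x, B *ᵥ x = 0 → x = 0) {x y : ι → ℝ} (h : B *ᵥ x = B *ᵥ y) :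
    x = y :=
  sub_eq_zero.1 (hB _ (by rw [mulVec_sub, h, sub_self]))

variable {e₁ e₂ : ι} (hE : IsEdgeMatrix B e₁ e₂) (hB : IsFundamental B) (hu : 2 < B e₁ e₂)

include hE hB hu in
theorem IsEdgeMatrix.exists_pos : ∃ p : ι → ℝ, 0 < p ⬝ᵥ B *ᵥ p := by
  obtain ⟨p, -, -, -, hp⟩ := exists_pair_vector hB.1 hB.2.1 hE.ne 1 1
  exact ⟨p, by rw [hp]; linarith⟩

include hE hB hu in
theorem IsEdgeMatrix.isHyperbolic : IsHyperbolic B := by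
  obtain ⟨q, hq⟩ := hE.exists_pos hB hu
  refine isHyperbolic_of_pos hq e₁ fun z hz => ?_
  rcases eq_or_ne z 0 with rfl | h0
  · simp
  · exact (hE.neg_left z hz h0).le

/-- Vectors with a negative definite complement that pair non-negatively with the others. -/
theorem exists_vertex_vector [DecidableEq ι] {e : ι}
    (hneg : ∀ x : ι → ℝ, x e = 0 → x ≠ 0 → x ⬝ᵥ B *ᵥ x < 0)
    (hnd : ∀ x, B *ᵥ x = 0 → x = 0) (hB : IsFundamental B) (hp : ∃ p : ι → ℝ, 0 < p ⬝ᵥ B *ᵥ p) :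
    ∃ v : ι → ℝ, B *ᵥ v = Pi.single e 1 ∧ 0 < v e ∧ ∀ i, 0 ≤ v i := by
  obtain ⟨v, hv⟩ := exists_mulVec_eq hnd (Pi.single e 1)
  have hxv : ∀ x : ι → ℝ, x ⬝ᵥ B *ᵥ v = x e := fun x => by rw [hv]; simp
  have hvx : ∀ x : ι → ℝ, v ⬝ᵥ B *ᵥ x = x e := fun x => by
    rw [dotProduct_mulVec_comm hB.1, hxv]
  have hv0 : v ≠ 0 := by
    rintro rfl
    have := congrFun hv e
    simp at this
  have hpos : 0 < v e := by
    rcases lt_trichotomy (v e) 0 with h | h | h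
    · obtain ⟨p, hp⟩ := hp
      -- Since the orthogonal complement of `v` is the hyperplane of vectors with zero coordinate at
      -- `e`, this projects the positive vector `p` into it; if `v² = v e < 0`, the square grows and
      -- contradicts `hneg`.
      set c := p e / v e with hc
      have hce : c * v e = p e := div_mul_cancel₀ _ h.ne
      have h1 : (p - c • v) e = 0 := by simp [hce]
      have h2 : (p - c • v) ⬝ᵥ B *ᵥ (p - c • v) = p ⬝ᵥ B *ᵥ p - c ^ 2 * v e := by
        simp only [mulVec_sub, mulVec_smul, dotProduct_sub, dotProduct_smul, hxv, h1,
          sub_dotProduct, smul_dotProduct, hvx, smul_eq_mul]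
        linear_combination c * hce
      have h3 : 0 < (p - c • v) ⬝ᵥ B *ᵥ (p - c • v) := by
        rw [h2]; nlinarith [mul_nonneg (sq_nonneg c) (neg_pos.2 h).le]
      have h4 : p - c • v ≠ 0 := by
        intro h0; rw [h0] at h3; simp at h3
      exact absurd (hneg _ h1 h4) (not_lt.2 h3.le)
    · have := hneg v h hv0
      rw [hxv, h] at this
      exact absurd this (lt_irrefl 0)
    · exact h
  refine ⟨v, hv, hpos, ?_⟩
  set m : ι → ℝ := fun i => max (-v i) 0 with hm
  have hsplit : ∀ i, v i = max (v i) 0 - m i := fun i => by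
    rcases le_total (v i) 0 with h | h
    · simp [hm, h]
    · simp [hm, h]
  have hme : m e = 0 := by simp [hm, hpos.le]
  -- `m` and `v + m` are the negative and positive parts of `v`, with disjoint supports, so only
  -- non-negative off-diagonal entries contribute. As `m` is orthogonal to `v`, its own square is
  -- non-negative and `m = 0`.
  have h1 : 0 ≤ m ⬝ᵥ B *ᵥ (v + m) := by
    change 0 ≤ ∑ i, m i * ∑ j, B i j * (v + m) j
    refine Finset.sum_nonneg fun i _ => ?_
    rw [Finset.mul_sum]
    refine Finset.sum_nonneg fun j _ => ?_
    have hj : (v + m) j = max (v j) 0 := by rw [Pi.add_apply, hsplit j, sub_add_cancel, ← hsplit j]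
    rw [hj]
    rcases eq_or_ne i j with rfl | hij
    · rcases le_total (v i) 0 with h | h
      · simp [h]
      · simp [hm, h]
    · exact mul_nonneg (le_max_right _ _) (mul_nonneg (hB.2.2 i j hij).1 (le_max_right _ _))
  rw [mulVec_add, dotProduct_add, hxv, hme, zero_add] at h1
  have hm0 : m = 0 := by
    by_contra h0
    exact absurd (hneg m hme h0) (not_lt.2 h1)
  intro i
  have := congrFun hm0 i
  simp only [hm, Pi.zero_apply, max_eq_right_iff] at this
  linarith

theorem exists_small (a b c d e : ℝ) (ha : 0 < a) (hd : 0 < d) :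
    ∃ ε : ℝ, 0 < ε ∧ 0 < a + ε * b + ε ^ 2 * c ∧ 0 < d + ε * e := by
  have h1 : Filter.Tendsto (fun ε : ℝ => a + ε * b + ε ^ 2 * c) (nhds 0) (nhds a) := by
    have : Continuous fun ε : ℝ => a + ε * b + ε ^ 2 * c := by fun_prop
    simpa using this.tendsto 0
  have h2 : Filter.Tendsto (fun ε : ℝ => d + ε * e) (nhds 0) (nhds d) := by
    have : Continuous fun ε : ℝ => d + ε * e := by fun_prop
    simpa using this.tendsto 0
  have h3 := ((h1.eventually_const_lt ha).and (h2.eventually_const_lt hd)).filter_mono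
    (nhdsWithin_le_nhds (s := Set.Ioi 0))
  obtain ⟨ε, ⟨h4, h5⟩, h6⟩ := (h3.and self_mem_nhdsWithin).exists
  exact ⟨ε, h6, h4, h5⟩

/-- Perturbation of a vertex to an inner point of a face through it. -/
theorem exists_face_point [DecidableEq ι] (hnd : ∀ x, B *ᵥ x = 0 → x = 0) (hB : B.IsSymm) {e i : ι}
    (hi : i ≠ e) {v b : ι → ℝ} (hv : B *ᵥ v = Pi.single e 1) (hve : 0 < v e) (hb : 0 < b e) :
    ∃ x : ι → ℝ, 0 < x ⬝ᵥ B *ᵥ x ∧ 0 < b ⬝ᵥ B *ᵥ x ∧ (B *ᵥ x) i = 0 ∧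
      ∀ j, j ≠ i → 0 < (B *ᵥ x) j := by
  -- The direction `z` stays on the face `i` and moves to the inner side of all other faces.
  obtain ⟨z, hz⟩ := exists_mulVec_eq hnd (1 - Pi.single i 1)
  have hxv : ∀ x : ι → ℝ, x ⬝ᵥ B *ᵥ v = x e := fun x => by rw [hv]; simp
  have hvx : ∀ x : ι → ℝ, v ⬝ᵥ B *ᵥ x = x e := fun x => by
    rw [dotProduct_mulVec_comm hB, hxv]
  obtain ⟨ε, hε, h1, h2⟩ := exists_small (v e) (2 * z e) (z ⬝ᵥ B *ᵥ z) (b e) (b ⬝ᵥ B *ᵥ z) hve hb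
  have hx : ∀ j, (B *ᵥ (v + ε • z)) j = (Pi.single e 1 : ι → ℝ) j +
      ε * (1 - (Pi.single i 1 : ι → ℝ) j) := fun j => by
    rw [mulVec_add, mulVec_smul, hv, hz]; simp
  refine ⟨v + ε • z, ?_, ?_, ?_, fun j hj => ?_⟩
  · simp only [mulVec_add, mulVec_smul, add_dotProduct, dotProduct_add, dotProduct_smul,
      smul_dotProduct, hxv, hvx, smul_eq_mul, Pi.add_apply, Pi.smul_apply]
    linarith
  · simp only [mulVec_add, mulVec_smul, dotProduct_add, dotProduct_smul, hxv, smul_eq_mul]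
    linarith
  · rw [hx]; simp [hi]
  · rw [hx, Pi.single_eq_of_ne hj]
    have : 0 ≤ (Pi.single e 1 : ι → ℝ) j := by
      rw [Pi.single_apply]; split_ifs <;> norm_num
    linarith

end EdgeVectors

section Chamber

variable {n : ℕ} {B : Matrix (Fin (n + 1)) (Fin (n + 1)) ℝ} {e₁ e₂ : Fin (n + 1)}

/-- An edge matrix of full size with a broken edge is the Gram matrix of an edge chamber. -/
theorem IsEdgeMatrix.exists_chamber (hE : IsEdgeMatrix B e₁ e₂) (hB : IsFundamental B)
    (hu : 2 < B e₁ e₂) :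
    ∃ M : FundamentalChamber n (Fin (n + 1)), M.IsEdgeChamber ∧ M.gram = B := by
  have hpos := hE.exists_pos hB hu
  -- The standard basis vectors will serve as normals. The dual basis vectors at `e₂` and `e₁` lie
  -- on all hyperplanes but one and are the ends of the edge.
  obtain ⟨v, hv, hve, hv0⟩ := exists_vertex_vector hE.neg_right hE.nondeg hB hpos
  obtain ⟨w, hw, hwe, hw0⟩ := exists_vertex_vector hE.neg_left hE.nondeg hB hpos
  have hxv : ∀ x, x ⬝ᵥ B *ᵥ v = x e₂ := fun x => by rw [hv]; simp
  have hxw : ∀ x, x ⬝ᵥ B *ᵥ w = x e₁ := fun x => by rw [hw]; simp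
  obtain ⟨Φ, hΦ⟩ : ∃ Φ : LinearMap.BilinForm ℝ (Fin (n + 1) → ℝ), Φ = Matrix.toLinearMap₂' ℝ B :=
    ⟨_, rfl⟩
  have hform : ∀ x y, Φ x y = x ⬝ᵥ B *ᵥ y := fun x y => hΦ ▸ Matrix.toLinearMap₂'_apply' B x y
  have hsingle : ∀ x i, Φ x (Pi.single i 1) = (B *ᵥ x) i := fun x i => by
    rw [hform, dotProduct_mulVec_comm hB.1, single_one_dotProduct]
  have hnonpos : ∀ y : Fin (n + 1) → ℝ, y e₁ = 0 → y ⬝ᵥ B *ᵥ y ≤ 0 := fun y hy => by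
    rcases eq_or_ne y 0 with rfl | h
    · simp
    · exact (hE.neg_left y hy h).le
  have hsig : sigPos (LinearMap.BilinMap.toQuadraticMap (Φ)) = 1 := by
    obtain ⟨p, hp⟩ := hpos
    have := isHyperbolic_of_pos hp e₁ hnonpos
    unfold IsHyperbolic at this
    rw [hΦ]
    convert this
    rfl
  have hrad : (LinearMap.BilinMap.toQuadraticMap (Φ)).radical = ⊥ := by
    rw [eq_bot_iff]
    intro y hy
    rw [QuadraticMap.mem_radical_iff'] at hy
    refine (Submodule.mem_bot ℝ).2 (hE.nondeg y (funext fun i => ?_))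
    have h1 := hy.1
    have h2 := hy.2 (Pi.single i 1)
    simp only [LinearMap.BilinMap.toQuadraticMap_apply, map_add, LinearMap.add_apply, hsingle]
      at h1 h2
    have h3 : Φ (Pi.single i 1) y = (B *ᵥ y) i := by
      rw [hform, single_one_dotProduct]
    rw [h1, h3] at h2
    have h4 : (B *ᵥ y) i = 0 := by linarith
    exact h4
  have hneg : sigNeg (LinearMap.BilinMap.toQuadraticMap (Φ)) = n := by
    have := QuadraticForm.sigPos_add_sigNeg_add_radical
      (Q := LinearMap.BilinMap.toQuadraticMap (Φ))
    rw [hsig, hrad, Module.finrank_fintype_fun_eq_card, Fintype.card_fin, finrank_bot] at this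
    lia
  have hgram : (Matrix.of fun i j => Φ (Pi.single i 1) (Pi.single j 1)) =
      B := by
    ext i j
    rw [of_apply, hform, single_one_dotProduct, mulVec_single_one]
    rfl
  -- This coordinate is the product of `v` and `w`: the two vertices lie in the same half-cone, so
  -- `v + w` can serve as base vector.
  have hvw : 0 < v e₁ := by
    refine lt_of_le_of_ne (hv0 e₁) fun h0 => ?_
    have h1 : ∑ j, B e₁ j * v j = 0 := by
      have := congrFun hv e₁
      rwa [Pi.single_eq_of_ne hE.ne] at this
    have h2 : B e₁ e₂ * v e₂ ≤ ∑ j, B e₁ j * v j := by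
      refine Finset.single_le_sum (f := fun j => B e₁ j * v j) (fun j _ => ?_) (Finset.mem_univ e₂)
      rcases eq_or_ne e₁ j with rfl | hj
      · rw [← h0, mul_zero]
      · exact mul_nonneg (hB.2.2 _ _ hj).1 (hv0 j)
    nlinarith
  have hwv : 0 < w e₂ := by rw [← hxv w, dotProduct_mulVec_comm hB.1, hxw]; exact hvw
  let M : FundamentalChamber n (Fin (n + 1)) :=
    { form := Φ
      form_symm := fun x y => by rw [hform, hform, dotProduct_mulVec_comm hB.1]
      sigPos_form := hsig
      sigNeg_form := hneg
      base := v + w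
      base_pos := by
        rw [hform, mulVec_add, dotProduct_add, hxv, hxw]
        simp only [Pi.add_apply]
        linarith
      normal := fun i => Pi.single i 1
      facet := fun i => by
        simp only [hsingle, hform]
        by_cases hi : i = e₂
        · exact exists_face_point hE.nondeg hB.1 (hi ▸ hE.ne.symm) hw hwe
            (by simp only [Pi.add_apply]; linarith)
        · exact exists_face_point hE.nondeg hB.1 hi hv hve
            (by simp only [Pi.add_apply]; linarith)
      fundamental := by rw [hgram]; exact hB }
  have hM : ∀ x i, M.form x (M.normal i) = (B *ᵥ x) i := hsingle
  have hcar : ∀ x, x ∈ M.carrier ↔ 0 < x ⬝ᵥ B *ᵥ x ∧ 0 < (v + w) ⬝ᵥ B *ᵥ x ∧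
      ∀ i, 0 ≤ (B *ᵥ x) i := fun x => by
    simp only [← hM, ← hform]; rfl
  have hnn : ∀ e i, 0 ≤ (Pi.single e 1 : Fin (n + 1) → ℝ) i := fun e i => by
    rw [Pi.single_apply]; split_ifs <;> norm_num
  have hvert : ∀ (z : Fin (n + 1) → ℝ) (e : Fin (n + 1)), B *ᵥ z = Pi.single e 1 → 0 < z e →
      0 < (v + w) e → M.IsVertex z := by
    intro z e hz hze hbe
    refine ⟨(hcar z).2 ⟨?_, ?_, ?_⟩, fun x hx => ⟨(B *ᵥ x) e, ?_⟩⟩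
    · rw [hz]; simpa using hze
    · rw [hz]; simpa using hbe
    · rw [hz]; exact hnn e
    · simp only [hM, hz] at hx
      refine eq_of_mulVec_eq hE.nondeg (funext fun i => ?_)
      rw [mulVec_smul, hz]
      rcases eq_or_ne i e with rfl | hi
      · simp
      · rw [hx i (Pi.single_eq_of_ne hi 1)]
        simp [hi]
  refine ⟨M, ⟨v, w, ⟨hvert v e₂ hv hve ?_, hvert w e₁ hw hwe ?_, fun c hc => ?_, fun x hx => ?_⟩,
    fun i => ?_⟩, hgram⟩
  · simp only [Pi.add_apply]; linarith
  · simp only [Pi.add_apply]; linarith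
  · have := congrFun (congrArg (B *ᵥ ·) hc) e₁
    simp [mulVec_smul, hv, hw, hE.ne] at this
  · simp only [hM, hv, hw] at hx
    refine ⟨(B *ᵥ x) e₂, (B *ᵥ x) e₁, eq_of_mulVec_eq hE.nondeg (funext fun i => ?_)⟩
    rw [mulVec_add, mulVec_smul, mulVec_smul, hv, hw]
    by_cases h1 : i = e₁
    · subst h1; simp [hE.ne]
    by_cases h2 : i = e₂
    · subst h2; simp [h1]
    rw [hx i (Pi.single_eq_of_ne h2 1) (Pi.single_eq_of_ne h1 1)]
    simp [h1, h2]
  · simp only [hM, hv, hw]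
    by_cases h1 : i = e₁
    · left; exact Pi.single_eq_of_ne (h1 ▸ hE.ne) 1
    · right; exact Pi.single_eq_of_ne h1 1

end Chamber

end VArith

namespace VArith

open Real Matrix

/-! ### Submatrices of V-arithmetic matrices -/

/-- The composite of `σ` with the inclusion into `ℂ` lifts along the algebraic extension, and total
reality of `E` brings the lift back to `ℝ`. -/
theorem exists_extend_embedding {E F : IntermediateField ℚ ℝ} [NumberField E]
    [NumberField.IsTotallyReal E] (hF : F ≤ E) (σ : F →+* ℝ) :
    ∃ τ : E →+* ℝ, ∀ x : F, τ (IntermediateField.inclusion hF x) = σ x := by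
  let : Algebra F ℂ := ((Complex.ofRealHom).comp σ).toAlgebra
  let : Algebra F E := (IntermediateField.inclusion hF).toRingHom.toAlgebra
  have : IsScalarTower ℚ F E := IsScalarTower.of_algebraMap_eq fun x => rfl
  have : Algebra.IsAlgebraic F E := Algebra.IsAlgebraic.tower_top (K := ℚ) F
  let φ : E →ₐ[F] ℂ := IsAlgClosed.lift
  have hreal : NumberField.ComplexEmbedding.IsReal (φ : E →+* ℂ) := by
    have := NumberField.IsTotallyReal.isReal (NumberField.InfinitePlace.mk (φ : E →+* ℂ))
    rwa [NumberField.InfinitePlace.isReal_mk_iff] at this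
  refine ⟨hreal.embedding, fun x => ?_⟩
  have h1 := NumberField.ComplexEmbedding.IsReal.coe_embedding_apply hreal
    (IntermediateField.inclusion hF x)
  have h2 : φ (IntermediateField.inclusion hF x) = ((σ x : ℝ) : ℂ) := φ.commutes x
  have h3 : ((hreal.embedding (IntermediateField.inclusion hF x) : ℝ) : ℂ) = ((σ x : ℝ) : ℂ) :=
    h1.trans h2
  exact_mod_cast h3

section Submatrix

variable {ι κ : Type} [Fintype ι] [Fintype κ] {A : Matrix ι ι ℝ} {f : κ → ι}

omit [Fintype ι] [Fintype κ] in
theorem IsFundamental.submatrix (h : IsFundamental A) (hf : Function.Injective f) :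
    IsFundamental (A.submatrix f f) :=
  ⟨h.1.submatrix f, fun i => h.2.1 (f i), fun i j hij => h.2.2 (f i) (f j) (hf.ne hij)⟩

omit [Fintype ι] [Fintype κ] in
theorem entryField_submatrix_le (A : Matrix ι ι ℝ) (f : κ → ι) :
    entryField (A.submatrix f f) ≤ entryField A := by
  rw [entryField, IntermediateField.adjoin_le_iff]
  rintro x ⟨i, j, rfl⟩
  exact entry_mem_entryField A (f i) (f j)

omit [Fintype ι] [Fintype κ] in
theorem groundField_submatrix_le (A : Matrix ι ι ℝ) (f : κ → ι) :
    groundField (A.submatrix f f) ≤ groundField A := by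
  rw [groundField, IntermediateField.adjoin_le_iff]
  rintro x ⟨m, i, rfl⟩
  exact cyclicProduct_mem_groundField A (f ∘ i)

/-- An embedding of the smaller field of entries extends to the larger one and still moves the
larger ground field; the conjugate of the whole matrix is strictly negative definite, hence so is
its restriction. -/
theorem IsVArithmetic.submatrix (h : IsVArithmetic A) (hA : ∀ x, A *ᵥ x = 0 → x = 0)
    (hf : Function.Injective f) (hyp : IsHyperbolic (A.submatrix f f)) :
    IsVArithmetic (A.submatrix f f) := by
  have := h.numberField
  have := h.totallyReal
  have hle := entryField_submatrix_le A f
  let : Algebra (entryField (A.submatrix f f)) (entryField A) :=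
    (IntermediateField.inclusion hle).toRingHom.toAlgebra
  have hnf : NumberField (entryField (A.submatrix f f)) :=
    { to_charZero := inferInstance
      to_finiteDimensional := FiniteDimensional.of_injective
        (IntermediateField.inclusion hle).toLinearMap (IntermediateField.inclusion hle).injective }
  refine ⟨h.fundamental.submatrix hf, hyp, fun m i => h.integral m (f ∘ i), hnf,
    NumberField.IsTotallyReal.of_algebra _ (entryField A), ?_⟩
  rintro σ ⟨x, hx, hσx⟩ w hw
  obtain ⟨τ, hτ⟩ := exists_extend_embedding hle σ
  have hneg := h.conjugate_neg hA τ
    ⟨IntermediateField.inclusion hle x, groundField_submatrix_le A f hx, by rw [hτ]; exact hσx⟩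
  have hc : (conjugate A τ).submatrix f f = conjugate (A.submatrix f f) σ := by
    ext i j
    exact hτ (entry (A.submatrix f f) i j)
  obtain ⟨y, hy, -, hq⟩ := exists_extend (conjugate A τ) hf w
  rw [hc] at hq
  rw [← hq]
  refine hneg y ?_
  rintro rfl
  have : w = 0 := funext fun k => (hy k).symm
  rw [this, mulVec_zero] at hw
  exact hw rfl

/-- Nondegeneracy is not inherited automatically, but the broken edge provides it: a kernel vector
must involve `a`, and subtracting it from a positive vector would give a positive vector without
`a`-coordinate. -/
theorem IsEdgeMatrix.submatrix {a b : κ} (hE : IsEdgeMatrix A (f a) (f b)) (hB : IsFundamental A)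
    (hu : 2 < A (f a) (f b)) (hf : Function.Injective f) :
    IsEdgeMatrix (A.submatrix f f) a b := by
  have hab : a ≠ b := fun h => hE.ne (congrArg f h)
  have key : ∀ c, (∀ x : ι → ℝ, x (f c) = 0 → x ≠ 0 → x ⬝ᵥ A *ᵥ x < 0) →
      ∀ x : κ → ℝ, x c = 0 → x ≠ 0 → x ⬝ᵥ A.submatrix f f *ᵥ x < 0 := by
    intro c hc x hx hx0
    obtain ⟨y, hy, -, hq⟩ := exists_extend A hf x
    rw [← hq]
    refine hc y (by rw [hy, hx]) ?_
    rintro rfl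
    exact hx0 (funext fun k => (hy k).symm)
  refine ⟨hab, key a hE.neg_left, key b hE.neg_right, fun x hx => ?_⟩
  have hB' := hB.submatrix hf
  by_contra hx0
  have hxa : x a ≠ 0 := fun h => by
    have := key a hE.neg_left x h hx0
    rw [hx, dotProduct_zero] at this
    exact lt_irrefl _ this
  obtain ⟨p, -, -, -, hp⟩ := exists_pair_vector hB'.1 hB'.2.1 hab 1 1
  have hp' : 0 < p ⬝ᵥ A.submatrix f f *ᵥ p := by
    rw [hp, submatrix_apply]; linarith
  have hq : (p - (p a / x a) • x) ⬝ᵥ A.submatrix f f *ᵥ (p - (p a / x a) • x) =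
      p ⬝ᵥ A.submatrix f f *ᵥ p := by
    rw [mulVec_sub, mulVec_smul, hx, smul_zero, sub_zero, dotProduct_mulVec_comm hB'.1, mulVec_sub,
      mulVec_smul, hx, smul_zero, sub_zero]
  rw [← hq] at hp'
  refine absurd (key a hE.neg_left _ ?_ ?_) (not_lt.2 hp'.le)
  · simp [hxa]
  · intro h0; rw [h0] at hp'; simp at hp'

end Submatrix

end VArith

namespace VArith

open Real Matrix

/-! ### Edge matrices with a broken edge -/

section Broken

variable {ι : Type} {A : Matrix ι ι ℝ}

theorem submatrix_vecCons (hA : IsFundamental A) (a b c d : ι) :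
    A.submatrix ![a, b, c, d] ![a, b, c, d] =
      !![-2, A a b, A a c, A a d;
         A a b, -2, A b c, A b d;
         A a c, A b c, -2, A c d;
         A a d, A b d, A c d, -2] := by
  ext i j
  fin_cases i <;> fin_cases j <;>
    simp [hA.2.1, hA.1.apply a b, hA.1.apply a c, hA.1.apply a d, hA.1.apply b c, hA.1.apply b d,
      hA.1.apply c d]

/-- The graphs on `e₁`, `e₂`, `f`, `g` that satisfy the restrictions on edge chambers are of one of
the five types, up to an exchange of `e₁` and `e₂` and of `f` and `g`. -/
theorem exists_isGamma (hA : IsFundamental A) {a b c d : ι} {s r k p m : ℕ} (hs2 : 2 ≤ s)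
    (hr2 : 2 ≤ r) (hk2 : 2 ≤ k) (hp2 : 2 ≤ p) (hm2 : 2 ≤ m) (hs : A a c = wt s) (hr : A a d = wt r)
    (hk : A b c = wt k) (hp : A b d = wt p) (hm : A c d = wt m)
    (h1 : s = 2 ∨ r = 2 ∨ m = 2) (h2 : k = 2 ∨ p = 2 ∨ m = 2) (h3 : 3 ≤ s ∨ 3 ≤ k)
    (h4 : 3 ≤ r ∨ 3 ≤ p ∨ 3 ≤ m) :
    ∃ a' b' c' d' : ι, (a' = a ∧ b' = b ∨ a' = b ∧ b' = a) ∧ (c' = c ∧ d' = d ∨ c' = d ∧ d' = c) ∧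
      ∃ i : Fin 5, IsGamma i (A a b) (A.submatrix ![a', b', c', d'] ![a', b', c', d']) := by
  have s1 := hA.1.apply a b
  have s2 := hA.1.apply c d
  simp only [submatrix_vecCons hA]
  -- If `f` and `g` are joined, the right-angle conditions allow each of `e₁`, `e₂` at most one of
  -- them as neighbour (types 2 and 3); otherwise the types 1, 4 and 5 remain.
  by_cases m3 : 3 ≤ m
  · by_cases s3 : 3 ≤ s
    · obtain rfl : r = 2 := by lia
      by_cases k3 : 3 ≤ k
      · obtain rfl : p = 2 := by lia
        refine ⟨a, b, c, d, by simp, by simp, 1, s, k, m, s3, k3, m3, ?_⟩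
        rw [hs, hr, hk, hp, hm, wt_two]
      · obtain rfl : k = 2 := by lia
        refine ⟨b, a, d, c, by simp, by simp, 2, p, s, m, hp2, s3, m3, ?_⟩
        rw [s1, s2, hs, hr, hk, hp, hm, wt_two]
    · obtain rfl : s = 2 := by lia
      obtain rfl : p = 2 := by lia
      refine ⟨a, b, d, c, by simp, by simp, 2, r, k, m, hr2, by lia, m3, ?_⟩
      rw [s2, hs, hr, hk, hp, hm, wt_two]
  obtain rfl : m = 2 := by lia
  rw [wt_two] at hm
  by_cases s3 : 3 ≤ s
  · by_cases r3 : 3 ≤ r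
    · by_cases p3 : 3 ≤ p
      · by_cases k3 : 3 ≤ k
        · refine ⟨a, b, c, d, by simp, by simp, 0, s, k, r, p, s3, k3, r3, p3, ?_⟩
          rw [hs, hr, hk, hp, hm]
        · obtain rfl : k = 2 := by lia
          refine ⟨a, b, d, c, by simp, by simp, 3, r, p, s, r3, hp2, s3, ?_⟩
          rw [s2, hs, hr, hk, hp, hm, wt_two]
      · obtain rfl : p = 2 := by lia
        refine ⟨a, b, c, d, by simp, by simp, 3, s, k, r, s3, hk2, r3, ?_⟩
        rw [hs, hr, hk, hp, hm, wt_two]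
    · obtain rfl : r = 2 := by lia
      by_cases k3 : 3 ≤ k
      · refine ⟨b, a, c, d, by simp, by simp, 3, k, s, p, k3, hs2, by lia, ?_⟩
        rw [s1, hs, hr, hk, hp, hm, wt_two]
      · obtain rfl : k = 2 := by lia
        refine ⟨a, b, c, d, by simp, by simp, 4, s, p, s3, by lia, ?_⟩
        rw [hs, hr, hk, hp, hm, wt_two]
  · obtain rfl : s = 2 := by lia
    by_cases p3 : 3 ≤ p
    · refine ⟨b, a, d, c, by simp, by simp, 3, p, r, k, p3, hr2, by lia, ?_⟩
      rw [s1, s2, hs, hr, hk, hp, hm, wt_two]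
    · obtain rfl : p = 2 := by lia
      refine ⟨a, b, d, c, by simp, by simp, 4, r, k, by lia, by lia, ?_⟩
      rw [s2, hs, hr, hk, hp, hm, wt_two]

variable [Fintype ι]

/-- Three weights that are at least `1` make `disc` non-negative, so a spherical triangle has a
right angle. -/
theorem IsEdgeMatrix.label_eq_two {e₁ e₂ : ι} (hE : IsEdgeMatrix A e₁ e₂) (h : IsVArithmetic A)
    {i j l : ι} (hij : i ≠ j) (hil : i ≠ l) (hjl : j ≠ l) (hi : i ≠ e₁) (hj : j ≠ e₁)
    (hl : l ≠ e₁) {p q r : ℕ} (hp2 : 2 ≤ p) (hq2 : 2 ≤ q) (hr2 : 2 ≤ r) (hp : A i j = wt p)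
    (hq : A i l = wt q) (hr : A j l = wt r) : p = 2 ∨ q = 2 ∨ r = 2 := by
  by_contra! hcon
  have hd := hE.disc_neg_of_ne h hij hil hjl hi hj hl
  have f1 : ∀ {p : ℕ}, 2 ≤ p → p ≠ 2 → 1 ≤ wt p := fun {p} h2 hne => by
    have h3 : 3 ≤ p := by lia
    nlinarith [one_le_wt_sq h3, wt_pos h3]
  have hp1 := f1 hp2 hcon.1
  have hq1 := f1 hq2 hcon.2.1
  have hr1 := f1 hr2 hcon.2.2
  rw [hp, hq, hr, disc] at hd
  have h1 : 1 ≤ wt p * wt q := by nlinarith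
  have h2 : 1 ≤ wt p * wt q * wt r := by nlinarith
  nlinarith

/-- The ground field of an edge matrix with a broken edge and a large hyperbolic component is the
ground field of a three-dimensional edge chamber. -/
theorem IsEdgeMatrix.mem_fieldsGamma {C : (gramGraph A).ConnectedComponent} {e₁ e₂ : ι} {t : ℝ}
    (hE : IsEdgeMatrix A e₁ e₂) (h : IsVArithmetic A) (hu : 2 < A e₁ e₂) (ht : A e₁ e₂ < t)
    (hC : IsHyperbolicComponent A C) (hcard : 4 ≤ C.supp.ncard) :
    ∃ i : Fin 5, groundField A ∈ fieldsGamma i t := by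
  have he₁ := hE.left_mem hC
  -- `f` is chosen adjacent to the broken edge, then `g` adjacent to one of the three vertices, so
  -- the four vertices span a connected graph.
  obtain ⟨x, hx, f, hf, -, -, hxf⟩ := exists_adj_of_ncard_lt C {e₁, e₂}
    (by rw [Set.ncard_pair hE.ne]; lia) he₁ (by simp)
  have hS : ({e₁, e₂, f} : Set ι).ncard < C.supp.ncard := by
    refine lt_of_le_of_lt ((Set.ncard_insert_le _ _).trans
      (Nat.succ_le_succ (Set.ncard_insert_le _ _))) ?_
    rw [Set.ncard_singleton]; lia
  obtain ⟨y, hy, g, hg, -, -, hyg⟩ := exists_adj_of_ncard_lt C {e₁, e₂, f} hS he₁ (by simp)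
  rw [gramGraph_adj h.symm] at hxf hyg
  simp only [Set.mem_insert_iff, Set.mem_singleton_iff, not_or] at hx hf hy hg
  obtain ⟨hf1, hf2⟩ := hf
  obtain ⟨hg1, hg2, hgf⟩ := hg
  obtain ⟨s, hs2, hs⟩ := hE.swap.exists_wt h (Ne.symm hf1) hE.ne hf2
  obtain ⟨r, hr2, hr⟩ := hE.swap.exists_wt h (Ne.symm hg1) hE.ne hg2
  obtain ⟨k, hk2, hk⟩ := hE.exists_wt h (Ne.symm hf2) hE.ne.symm hf1
  obtain ⟨p, hp2, hp⟩ := hE.exists_wt h (Ne.symm hg2) hE.ne.symm hg1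
  obtain ⟨m, hm2, hm⟩ := hE.exists_wt h (Ne.symm hgf) hf1 hg1
  have h3 : ∀ {n : ℕ}, 2 ≤ n → wt n ≠ 0 → 3 ≤ n := fun {n} h2 hn => by
    by_contra!
    obtain rfl : n = 2 := by lia
    exact hn wt_two
  obtain ⟨a, b, c, d, hab, hcd, i, hi⟩ := exists_isGamma h.fundamental hs2 hr2 hk2 hp2 hm2 hs hr hk hp
    hm
    (hE.swap.label_eq_two h (Ne.symm hf1) (Ne.symm hg1) (Ne.symm hgf) hE.ne hf2 hg2 hs2 hr2 hm2 hs
      hr hm)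
    (hE.label_eq_two h (Ne.symm hf2) (Ne.symm hg2) (Ne.symm hgf) hE.ne.symm hf1 hg1 hk2 hp2 hm2 hk
      hp hm)
    (by
      rcases hx with rfl | rfl
      · exact Or.inl (h3 hs2 (hs ▸ hxf.2))
      · exact Or.inr (h3 hk2 (hk ▸ hxf.2)))
    (by
      rcases hy with rfl | rfl | rfl
      · exact Or.inl (h3 hr2 (hr ▸ hyg.2))
      · exact Or.inr (Or.inl (h3 hp2 (hp ▸ hyg.2)))
      · exact Or.inr (Or.inr (h3 hm2 (hm ▸ hyg.2))))
  have hEab : IsEdgeMatrix A a b := by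
    rcases hab with ⟨rfl, rfl⟩ | ⟨rfl, rfl⟩
    · exact hE
    · exact hE.swap
  have hAab : A a b = A e₁ e₂ := by
    rcases hab with ⟨rfl, rfl⟩ | ⟨rfl, rfl⟩
    · rfl
    · exact h.symm.apply _ _
  have hinj : Function.Injective ![a, b, c, d] := by
    have hne := hE.ne
    rcases hab with ⟨rfl, rfl⟩ | ⟨rfl, rfl⟩ <;> rcases hcd with ⟨rfl, rfl⟩ | ⟨rfl, rfl⟩ <;>
    · intro k l
      fin_cases k <;> fin_cases l <;> simp [hne, hne.symm, hf1, hf2, hg1, hg2, hgf, Ne.symm hf1,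
        Ne.symm hf2, Ne.symm hg1, Ne.symm hg2, Ne.symm hgf]
  rw [← hAab] at hi hu ht
  have hEB : IsEdgeMatrix (A.submatrix ![a, b, c, d] ![a, b, c, d]) (0 : Fin 4) 1 :=
    IsEdgeMatrix.submatrix (f := ![a, b, c, d]) (a := 0) (b := 1) hEab h.fundamental hu hinj
  have hFB := h.fundamental.submatrix hinj
  have huB : 2 < A.submatrix ![a, b, c, d] ![a, b, c, d] (0 : Fin 4) 1 := hu
  have hVB := h.submatrix hE.nondeg hinj (hEB.isHyperbolic hFB huB)
  obtain ⟨M, hM, hMB⟩ := hEB.exists_chamber hFB huB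
  rw [← hMB] at hVB hi
  refine ⟨i, M, A a b, hM, hVB, hAab ▸ hi, hu, ht, ?_⟩
  -- The matrix and its submatrix contain the same broken edge, and both ground fields are generated
  -- by the square of its weight.
  rw [h.groundField_eq_of_two_lt hE.nondeg hEab.ne hu]
  rw [← hMB] at hEB huB
  rw [hVB.groundField_eq_of_two_lt hEB.nondeg hEB.ne huB, hMB]
  rfl

end Broken

end VArith

namespace VArith

open Real Matrix

/-! ### Degrees -/

theorem exists_cos_eq {b : ℕ} (hb : 0 < b) {k : ℕ} (hk : Nat.Coprime k b) :
    ∃ j ∈ (Finset.range (b / 2 + 1)).filter fun j => Nat.Coprime j b,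
      cos (k * (2 * π / b)) = cos (j * (2 * π / b)) := by
  have hb' : (b : ℝ) ≠ 0 := by positivity
  have hlt := Nat.mod_lt k hb
  have hcop : Nat.Coprime (k % b) b := by
    rwa [Nat.coprime_iff_gcd_eq_one, ← Nat.gcd_rec, Nat.gcd_comm]
  have hcos : cos (k * (2 * π / b)) = cos ((k % b : ℕ) * (2 * π / b)) := by
    have h1 : (k : ℝ) = (k % b : ℕ) + b * (k / b : ℕ) := by exact_mod_cast (Nat.mod_add_div k b).symm
    have h2 : (k : ℝ) * (2 * π / b) = (k % b : ℕ) * (2 * π / b) + (k / b : ℕ) * (2 * π) := by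
      rw [h1]; field_simp
    rw [h2, cos_add_nat_mul_two_pi]
  rcases le_or_gt (k % b) (b / 2) with h | h
  · exact ⟨k % b, by simp only [Finset.mem_filter, Finset.mem_range]; exact ⟨by lia, hcop⟩, hcos⟩
  · refine ⟨b - k % b, ?_, ?_⟩
    · simp only [Finset.mem_filter, Finset.mem_range]
      exact ⟨by lia, (Nat.coprime_self_sub_left hlt.le).2 hcop |> fun h => by simpa using h⟩
    · rw [hcos, Nat.cast_sub hlt.le]
      have : ((b : ℝ) - (k % b : ℕ)) * (2 * π / b) = 2 * π - (k % b : ℕ) * (2 * π / b) := by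
        field_simp
      rw [this, cos_two_pi_sub]

/-- The degree is the number of conjugates, and each of them is `cos (2πj/b)` with `j` prime to `b`,
folded into the range `j ≤ b/2`. -/
theorem finrank_adjoin_cos_le {b : ℕ} (hb : 0 < b) :
    Module.finrank ℚ (IntermediateField.adjoin ℚ {cos (2 * π / b)}) ≤
      ((Finset.range (b / 2 + 1)).filter fun j => Nat.Coprime j b).card := by
  classical
  set c : algReal := awt b ^ 2 / 2 - 1 with hc
  have hcc : (c : ℝ) = cos (2 * π / b) := by
    have : (c : ℝ) = wt b ^ 2 / 2 - 1 := rfl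
    rw [this, wt_sq]; ring
  have hint : IsIntegral ℚ c := Algebra.IsIntegral.isIntegral c
  have hmin : minpoly ℚ (c : ℝ) = minpoly ℚ c :=
    minpoly.algebraMap_eq (algebraMap algReal ℝ).injective c
  have hint' : IsIntegral ℚ (c : ℝ) :=
    (isIntegral_algHom_iff (IntermediateField.val algReal) (IntermediateField.val algReal).injective).2
      hint
  rw [← hcc, IntermediateField.adjoin.finrank hint', hmin,
    ← Polynomial.card_rootSet_eq_natDegree (K := ℂ) (minpoly.irreducible hint).separable
      (IsAlgClosed.splits _), ← Set.toFinset_card]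
  refine (Finset.card_le_card (t := Finset.image (fun j : ℕ => ((cos (j * (2 * π / b)) : ℝ) : ℂ))
    ((Finset.range (b / 2 + 1)).filter fun j => Nat.Coprime j b)) ?_).trans Finset.card_image_le
  intro z hz
  rw [Set.mem_toFinset, ← Algebra.IsAlgebraic.range_eval_eq_rootSet_minpoly_of_splits ℂ
    (fun z => IsAlgClosed.splits _)] at hz
  obtain ⟨σ, rfl⟩ := hz
  obtain ⟨k, -, hk, hσ⟩ := exists_mul_of_embedding σ.toRingHom (N := 2 * b) (by positivity)
  obtain ⟨j, hj, hcos⟩ := exists_cos_eq hb (hk.coprime_mul_left_right)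
  refine Finset.mem_image.2 ⟨j, hj, ?_⟩
  have h1 : σ (awt b) = (cwt k b : ℂ) := hσ b dvd_rfl
  have h2 : σ c = (σ (awt b)) ^ 2 / 2 - 1 := by
    rw [hc, map_sub, map_div₀, map_pow, map_one, map_ofNat]
  change _ = σ c
  rw [h2, h1, ← hcos]
  have := cwt_sq k b
  have h3 : cos (k * (2 * π / b)) = cwt k b ^ 2 / 2 - 1 := by rw [this]; ring
  rw [h3]; push_cast; rfl

/-- The extreme case is `cos (2π/11)`; this is the source of the condition `5 ≤ N`. -/
theorem finrank_le_five_of_mem_fieldsT {K : IntermediateField ℚ ℝ} (hK : K ∈ fieldsT) :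
    Module.finrank ℚ K ≤ 5 := by
  rcases hK with ((hK | ⟨a, -, rfl⟩) | hK | hK) | ⟨b, hb, rfl⟩
  · rw [hK, IntermediateField.finrank_bot]; norm_num
  · exact (finrank_adjoin_sqrt_le a).trans (by norm_num)
  · have : Module.finrank ℚ (IntermediateField.adjoin ℚ {√(2 : ℝ), √(3 : ℝ)}) ≤ 4 := by
      exact_mod_cast finrank_adjoin_sqrt_pair_le 2 3
    rw [hK]
    exact this.trans (by norm_num)
  · have : Module.finrank ℚ (IntermediateField.adjoin ℚ {√(2 : ℝ), √(5 : ℝ)}) ≤ 4 := by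
      exact_mod_cast finrank_adjoin_sqrt_pair_le 2 5
    rw [hK]
    exact this.trans (by norm_num)
  · simp only [Set.mem_insert_iff, Set.mem_singleton_iff] at hb
    rcases hb with rfl | rfl | rfl | rfl | rfl | rfl <;>
      exact (finrank_adjoin_cos_le (by norm_num)).trans (by decide)

/-! ### Finiteness -/

section Finite

variable {ι : Type} [Fintype ι] {A : Matrix ι ι ℝ}

/-- A conjugate of `A i j ^ 2` either equals it or comes from an embedding that moves the ground
field, and then it is less than `4`. -/
theorem IsVArithmetic.norm_apply_le (h : IsVArithmetic A) (hA : ∀ x, A *ᵥ x = 0 → x = 0)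
    {i j : ι} (hij : i ≠ j) {t : ℝ} (ht : A i j ^ 2 ≤ t) (φ : groundField A →+* ℂ) :
    ‖φ ⟨A i j ^ 2, sq_mem_groundField h.symm i j⟩‖ ≤ max t 4 := by
  have := h.numberField
  have := h.totallyReal
  have hle := groundField_le_entryField A
  let _ : Algebra (groundField A) (entryField A) :=
    (IntermediateField.inclusion hle).toRingHom.toAlgebra
  have hnf : NumberField (groundField A) :=
    { to_charZero := inferInstance
      to_finiteDimensional := FiniteDimensional.of_injective
        (IntermediateField.inclusion hle).toLinearMap (IntermediateField.inclusion hle).injective }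
  have htr : NumberField.IsTotallyReal (groundField A) :=
    NumberField.IsTotallyReal.of_algebra _ (entryField A)
  have hφ := NumberField.IsTotallyReal.complexEmbedding_isReal φ
  obtain ⟨τ, hτ⟩ := exists_extend_embedding hle hφ.embedding
  set θ : groundField A := ⟨A i j ^ 2, sq_mem_groundField h.symm i j⟩ with hθ
  have h1 : τ (entry A i j) ^ 2 = hφ.embedding θ := by
    rw [← hτ θ, ← map_pow]; rfl
  rw [← hφ.coe_embedding_apply, ← h1, Complex.norm_real, norm_of_nonneg (sq_nonneg _)]
  by_cases hm : τ (IntermediateField.inclusion hle θ) = (θ : ℝ)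
  · rw [h1, ← hτ θ, hm]
    exact ht.trans (le_max_left _ _)
  · exact (h.conjugate_sq_lt τ (h.conjugate_neg hA τ ⟨_, θ.2, hm⟩) hij).le.trans (le_max_right _ _)

open Polynomial in
-- Bounded conjugates and bounded degree bound the coefficients of the integral minimal polynomial,
-- so that only finitely many polynomials can occur.
theorem IsVArithmetic.exists_minpoly (h : IsVArithmetic A) (hA : ∀ x, A *ᵥ x = 0 → x = 0)
    {i j : ι} (hij : i ≠ j) {t : ℝ} (ht : A i j ^ 2 ≤ t) {N : ℕ}
    (hN : Module.finrank ℚ (groundField A) ≤ N) :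
    ∃ f : ℤ[X], f ≠ 0 ∧ f.natDegree ≤ N ∧
      (∀ n, f.coeff n ∈ Set.Icc (-(⌈max (max t 4) 1 ^ N * (2 : ℝ) ^ N⌉₊ : ℤ))
        ⌈max (max t 4) 1 ^ N * (2 : ℝ) ^ N⌉₊) ∧ aeval (A i j ^ 2) f = 0 := by
  have := h.numberField
  have hle := groundField_le_entryField A
  have hnf : NumberField (groundField A) :=
    { to_charZero := inferInstance
      to_finiteDimensional := FiniteDimensional.of_injective
        (IntermediateField.inclusion hle).toLinearMap (IntermediateField.inclusion hle).injective }
  set θ : groundField A := ⟨A i j ^ 2, sq_mem_groundField h.symm i j⟩ with hθ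
  have hint : IsIntegral ℤ (A i j ^ 2) := by
    have e : cyclicProduct A ![i, j] = A i j ^ 2 := by
      simp [cyclicProduct, Fin.prod_univ_two, h.symm.apply i j]
      ring
    rw [← e]
    exact h.integral 1 ![i, j]
  have hθi : IsIntegral ℤ θ :=
    (isIntegral_algHom_iff ((IntermediateField.val (groundField A)).restrictScalars ℤ)
      (IntermediateField.val (groundField A)).injective).1 hint
  have hq := minpoly.isIntegrallyClosed_eq_field_fractions' ℚ hθi
  refine ⟨minpoly ℤ θ, minpoly.ne_zero hθi, ?_, fun n => ?_, ?_⟩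
  · rw [← (minpoly.monic hθi).natDegree_map (algebraMap ℤ ℚ), ← hq]
    exact (minpoly.natDegree_le θ).trans hN
  · rw [Set.mem_Icc, ← abs_le, ← @Int.cast_le ℝ]
    refine le_trans (Eq.trans_le ?_ <| NumberField.Embeddings.coeff_bdd_of_norm_le
      (h.norm_apply_le hA hij ht) n) (le_trans ?_ (Nat.le_ceil _))
    · rw [hq, coeff_map, eq_intCast, Int.norm_cast_rat, Int.norm_eq_abs, Int.cast_abs]
    · have h1 : ((Module.finrank ℚ (groundField A)).choose
          (Module.finrank ℚ (groundField A) / 2) : ℝ) ≤ 2 ^ N := by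
        exact_mod_cast (Nat.choose_le_two_pow _ _).trans (Nat.pow_le_pow_right (by norm_num) hN)
      have h2 : (1 : ℝ) ≤ max (max t 4) 1 := le_max_right _ _
      gcongr
  · have := congrArg (IntermediateField.val (groundField A)) (minpoly.aeval ℤ θ)
    rw [map_zero] at this
    rw [← this]
    exact (aeval_algHom_apply ((IntermediateField.val (groundField A)).restrictScalars ℤ) θ
      (minpoly ℤ θ)).trans rfl

end Finite

/-! ### Three-dimensional edge chambers with four faces -/

section Gamma

variable {i : Fin 5} {u t : ℝ} {A : Matrix (Fin 4) (Fin 4) ℝ}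

theorem IsGamma.apply_zero_one (h : IsGamma i u A) : A 0 1 = u := by
  fin_cases i
  · obtain ⟨s, k, r, p, -, -, -, -, rfl⟩ := h; simp
  · obtain ⟨s, k, p, -, -, -, rfl⟩ := h; simp
  · obtain ⟨s, k, r, -, -, -, rfl⟩ := h; simp
  · obtain ⟨s, k, r, -, -, -, rfl⟩ := h; simp
  · obtain ⟨s, k, -, -, rfl⟩ := h; simp

theorem IsGamma.hasMinimality (h : IsGamma i u A) (hu : 2 < u) (ht : u < t) :
    HasMinimality A t := by
  have key : ∀ {m : ℕ}, 2 ≤ m → wt m < t := fun hm => (wt_lt_two hm).trans (hu.trans ht)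
  have h0 : (0 : ℝ) < t := by linarith
  have h1 : (-2 : ℝ) < t := by linarith
  intro a b
  fin_cases i
  · obtain ⟨s, k, r, p, hs, hk, hr, hp, rfl⟩ := h
    have := key (Nat.le_of_succ_le hs)
    have := key (Nat.le_of_succ_le hk)
    have := key (Nat.le_of_succ_le hr)
    have := key (Nat.le_of_succ_le hp)
    fin_cases a <;> fin_cases b <;> simpa
  · obtain ⟨s, k, p, hs, hk, hp, rfl⟩ := h
    have := key (Nat.le_of_succ_le hs)
    have := key (Nat.le_of_succ_le hk)
    have := key (Nat.le_of_succ_le hp)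
    fin_cases a <;> fin_cases b <;> simpa
  · obtain ⟨s, k, r, hs, hk, hr, rfl⟩ := h
    have := key hs
    have := key (Nat.le_of_succ_le hk)
    have := key (Nat.le_of_succ_le hr)
    fin_cases a <;> fin_cases b <;> simpa
  · obtain ⟨s, k, r, hs, hk, hr, rfl⟩ := h
    have := key (Nat.le_of_succ_le hs)
    have := key hk
    have := key (Nat.le_of_succ_le hr)
    fin_cases a <;> fin_cases b <;> simpa
  · obtain ⟨k, s, hk, hs, rfl⟩ := h
    have := key (Nat.le_of_succ_le hs)
    have := key (Nat.le_of_succ_le hk)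
    fin_cases a <;> fin_cases b <;> simpa

theorem IsGamma.reachable (h : IsGamma i u A) (hA : A.IsSymm) (hu : 2 < u) (j : Fin 4) :
    (gramGraph A).Reachable 0 j := by
  have key : ∀ a b : Fin 4, a ≠ b → A a b ≠ 0 → (gramGraph A).Reachable a b := fun a b hab h =>
    ((gramGraph_adj hA).2 ⟨hab, h⟩).reachable
  have h01 : (gramGraph A).Reachable 0 1 := key 0 1 (by decide) (by
    rw [h.apply_zero_one]; linarith)
  have hw : ∀ {m : ℕ}, 3 ≤ m → wt m ≠ 0 := fun hm => (wt_pos hm).ne'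
  suffices h' : (gramGraph A).Reachable 0 2 ∧ (gramGraph A).Reachable 0 3 by
    fin_cases j
    · exact SimpleGraph.Reachable.refl _
    · exact h01
    · exact h'.1
    · exact h'.2
  fin_cases i
  · obtain ⟨s, k, r, p, hs, hk, hr, hp, hA'⟩ := h
    exact ⟨key 0 2 (by decide) (by rw [hA']; simpa using hw hs),
      key 0 3 (by decide) (by rw [hA']; simpa using hw hr)⟩
  · obtain ⟨s, k, p, hs, hk, hp, hA'⟩ := h
    have h02 := key 0 2 (by decide) (by rw [hA']; simpa using hw hs)
    exact ⟨h02, h02.trans (key 2 3 (by decide) (by rw [hA']; simpa using hw hp))⟩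
  · obtain ⟨s, k, r, hs, hk, hr, hA'⟩ := h
    -- The label `s` may be `2`, so `f` is reached through `e₂` and `g`.
    have h03 := h01.trans (key 1 3 (by decide) (by rw [hA']; simpa using hw hk))
    exact ⟨h03.trans (key 3 2 (by decide) (by rw [hA']; simpa using hw hr)), h03⟩
  · obtain ⟨s, k, r, hs, hk, hr, hA'⟩ := h
    exact ⟨key 0 2 (by decide) (by rw [hA']; simpa using hw hs),
      key 0 3 (by decide) (by rw [hA']; simpa using hw hr)⟩
  · obtain ⟨k, s, hk, hs, hA'⟩ := h
    exact ⟨key 0 2 (by decide) (by rw [hA']; simpa using hw hk),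
      h01.trans (key 1 3 (by decide) (by rw [hA']; simpa using hw hs))⟩

end Gamma

end VArith

/-! ### Degree constants and finiteness of the sets of fields -/

namespace VArith

open Real Matrix

/-- Identifies the broken edge of a graph of one of the five types with the pair of distinguished
faces, up to order. -/
theorem IsEdgeMatrix.eq_of_two_lt {ι : Type} [Fintype ι] {A : Matrix ι ι ℝ} {e₁ e₂ : ι}
    (hE : IsEdgeMatrix A e₁ e₂) (h : IsVArithmetic A) {i j : ι} (hij : i ≠ j) (hu : 2 < A i j) :
    i = e₁ ∧ j = e₂ ∨ i = e₂ ∧ j = e₁ := by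
  have key : ∀ {e₁ e₂ : ι}, IsEdgeMatrix A e₁ e₂ → i = e₁ ∨ j = e₁ := fun {e₁ e₂} hE => by
    by_contra! hcon
    obtain ⟨m, hm, hm'⟩ := hE.exists_wt h hij hcon.1 hcon.2
    have := wt_lt_two hm
    linarith
  have hne := hE.ne
  rcases key hE with rfl | rfl
  · exact Or.inl ⟨rfl, (key hE.swap).resolve_left hne⟩
  · exact Or.inr ⟨(key hE.swap).resolve_right hne, rfl⟩

theorem IsEdgeMatrix.isHyperbolicComponent {ι : Type} [Fintype ι] {A : Matrix ι ι ℝ} {e₁ e₂ : ι}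
    (hE : IsEdgeMatrix A e₁ e₂) (hA : IsFundamental A) (hu : 2 < A e₁ e₂)
    {C : (gramGraph A).ConnectedComponent} (h1 : e₁ ∈ C.supp) (h2 : e₂ ∈ C.supp) :
    IsHyperbolicComponent A C := by
  classical
  have hE' := IsEdgeMatrix.submatrix (f := fun i : C.supp => (i : ι)) (a := ⟨e₁, h1⟩)
    (b := ⟨e₂, h2⟩) hE hA hu Subtype.val_injective
  exact hE'.isHyperbolic (hA.submatrix Subtype.val_injective) hu

/-- The data of a V-arithmetic edge chamber with four faces that has a broken edge. -/
theorem exists_isEdgeMatrix_of_mem_fieldsGamma {i : Fin 5} {t : ℝ} {K : IntermediateField ℚ ℝ}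
    (hK : K ∈ fieldsGamma i t) : ∃ (M : FundamentalChamber 3 (Fin 4)) (u : ℝ), M.IsEdgeChamber ∧
      IsVArithmetic M.gram ∧ IsGamma i u M.gram ∧ 2 < u ∧ u < t ∧ K = groundField M.gram ∧
      IsEdgeMatrix M.gram 0 1 := by
  obtain ⟨M, u, hM, hV, hG, hu, ht, hK⟩ := hK
  obtain ⟨e₁, e₂, hE⟩ := hM.exists_isEdgeMatrix
  refine ⟨M, u, hM, hV, hG, hu, ht, hK, ?_⟩
  rcases hE.eq_of_two_lt hV (i := 0) (j := 1) (by decide) (by rwa [hG.apply_zero_one]) with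
    ⟨rfl, rfl⟩ | ⟨rfl, rfl⟩
  · exact hE
  · exact hE.swap

/-- The graphs of the five types are connected, so their only component is hyperbolic with four
vertices and tests the degree constant directly. -/
theorem IsDegreeConstant.isGammaDegreeBound {t : ℝ} {N : ℕ} (h : IsDegreeConstant t N) :
    IsGammaDegreeBound t N := by
  classical
  intro i K hK
  obtain ⟨M, u, hM, hV, hG, hu, ht, rfl, hE⟩ := exists_isEdgeMatrix_of_mem_fieldsGamma hK
  by_contra! hN
  let C := (gramGraph M.gram).connectedComponentMk 0
  have hsupp : C.supp = Set.univ := Set.eq_univ_of_forall fun j =>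
    SimpleGraph.ConnectedComponent.sound (hG.reachable hV.symm hu j).symm
  have hmem : ∀ j, j ∈ C.supp := fun j => by rw [hsupp]; trivial
  have hu' : 2 < M.gram 0 1 := by rwa [hG.apply_zero_one]
  have hC : IsHyperbolicComponent M.gram C :=
    hE.isHyperbolicComponent hV.fundamental hu' (hmem 0) (hmem 1)
  have := h 3 (Fin 4) M hM hV (hG.hasMinimality hu ht) hN C hC
  rw [hsupp, Set.ncard_univ, Nat.card_eq_fintype_card, Fintype.card_fin] at this
  exact lt_irrefl _ this

/-- The ground fields of edge chambers with a large hyperbolic component. -/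
theorem groundField_mem {t : ℝ} {n : ℕ} {ι : Type} [Fintype ι] {M : FundamentalChamber n ι}
    (hM : M.IsEdgeChamber) (hV : IsVArithmetic M.gram) (ht : HasMinimality M.gram t)
    {C : (gramGraph M.gram).ConnectedComponent} (hC : IsHyperbolicComponent M.gram C)
    (hcard : 4 ≤ C.supp.ncard) :
    groundField M.gram ∈ fieldsT ∨ ∃ i : Fin 5, groundField M.gram ∈ fieldsGamma i t := by
  obtain ⟨e₁, e₂, hE⟩ := hM.exists_isEdgeMatrix
  rcases le_or_gt (M.gram e₁ e₂) 2 with hu | hu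
  · exact Or.inl (hE.mem_fieldsT hV hu hC hcard)
  · exact Or.inr (hE.mem_fieldsGamma hV hu (ht e₁ e₂) hC hcard)

theorem IsGammaDegreeBound.isDegreeConstant {t : ℝ} {N : ℕ} (hN : 5 ≤ N)
    (h : IsGammaDegreeBound t N) : IsDegreeConstant t N := by
  intro n ι _ M hM hV ht hdeg C hC
  by_contra! hcard
  rcases groundField_mem hM hV ht hC hcard with hK | ⟨i, hK⟩
  · have := finrank_le_five_of_mem_fieldsT hK
    lia
  · have := h i _ hK
    lia

theorem isDegreeConstant_iff {t : ℝ} {N : ℕ} (hN : 5 ≤ N) :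
    IsDegreeConstant t N ↔ IsGammaDegreeBound t N :=
  ⟨fun h => h.isGammaDegreeBound, fun h => h.isDegreeConstant hN⟩

theorem IsGammaDegreeBound.mono {t : ℝ} {N N' : ℕ} (h : IsGammaDegreeBound t N) (hN : N ≤ N') :
    IsGammaDegreeBound t N' := fun i K hK => (h i K hK).trans hN

/-- Each field is `ℚ(u²)`, where `u²` is a root of one of finitely many integral polynomials of
bounded degree and bounded coefficients. -/
theorem IsGammaDegreeBound.finite {t : ℝ} {N : ℕ} (h : IsGammaDegreeBound t N) (i : Fin 5) :
    (fieldsGamma i t).Finite := by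
  classical
  set c : ℤ := (⌈max (max (t ^ 2) 4) 1 ^ N * (2 : ℝ) ^ N⌉₊ : ℤ)
  refine ((Polynomial.bUnion_roots_finite (algebraMap ℤ ℝ) N (Set.finite_Icc (-c) c)).image
    fun x => IntermediateField.adjoin ℚ {x}).subset fun K hK => ?_
  have hdeg := h i K hK
  obtain ⟨M, u, hM, hV, hG, hu, ht, rfl, hE⟩ := exists_isEdgeMatrix_of_mem_fieldsGamma hK
  have h01 := hG.apply_zero_one
  obtain ⟨f, hf0, hfN, hfc, hf⟩ := hV.exists_minpoly hE.nondeg (i := 0) (j := 1) (by decide)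
    (t := t ^ 2) (by rw [h01]; gcongr) hdeg
  refine ⟨M.gram 0 1 ^ 2, ?_, ?_⟩
  · simp only [Set.mem_iUnion]
    exact ⟨f, ⟨hfN, hfc⟩, Polynomial.mem_rootSet.2 ⟨hf0, hf⟩⟩
  · exact (hV.groundField_eq_of_two_lt hE.nondeg hE.ne (by rwa [h01])).symm

theorem exists_isGammaDegreeBound_iff {t : ℝ} :
    (∃ N, IsGammaDegreeBound t N) ↔ ∀ i : Fin 5, (fieldsGamma i t).Finite := by
  refine ⟨fun ⟨N, hN⟩ => hN.finite, fun h => ?_⟩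
  obtain ⟨N, hN⟩ := ((Set.finite_iUnion h).image fun K : IntermediateField ℚ ℝ =>
    Module.finrank ℚ K).bddAbove
  exact ⟨N, fun i K hK => hN ⟨K, Set.mem_iUnion.2 ⟨i, hK⟩, rfl⟩⟩

end VArith

theorem proposition3p1 :
    -- the ground field of an edge chamber with a large hyperbolic component
    (∀ (t : ℝ), 0 < t → ∀ (n : ℕ) (ι : Type) [Fintype ι] (M : VArith.FundamentalChamber n ι),
      M.IsEdgeChamber → VArith.IsVArithmetic M.gram → VArith.HasMinimality M.gram t →
      ∀ C : (VArith.gramGraph M.gram).ConnectedComponent,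
        VArith.IsHyperbolicComponent M.gram C → 4 ≤ C.supp.ncard →
        VArith.groundField M.gram ∈ VArith.fieldsL4 ∨
          VArith.groundField M.gram ∈ VArith.fieldsT ∨
          ∃ i : Fin 5, VArith.groundField M.gram ∈ VArith.fieldsGamma i t) ∧
    -- a constant in the degree theorem exists for `t` iff the five sets are finite for `t`
    (∀ (t : ℝ), 0 < t →
      ((∃ N : ℕ, VArith.IsDegreeConstant t N) ↔
        ∀ i : Fin 5, (VArith.fieldsGamma i t).Finite)) ∧
    -- the constants themselves correspond, without any loss
    (∀ (t : ℝ), 0 < t → ∀ N : ℕ, 5 ≤ N →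
      (VArith.IsDegreeConstant t N ↔ VArith.IsGammaDegreeBound t N)) ∧
    -- the same with effective (computable) constants
    ((∃ N : ℕ → ℕ, Computable N ∧ ∀ t : ℝ, 0 < t → VArith.IsDegreeConstant t (N ⌈t⌉₊)) ↔
      (∀ t : ℝ, 0 < t → ∀ i : Fin 5, (VArith.fieldsGamma i t).Finite) ∧
        ∃ N : ℕ → ℕ, Computable N ∧
          ∀ t : ℝ, 0 < t → VArith.IsGammaDegreeBound t (N ⌈t⌉₊)) := by
  -- The first alternative is not needed separately, since the three fields in `fieldsL4` also
  -- belong to `fieldsT`.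
  refine ⟨fun t _ n ι _ M hM hV ht C hC hcard =>
      Or.inr (VArith.groundField_mem hM hV ht hC hcard),
    fun t _ => ⟨fun ⟨N, hN⟩ => hN.isGammaDegreeBound.finite, fun h => ?_⟩,
    fun t _ N hN => VArith.isDegreeConstant_iff hN, ⟨?_, ?_⟩⟩
  · obtain ⟨N, hN⟩ := VArith.exists_isGammaDegreeBound_iff.2 h
    exact ⟨max N 5, (hN.mono (le_max_left N 5)).isDegreeConstant (le_max_right N 5)⟩
  · rintro ⟨N, hN, h⟩
    exact ⟨fun t ht => (h t ht).isGammaDegreeBound.finite, N, hN,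
      fun t ht => (h t ht).isGammaDegreeBound⟩
  · rintro ⟨-, N, hN, h⟩
    -- Raising the bound to at least `5` absorbs the fields in `fieldsT` and preserves
    -- computability.
    exact ⟨fun k => max (N k) 5, Primrec.nat_max.to_comp.comp hN (Computable.const 5),
      fun t ht => ((h t ht).mono (le_max_left _ 5)).isDegreeConstant (le_max_right _ 5)⟩
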